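/- Let $(\rho^+_k)_{k\ge1}$ and $(\rho^-_k)_{k\ge1}$ be sequences of complex numbers. Assume that for some $0<r\le 1$ $$\sum_{k\ge1}|\rho^+_k|r^k<\infty,\quad \sum_{k\ge1}|\rho^-_k|r^{-k}<\infty,\quad \sum_{k\ge1}k|\rho^+_k|^2r^{2k}<\infty,\quad \sum_{k\ge1}k|\rho^-_k|^2r^{-2k}<\infty .$$ (For $r=1$ these are the classical conditions of Szegő's strong limit theorem; if $\rho^\pm_k=O(r_\pm^k)$ with $0<r_-<\min(1,1/r_+)$, they hold for any $r$ with $r_-<r<1/r_+$, $r\le1$.) On the circle $|z|=r$ put $$R_+(z)=\sum_{k\ge1}\rho^+_kz^k,\qquad R_-(z)=\sum_{k\ge1}\rho^-_kz^{-k},\qquad f(z)=\exp(R_+(z)+R_-(z)),\qquad \check f(z)=f(-z)^{-1},$$ and let $f_k$, $\check f_k$ ($k\in\mathbb Z$) be their Fourier coefficients, indexed so that $f(z)=\sum_{k\in\mathbb Z}f_kz^{-k}$ and $\check f(z)=\sum_{k\in\mathbb Z}\check f_kz^{-k}$, i.e. $f_k=\frac1{2\pi i}\oint_{|z|=r}f(z)z^{k-1}\,dz$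 and likewise for $\check f_k$. Define the Toeplitz+Hankel determinants $$D^1_n=\det[f_{i-j}+f_{i+j}]_{0\le i,j\le n-1},\qquad D^2_m=\det[\check f_{i-j}-\check f_{i+j+2}]_{0\le i,j\le m-1},$$ $$D^3_n=\det[f_{i-j}-f_{i+j+2}]_{0\le i,j\le n-1},\qquad D^4_m=\det[\check f_{i-j}+\check f_{i+j}]_{0\le i,j\le m-1}.$$ Then the two series below converge absolutely, and $$\lim_{n\to\infty}\tfrac12D^1_n=\lim_{m\to\infty}D^2_m=\exp\sum_{k\ge1}\Bigl(k\rho^+_k\rho^-_k+\rho^-_{2k}-\frac{k(\rho^-_k)^2}2\Bigr),$$ $$\lim_{n\to\infty}D^3_n=\lim_{m\to\infty}\tfrac12D^4_m=\exp\sum_{k\ge1}\Bigl(k\rho^+_k\rho^-_k-\rho^-_{2k}-\frac{k(\rho^-_k)^2}2\Bigr).$$ -/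

import Mathlib

open Filter Topology

noncomputable section

namespace ToeplitzHankel

/-- `R₊(z) = ∑_{k ≥ 1} ρ⁺_k z^k`. -/
def Rplus (ρp : ℕ+ → ℂ) (z : ℂ) : ℂ := ∑' k : ℕ+, ρp k * z ^ (k : ℕ)

/-- `R₋(z) = ∑_{k ≥ 1} ρ⁻_k z^{-k}`. -/
def Rminus (ρm : ℕ+ → ℂ) (z : ℂ) : ℂ := ∑' k : ℕ+, ρm k * z⁻¹ ^ (k : ℕ)

/-- The symbol `f(z) = exp (R₊(z) + R₋(z))`. -/
def symbol (ρp ρm : ℕ+ → ℂ) (z : ℂ) : ℂ := Complex.exp (Rplus ρp z + Rminus ρm z)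

/-- The dual symbol, `z ↦ f(-z)⁻¹`. -/
def dualSymbol (ρp ρm : ℕ+ → ℂ) (z : ℂ) : ℂ := (symbol ρp ρm (-z))⁻¹

/-- The Fourier (Laurent) coefficients on the circle `|z| = r` of a function `g`, indexed so that
`g(z) = ∑_{k ∈ ℤ} g_k z^{-k}`; that is, `g_k = (2πi)⁻¹ ∮_{|z| = r} g(z) z^{k-1} dz`. -/
def coeff (r : ℝ) (g : ℂ → ℂ) (k : ℤ) : ℂ :=
  (2 * (Real.pi : ℂ) * Complex.I)⁻¹ * ∮ z in C(0, r), g z * z ^ (k - 1)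

/-- `det [a_{i-j} + a_{i+j}]_{0 ≤ i,j ≤ n-1}`. -/
def detPlus (a : ℤ → ℂ) (n : ℕ) : ℂ :=
  (Matrix.of fun i j : Fin n => a ((i : ℤ) - (j : ℤ)) + a ((i : ℤ) + (j : ℤ))).det

/-- `det [a_{i-j} - a_{i+j+2}]_{0 ≤ i,j ≤ n-1}`. -/
def detMinus (a : ℤ → ℂ) (n : ℕ) : ℂ :=
  (Matrix.of fun i j : Fin n => a ((i : ℤ) - (j : ℤ)) - a ((i : ℤ) + (j : ℤ) + 2)).det

/-- `D¹_n = det [f_{i-j} + f_{i+j}]`. -/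
def D1 (r : ℝ) (ρp ρm : ℕ+ → ℂ) (n : ℕ) : ℂ := detPlus (coeff r (symbol ρp ρm)) n

/-- `D²_m = det [f̌_{i-j} - f̌_{i+j+2}]`, where `f̌(z) = f(-z)⁻¹`. -/
def D2 (r : ℝ) (ρp ρm : ℕ+ → ℂ) (m : ℕ) : ℂ := detMinus (coeff r (dualSymbol ρp ρm)) m

/-- `D³_n = det [f_{i-j} - f_{i+j+2}]`. -/
def D3 (r : ℝ) (ρp ρm : ℕ+ → ℂ) (n : ℕ) : ℂ := detMinus (coeff r (symbol ρp ρm)) n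

/-- `D⁴_m = det [f̌_{i-j} + f̌_{i+j}]`, where `f̌(z) = f(-z)⁻¹`. -/
def D4 (r : ℝ) (ρp ρm : ℕ+ → ℂ) (m : ℕ) : ℂ := detPlus (coeff r (dualSymbol ρp ρm)) m

/-- The `k`-th term of the exponent in the limit of `D¹ / 2` and `D²`. -/
def exponentSp (ρp ρm : ℕ+ → ℂ) (k : ℕ+) : ℂ :=
  (k : ℂ) * ρp k * ρm k + ρm (2 * k) - (k : ℂ) * ρm k ^ 2 / 2

/-- The `k`-th term of the exponent in the limit of `D³` and `D⁴ / 2`. -/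
def exponentO (ρp ρm : ℕ+ → ℂ) (k : ℕ+) : ℂ :=
  (k : ℂ) * ρp k * ρm k - ρm (2 * k) - (k : ℂ) * ρm k ^ 2 / 2

end ToeplitzHankel

end

/-!
# Limits of Toeplitz+Hankel determinants

Write `q = r ^ 2`, and scale `β k = ρ⁺ (k + 1) * r ^ (k + 1)`, `γ k = ρ⁻ (k + 1) * r ^ (-(k + 1))`.
After conjugation by powers of `r`, the matrix `f (i - j) + f (i + j)` has the entries
`⟨e (-i), G (e (-j) + q ^ j e j)⟩`, where `G` is the bilateral Laurent operator with symbol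
`exp (∑ β k t ^ (-(k + 1)) + ∑ γ k t ^ (k + 1))` on `ℓ²(ℤ)`; for `f (i - j) - f (i + j + 2)` the
vector is `e (-j) - q ^ (j + 1) e (j + 2)`. In both cases the vectors span a space that is invariant
under the Laurent operators with symbol `t ^ n + (q / t) ^ n`. The notion `IsFold` captures this;
together with one trace, it is all that is used about the two families.

Finite sections of `low γ * X * up β`, where `low γ` and `up β` are unipotent triangular Toeplitz
operators, have the same determinants as those of `X` (`det_corner_low_mul_up`). This replaces the
matrix by one that differs from the identity by an operator in an ideal, the closure of the
finite-rank operators with respect to the operator norm, the Hilbert–Schmidt norm and the `ℓ¹` norms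
of all diagonals. For such operators the determinants of the finite sections converge
(`DetClass.tendsto`), the limit `opDet` is multiplicative (`opDet_mul`) and invariant under
conjugation (`opDet_conj`), and to first order it is given by the trace (`norm_opDet_sub_le`). All of
this rests on two estimates for `det (1 + A)` in terms of the trace and the Frobenius norm of `A`
only, which come from `|det (1 + A)|² ≤ exp (2 Re tr A + ‖A‖²)` and the Schwarz lemma. Toeplitz
operators with absolutely summable symbol multiply the ideal into itself, and Hankel operators belong
to it under the hypotheses on the coefficients.

The limit is then a product of three factors. The first is the constant `szego β γ` of Szegő's
strong limit theorem, the determinant of a multiplicative commutator. It is bimultiplicative, hence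
equal to `szego (β / m) (γ / m) ^ (m ^ 2)`, and the first-order expansion for large `m` gives
`exp (∑ (k + 1) β k γ k)` (`szego_eq`). The second, `foldedDet`, is the contribution of the reflection.
Completing `exp (∑ γ k t ^ (k + 1))` to a symbol invariant under `t ↦ q / t` shows that it is
multiplicative in `γ` up to a constant of Szegő type (`IsFold.foldedDet_add`), so the same argument
applies; the trace of the Hankel operator composed with the reflection gives the terms `± ρ⁻ (2 k)`,
and the constant of Szegő type gives `-k (ρ⁻ k) ^ 2 / 2` (`IsFold.foldedDet_eq`). The third is `2`
or `1`, since `e 0` is doubled by the first reflection.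

The dual symbol arises from `ρ k ↦ -(-1) ^ k ρ k`, which changes the sign of the terms `ρ⁻ (2 k)`
only. So the statements about `D²` and `D⁴` are those about `D³` and `D¹` for other coefficients.
-/

noncomputable section

namespace ToeplitzHankel

open scoped InnerProductSpace InnerProduct

/-! ### Determinants of perturbations of the identity matrix -/

section MatrixEstimates

open Matrix
open scoped ComplexOrder

variable {ι : Type*} [Fintype ι]

/-- Trace and Frobenius norm of `A` are both at most `a`. -/
def TraceFrobLE (A : Matrix ι ι ℂ) (a : ℝ) : Prop :=
  0 ≤ a ∧ ‖A.trace‖ ≤ a ∧ ∑ i, ∑ j, ‖A i j‖ ^ 2 ≤ a ^ 2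

lemma sum_norm_add_sq_le {κ : Type*} (s : Finset κ) {E : Type*} [SeminormedAddCommGroup E]
    (x y : κ → E) {a b : ℝ} (ha : 0 ≤ a) (hb : 0 ≤ b) (hx : ∑ i ∈ s, ‖x i‖ ^ 2 ≤ a ^ 2)
    (hy : ∑ i ∈ s, ‖y i‖ ^ 2 ≤ b ^ 2) : ∑ i ∈ s, ‖x i + y i‖ ^ 2 ≤ (a + b) ^ 2 := by
  have hcs : ∑ i ∈ s, ‖x i‖ * ‖y i‖ ≤ a * b := by
    refine (Real.sum_mul_le_sqrt_mul_sqrt s _ _).trans ?_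
    gcongr
    · exact Real.sqrt_le_iff.2 ⟨ha, hx⟩
    · exact Real.sqrt_le_iff.2 ⟨hb, hy⟩
  calc ∑ i ∈ s, ‖x i + y i‖ ^ 2 ≤ ∑ i ∈ s, (‖x i‖ ^ 2 + 2 * (‖x i‖ * ‖y i‖) + ‖y i‖ ^ 2) := by
        gcongr with i hi
        calc ‖x i + y i‖ ^ 2 ≤ (‖x i‖ + ‖y i‖) ^ 2 := by gcongr; exact norm_add_le _ _
          _ = _ := by ring
    _ = ∑ i ∈ s, ‖x i‖ ^ 2 + 2 * ∑ i ∈ s, ‖x i‖ * ‖y i‖ + ∑ i ∈ s, ‖y i‖ ^ 2 := by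
        rw [Finset.sum_add_distrib, Finset.sum_add_distrib, Finset.mul_sum]
    _ ≤ (a + b) ^ 2 := by nlinarith

lemma TraceFrobLE.add {A B : Matrix ι ι ℂ} {a b : ℝ} (hA : TraceFrobLE A a)
    (hB : TraceFrobLE B b) : TraceFrobLE (A + B) (a + b) := by
  obtain ⟨ha, hA1, hA2⟩ := hA
  obtain ⟨hb, hB1, hB2⟩ := hB
  refine ⟨by positivity, ?_, ?_⟩
  · rw [trace_add]
    exact (norm_add_le _ _).trans (add_le_add hA1 hB1)
  · have := sum_norm_add_sq_le (Finset.univ ×ˢ Finset.univ : Finset (ι × ι))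
      (fun p => A p.1 p.2) (fun p => B p.1 p.2) ha hb (by rwa [Finset.sum_product])
      (by rwa [Finset.sum_product])
    rwa [Finset.sum_product] at this

lemma TraceFrobLE.smul {A : Matrix ι ι ℂ} {a : ℝ} (hA : TraceFrobLE A a) (z : ℂ) :
    TraceFrobLE (z • A) (‖z‖ * a) := by
  obtain ⟨ha, hA1, hA2⟩ := hA
  refine ⟨by positivity, ?_, ?_⟩
  · rw [trace_smul, norm_smul]; gcongr
  · simp only [Matrix.smul_apply, norm_smul, mul_pow, ← Finset.mul_sum]
    gcongr

lemma TraceFrobLE.mono {A : Matrix ι ι ℂ} {a b : ℝ} (hA : TraceFrobLE A a) (h : a ≤ b) :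
    TraceFrobLE A b :=
  ⟨hA.1.trans h, hA.2.1.trans h, hA.2.2.trans (pow_le_pow_left₀ hA.1 h 2)⟩

/-- `|det (1 + A)|²` is the product of the eigenvalues `λ` of `(1 + A)(1 + A)ᴴ`, and
`λ ≤ exp (λ - 1)`. -/
lemma norm_det_one_add_sq_le [DecidableEq ι] (A : Matrix ι ι ℂ) :
    ‖(1 + A).det‖ ^ 2 ≤ Real.exp (2 * A.trace.re + ∑ i, ∑ j, ‖A i j‖ ^ 2) := by
  set M := 1 + A with hM
  have hP : (M * Mᴴ).PosSemidef := posSemidef_self_mul_conjTranspose M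
  have hdet : ((‖M.det‖ ^ 2 : ℝ) : ℂ) = ((∏ i, hP.1.eigenvalues i : ℝ) : ℂ) := by
    have h1 := hP.1.det_eq_prod_eigenvalues
    rw [det_mul, det_conjTranspose] at h1
    push_cast
    rw [← Complex.mul_conj']
    exact h1
  have htr : ((∑ i, hP.1.eigenvalues i : ℝ) : ℂ)
      = ((Fintype.card ι + (2 * A.trace.re + ∑ i, ∑ j, ‖A i j‖ ^ 2) : ℝ) : ℂ) := by
    have h1 := hP.1.trace_eq_sum_eigenvalues
    push_cast
    have h3 : (A * Aᴴ).trace = ∑ i, ∑ j, (‖A i j‖ : ℂ) ^ 2 := by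
      simp only [trace, diag, mul_apply, conjTranspose_apply, RCLike.star_def, Complex.mul_conj']
    have h4 : (2 * A.trace.re : ℂ) = A.trace + Aᴴ.trace := by
      rw [trace_conjTranspose]
      exact_mod_cast (Complex.add_conj A.trace).symm
    refine h1.symm.trans ?_
    rw [hM, conjTranspose_add, conjTranspose_one, mul_add, mul_one, add_mul, one_mul, trace_add,
      trace_add, trace_add, trace_one, h3, h4]
    ring
  have hdet' : ‖M.det‖ ^ 2 = ∏ i, hP.1.eigenvalues i := by exact_mod_cast hdet
  have htr' : ∑ i, hP.1.eigenvalues i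
      = Fintype.card ι + (2 * A.trace.re + ∑ i, ∑ j, ‖A i j‖ ^ 2) := by exact_mod_cast htr
  calc ‖M.det‖ ^ 2 = ∏ i, hP.1.eigenvalues i := hdet'
    _ ≤ ∏ i, Real.exp (hP.1.eigenvalues i - 1) := by
        refine Finset.prod_le_prod (fun i _ => hP.eigenvalues_nonneg i) fun i _ => ?_
        have := Real.add_one_le_exp (hP.1.eigenvalues i - 1)
        linarith
    _ = Real.exp (∑ i, (hP.1.eigenvalues i - 1)) := (Real.exp_sum _ _).symm
    _ = _ := by
        rw [Finset.sum_sub_distrib, htr']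
        simp

/-- Trace and Frobenius norm bound the determinant, whatever the size of the matrix. -/
lemma TraceFrobLE.norm_det_le [DecidableEq ι] {A : Matrix ι ι ℂ} {a : ℝ} (hA : TraceFrobLE A a) :
    ‖(1 + A).det‖ ≤ Real.exp (a + a ^ 2) := by
  obtain ⟨ha, h1, h2⟩ := hA
  have h := norm_det_one_add_sq_le A
  have h3 : A.trace.re ≤ a := (Complex.re_le_norm _).trans h1
  have h4 : ‖(1 + A).det‖ ^ 2 ≤ Real.exp (a + a ^ 2) ^ 2 := by
    refine h.trans ?_
    rw [← Real.exp_nat_mul]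
    refine Real.exp_le_exp.2 ?_
    push_cast
    nlinarith
  exact (pow_le_pow_iff_left₀ (norm_nonneg _) (Real.exp_nonneg _) two_ne_zero).1 h4

lemma differentiable_det_affine [DecidableEq ι] (A B : Matrix ι ι ℂ) :
    Differentiable ℂ fun z : ℂ => (A + z • B).det := by
  simp only [det_apply', Matrix.add_apply, Matrix.smul_apply, smul_eq_mul]
  fun_prop

/-- A Lipschitz estimate independent of the size of the matrices: the Schwarz lemma for
`z ↦ det (1 + A + z • B)` on the disc of radius `b⁻¹`. -/
lemma norm_det_one_add_add_sub_le [DecidableEq ι] {A B : Matrix ι ι ℂ} {a b : ℝ}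
    (hA : TraceFrobLE A a) (hB : TraceFrobLE B b) (hb : b < 1) :
    ‖(1 + (A + B)).det - (1 + A).det‖ ≤ 2 * Real.exp ((a + 1) + (a + 1) ^ 2) * b := by
  set K := Real.exp ((a + 1) + (a + 1) ^ 2)
  have ha := hA.1
  -- it suffices to treat a slightly larger `b`, which is positive
  have key : ∀ b', b ≤ b' → 0 < b' → b' < 1 →
      ‖(1 + (A + B)).det - (1 + A).det‖ ≤ 2 * K * b' := by
    intro b' hbb h0 h1
    have hbd : ∀ z : ℂ, ‖z‖ ≤ b'⁻¹ → ‖((1 + A) + z • B).det‖ ≤ K := by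
      intro z hz
      rw [add_assoc]
      have := (hA.add ((hB.mono hbb).smul z)).mono (b := a + 1) (by
        gcongr
        calc ‖z‖ * b' ≤ b'⁻¹ * b' := by gcongr
          _ = 1 := inv_mul_cancel₀ h0.ne')
      exact this.norm_det_le
    have h := Complex.dist_le_div_mul_dist_of_mapsTo_ball (c := (0 : ℂ)) (z := 1) (R₁ := b'⁻¹)
      (R₂ := 2 * K) (f := fun z => ((1 + A) + z • B).det)
      (differentiable_det_affine (1 + A) B).differentiableOn
      (by
        intro z hz
        rw [mem_ball_zero_iff] at hz
        rw [Metric.mem_closedBall, dist_eq_norm]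
        refine (norm_sub_le _ _).trans ?_
        have h2 := hbd z hz.le
        have h3 := hbd 0 (by rw [norm_zero]; positivity)
        linarith)
      (by simpa using (one_lt_inv₀ h0).2 h1)
    simpa [dist_eq_norm, add_assoc] using h
  refine ge_of_tendsto (x := 𝓝[>] b) (f := fun b' => 2 * K * b') ?_ ?_
  · exact ((continuous_const.mul continuous_id).tendsto b).mono_left nhdsWithin_le_nhds
  · filter_upwards [self_mem_nhdsWithin, Ioo_mem_nhdsGT hb] with b' h1 h2
    exact key b' (le_of_lt h1) (hB.1.trans_lt h1) h2.2

/-- The Taylor estimate `det (1 + A) = 1 + tr A + O(a²)`, independent of the size of the matrices: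
the second-order Schwarz lemma for `z ↦ det (1 + z • A) - z * tr A` on the disc of radius `a⁻¹`. -/
lemma norm_det_one_add_sub_trace_le [DecidableEq ι] {A : Matrix ι ι ℂ} {a : ℝ}
    (hA : TraceFrobLE A a) (ha1 : a < 1) :
    ‖(1 + A).det - 1 - A.trace‖ ≤ 10 * a ^ 2 := by
  -- it suffices to treat a slightly larger `a`, which is positive
  have key : ∀ b, a ≤ b → 0 < b → b < 1 → ‖(1 + A).det - 1 - A.trace‖ ≤ 10 * b ^ 2 := by
    intro b hab h0 h1
    have hA' := hA.mono hab
    let f : ℂ → ℂ := fun z => (1 + z • A).det - z * A.trace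
    have hf0 : f 0 = 1 := by simp [f]
    have hbd : ∀ z : ℂ, ‖z‖ ≤ b⁻¹ → ‖f z - f 0‖ ≤ 10 := by
      intro z hz
      have hzb : ‖z‖ * b ≤ 1 := by
        calc ‖z‖ * b ≤ b⁻¹ * b := by gcongr
          _ = 1 := inv_mul_cancel₀ h0.ne'
      have h2 := ((hA'.smul z).mono hzb).norm_det_le
      have h3 : ‖z * A.trace‖ ≤ 1 := by
        rw [norm_mul]
        exact (mul_le_mul_of_nonneg_left hA'.2.1 (norm_nonneg _)).trans hzb
      have he : Real.exp (1 + 1 ^ 2) ≤ 8 := by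
        have h4 := Real.exp_one_lt_d9
        have h5 : Real.exp (1 + 1 ^ 2) = Real.exp 1 * Real.exp 1 := by
          rw [← Real.exp_add]; norm_num
        rw [h5]
        nlinarith [Real.exp_pos 1]
      rw [hf0]
      calc ‖(1 + z • A).det - z * A.trace - 1‖
          ≤ ‖(1 + z • A).det‖ + ‖z * A.trace‖ + ‖(1 : ℂ)‖ :=
            (norm_sub_le _ _).trans (by gcongr; exact norm_sub_le _ _)
        _ ≤ 8 + 1 + 1 := by
            gcongr
            · exact h2.trans he
            · simp
        _ = 10 := by norm_num
    have hdiff : Differentiable ℂ f := by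
      have := differentiable_det_affine 1 A
      simp only [f]
      fun_prop
    -- the trace is the derivative of the determinant, so `f` is constant to first order
    have hder : HasDerivAt f 0 0 := by
      set q := (det (1 + (Polynomial.X : Polynomial ℂ) • A.map Polynomial.C)).divX.divX
      have h2 : f = fun z => 1 + q.eval z * z ^ 2 := by
        funext z
        simp only [f, det_one_add_smul z A]
        ring
      rw [h2]
      have h3 := ((q.hasDerivAt 0).mul (hasDerivAt_pow 2 (0 : ℂ))).const_add 1
      simpa using h3
    have h := Complex.dist_le_mul_div_pow_of_mapsTo_ball_of_isLittleO (c := (0 : ℂ)) (z := 1)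
      (R₁ := b⁻¹) (R₂ := 10) (f := f) (n := 1) hdiff.differentiableOn
      (by
        intro z hz
        rw [mem_ball_zero_iff] at hz
        rw [Metric.mem_closedBall, dist_eq_norm]
        exact hbd z hz.le)
      (by
        have := hder.isLittleO.norm_right
        simpa using this)
      (by simpa using (one_lt_inv₀ h0).2 h1)
    have h4 : f 1 - f 0 = (1 + A).det - 1 - A.trace := by
      rw [hf0]; simp [f]; ring
    rw [dist_eq_norm, h4] at h
    simpa using h
  refine ge_of_tendsto (x := 𝓝[>] a) (f := fun b => 10 * b ^ 2) ?_ ?_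
  · exact ((continuous_const.mul (continuous_id.pow 2)).tendsto a).mono_left nhdsWithin_le_nhds
  · filter_upwards [self_mem_nhdsWithin, Ioo_mem_nhdsGT ha1] with b h1 h2
    exact key b (le_of_lt h1) (hA.1.trans_lt h1) h2.2

end MatrixEstimates

/-! ### An operator ideal: Hilbert–Schmidt operators with summable diagonals -/


/-- The Hilbert space `ℓ²(ι)` of complex families indexed by `ι`. -/
abbrev Ell2 (ι : Type) : Type := lp (fun _ : ι => ℂ) 2

/-- The standard basis vector `e i` of `ℓ²(ι)`. -/
def bv {ι : Type} [DecidableEq ι] (i : ι) : Ell2 ι := lp.single 2 i (1 : ℂ)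

/-- Bounded operators on `ℓ²(ℕ)`. -/
abbrev Op : Type := Ell2 ℕ →L[ℂ] Ell2 ℕ

/-- The matrix entry `⟨e i, K e j⟩`. -/
def entry (K : Op) (i j : ℕ) : ℂ := ⟪bv i, K (bv j)⟫_ℂ

section Basic

variable {ι : Type} [DecidableEq ι]

lemma inner_bv_left (i : ι) (x : Ell2 ι) : ⟪bv i, x⟫_ℂ = x i := by
  simp [bv, lp.inner_single_left]

lemma inner_bv_bv (i j : ι) : ⟪bv i, bv j⟫_ℂ = if i = j then 1 else 0 := by
  rw [inner_bv_left]
  simp [bv, Pi.single_apply]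

lemma hasSum_bv (x : Ell2 ι) : HasSum (fun i => x i • bv i) x := by
  simpa only [bv, ← lp.single_smul, smul_eq_mul, mul_one] using
    lp.hasSum_single (p := 2) (by norm_num) x

lemma ext_bv {F : Type*} [NormedAddCommGroup F] [NormedSpace ℂ F] {A B : Ell2 ι →L[ℂ] F}
    (h : ∀ i, A (bv i) = B (bv i)) : A = B := by
  ext x
  have h1 := (hasSum_bv x).mapL A
  have h2 := (hasSum_bv x).mapL B
  simp only [map_smul, h] at h1 h2
  exact h1.unique h2

lemma ext_inner_bv {x y : Ell2 ι} (h : ∀ i, ⟪bv i, x⟫_ℂ = ⟪bv i, y⟫_ℂ) : x = y := by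
  apply lp.ext
  funext i
  simpa only [inner_bv_left] using h i

lemma hasSum_norm_sq (x : Ell2 ι) : HasSum (fun i => ‖⟪bv i, x⟫_ℂ‖ ^ 2) (‖x‖ ^ 2) := by
  have := lp.hasSum_norm (p := 2) (by norm_num) x
  simpa [inner_bv_left] using this

end Basic


lemma sum_norm_inner_bv_sq_le {ι κ : Type} [DecidableEq ι] {σ : κ → ι}
    (hσ : Function.Injective σ) (s : Finset κ) (x : Ell2 ι) :
    ∑ i ∈ s, ‖⟪bv (σ i), x⟫_ℂ‖ ^ 2 ≤ ‖x‖ ^ 2 := by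
  have h := sum_le_hasSum (s.map ⟨σ, hσ⟩) (fun i _ => by positivity) (hasSum_norm_sq x)
  simpa using h

lemma entry_eq_inner_star (K : Op) (i j : ℕ) : entry K i j = ⟪star K (bv i), bv j⟫_ℂ :=
  (ContinuousLinearMap.adjoint_inner_left K (bv j) (bv i)).symm

lemma entry_star (K : Op) (i j : ℕ) : entry (star K) i j = star (entry K j i) := by
  rw [entry_eq_inner_star, star_star, entry, ← inner_conj_symm]
  rfl

lemma entry_add (K L : Op) (i j : ℕ) : entry (K + L) i j = entry K i j + entry L i j := by
  simp [entry]

lemma entry_sub (K L : Op) (i j : ℕ) : entry (K - L) i j = entry K i j - entry L i j := by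
  simp [entry]

lemma entry_smul (z : ℂ) (K : Op) (i j : ℕ) : entry (z • K) i j = z * entry K i j := by
  simp [entry]

lemma entry_one (i j : ℕ) : entry 1 i j = if i = j then 1 else 0 := by
  simp [entry, inner_bv_bv]

lemma entry_mul_eq_inner (K L : Op) (i j : ℕ) :
    entry (K * L) i j = ⟪star K (bv i), L (bv j)⟫_ℂ :=
  (ContinuousLinearMap.adjoint_inner_left K (L (bv j)) (bv i)).symm

lemma norm_entry_mul_le (K L : Op) (i j : ℕ) :
    ‖entry (K * L) i j‖ ≤ ‖star K (bv i)‖ * ‖L (bv j)‖ := by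
  rw [entry_mul_eq_inner]
  exact norm_inner_le_norm _ _

lemma norm_star_op (K : Op) : ‖star K‖ = ‖K‖ :=
  ContinuousLinearMap.adjoint.norm_map K

lemma continuous_entry (i j : ℕ) : Continuous fun K : Op => entry K i j := by
  unfold entry
  fun_prop

/-- `IdealLE K M` says that `K` is a Hilbert–Schmidt operator all of whose diagonals are absolutely
summable, with the operator norm, the Hilbert–Schmidt norm and the `ℓ¹` norms of all diagonals at
most `M`. The condition on all diagonals, rather than on the main one, makes the class stable under
multiplication by Toeplitz operators with absolutely summable symbol. The bound for `star K` follows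
from the one for `K`; it is included to make the definition symmetric. -/
structure IdealLE (K : Op) (M : ℝ) : Prop where
  nonneg : 0 ≤ M
  norm_le : ‖K‖ ≤ M
  hs : ∀ n, ∑ j ∈ Finset.range n, ‖K (bv j)‖ ^ 2 ≤ M ^ 2
  hs_star : ∀ n, ∑ j ∈ Finset.range n, ‖star K (bv j)‖ ^ 2 ≤ M ^ 2
  diag : ∀ p q n, ∑ i ∈ Finset.range n, ‖entry K (i + p) (i + q)‖ ≤ M

namespace IdealLE

variable {K L : Op} {M N : ℝ}

lemma mono (h : IdealLE K M) (hMN : M ≤ N) : IdealLE K N where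
  nonneg := h.nonneg.trans hMN
  norm_le := h.norm_le.trans hMN
  hs n := (h.hs n).trans (pow_le_pow_left₀ h.nonneg hMN 2)
  hs_star n := (h.hs_star n).trans (pow_le_pow_left₀ h.nonneg hMN 2)
  diag p q n := (h.diag p q n).trans hMN

lemma zero : IdealLE 0 0 where
  nonneg := le_rfl
  norm_le := by simp
  hs n := by simp
  hs_star n := by simp
  diag p q n := by simp [entry]

lemma add (hK : IdealLE K M) (hL : IdealLE L N) : IdealLE (K + L) (M + N) where
  nonneg := add_nonneg hK.nonneg hL.nonneg
  norm_le := (norm_add_le _ _).trans (add_le_add hK.norm_le hL.norm_le)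
  hs n := sum_norm_add_sq_le _ _ _ hK.nonneg hL.nonneg (hK.hs n) (hL.hs n)
  hs_star n := by
    rw [star_add]
    exact sum_norm_add_sq_le _ _ _ hK.nonneg hL.nonneg (hK.hs_star n) (hL.hs_star n)
  diag p q n := by
    refine le_trans ?_ (add_le_add (hK.diag p q n) (hL.diag p q n))
    rw [← Finset.sum_add_distrib]
    gcongr
    rw [entry_add]
    exact norm_add_le _ _

lemma smul (hK : IdealLE K M) (z : ℂ) : IdealLE (z • K) (‖z‖ * M) where
  nonneg := mul_nonneg (norm_nonneg _) hK.nonneg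
  norm_le := by rw [norm_smul]; gcongr; exact hK.norm_le
  hs n := by
    simp only [_root_.smul_apply, norm_smul, mul_pow, ← Finset.mul_sum]
    gcongr
    exact hK.hs n
  hs_star n := by
    simp only [star_smul, _root_.smul_apply, norm_smul, mul_pow, ← Finset.mul_sum,
      norm_star]
    gcongr
    exact hK.hs_star n
  diag p q n := by
    simp only [entry_smul, norm_mul, ← Finset.mul_sum]
    gcongr
    exact hK.diag p q n

lemma neg (hK : IdealLE K M) : IdealLE (-K) M := by
  simpa using hK.smul (-1)

lemma sub (hK : IdealLE K M) (hL : IdealLE L N) : IdealLE (K - L) (M + N) := by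
  rw [sub_eq_add_neg]
  exact hK.add hL.neg

lemma star (hK : IdealLE K M) : IdealLE (star K) M where
  nonneg := hK.nonneg
  norm_le := by rw [norm_star_op]; exact hK.norm_le
  hs := hK.hs_star
  hs_star := by rw [star_star]; exact hK.hs
  diag p q n := by
    simp only [entry_star, norm_star]
    exact hK.diag q p n

lemma sum_shift_sq_le {M : ℝ} {f : ℕ → ℝ} (hf : ∀ n, ∑ j ∈ Finset.range n, f j ^ 2 ≤ M ^ 2)
    (p n : ℕ) : ∑ i ∈ Finset.range n, f (i + p) ^ 2 ≤ M ^ 2 := by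
  refine le_trans ?_ (hf (p + n))
  rw [Finset.sum_range_add]
  simp only [add_comm p]
  have : 0 ≤ ∑ x ∈ Finset.range p, f x ^ 2 := Finset.sum_nonneg fun _ _ => sq_nonneg _
  linarith

lemma mul (hK : IdealLE K M) (hL : IdealLE L N) : IdealLE (K * L) (M * N) where
  nonneg := mul_nonneg hK.nonneg hL.nonneg
  norm_le := (norm_mul_le _ _).trans
    (mul_le_mul hK.norm_le hL.norm_le (norm_nonneg _) hK.nonneg)
  hs n := by
    have hM := hK.nonneg
    calc ∑ j ∈ Finset.range n, ‖K (L (bv j))‖ ^ 2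
        ≤ ∑ j ∈ Finset.range n, (M * ‖L (bv j)‖) ^ 2 := by
          gcongr with j
          exact K.le_of_opNorm_le hK.norm_le _
      _ ≤ (M * N) ^ 2 := by
          simp only [mul_pow, ← Finset.mul_sum]
          gcongr
          exact hL.hs n
  hs_star n := by
    have hN := hL.nonneg
    have hL' : ‖Star.star L‖ ≤ N := by rw [norm_star_op]; exact hL.norm_le
    calc ∑ j ∈ Finset.range n, ‖Star.star (K * L) (bv j)‖ ^ 2
        ≤ ∑ j ∈ Finset.range n, (N * ‖Star.star K (bv j)‖) ^ 2 := by
          gcongr with j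
          rw [star_mul]
          exact (Star.star L).le_of_opNorm_le hL' _
      _ ≤ (M * N) ^ 2 := by
          simp only [mul_pow, ← Finset.mul_sum]
          rw [mul_comm]
          gcongr
          exact hK.hs_star n
  diag p q n := by
    calc ∑ i ∈ Finset.range n, ‖entry (K * L) (i + p) (i + q)‖
        ≤ ∑ i ∈ Finset.range n, ‖Star.star K (bv (i + p))‖ * ‖L (bv (i + q))‖ := by
          gcongr
          exact norm_entry_mul_le _ _ _ _
      _ ≤ M * N := by
          refine (Real.sum_mul_le_sqrt_mul_sqrt _ _ _).trans ?_
          have hM := hK.nonneg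
          gcongr
          · exact Real.sqrt_le_iff.2 ⟨hM, sum_shift_sq_le hK.hs_star p n⟩
          · exact Real.sqrt_le_iff.2 ⟨hL.nonneg, sum_shift_sq_le hL.hs q n⟩

lemma of_tendsto {f : ℕ → Op} (hf : ∀ n, IdealLE (f n) M) (h : Tendsto f atTop (𝓝 K)) :
    IdealLE K M where
  nonneg := (hf 0).nonneg
  norm_le := le_of_tendsto h.norm (Eventually.of_forall fun n => (hf n).norm_le)
  hs n := by
    have hc : Continuous fun K : Op => ∑ j ∈ Finset.range n, ‖K (bv j)‖ ^ 2 := by fun_prop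
    exact le_of_tendsto ((hc.tendsto K).comp h) (Eventually.of_forall fun m => (hf m).hs n)
  hs_star n := by
    have hc : Continuous fun K : Op => ∑ j ∈ Finset.range n, ‖Star.star K (bv j)‖ ^ 2 := by
      fun_prop
    exact le_of_tendsto ((hc.tendsto K).comp h) (Eventually.of_forall fun m => (hf m).hs_star n)
  diag p q n := by
    have hc : Continuous fun K : Op => ∑ i ∈ Finset.range n, ‖entry K (i + p) (i + q)‖ :=
      continuous_finsetSum _ fun i _ => (continuous_entry _ _).norm
    exact le_of_tendsto ((hc.tendsto K).comp h) (Eventually.of_forall fun m => (hf m).diag p q n)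

lemma sum {κ : Type*} {f : κ → Op} {a : κ → ℝ} (s : Finset κ) (hf : ∀ n, IdealLE (f n) (a n)) :
    IdealLE (∑ n ∈ s, f n) (∑ n ∈ s, a n) := by
  classical
  induction s using Finset.induction_on with
  | empty => simpa using zero
  | insert i s hi ih =>
    rw [Finset.sum_insert hi, Finset.sum_insert hi]
    exact (hf i).add ih

lemma hasSum {f : ℕ → Op} {a : ℕ → ℝ} {A : ℝ} (hf : ∀ n, IdealLE (f n) (a n)) (ha : HasSum a A)
    (h : HasSum f K) : IdealLE K A :=
  of_tendsto (fun n => (sum (Finset.range n) hf).mono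
    (sum_le_hasSum _ (fun i _ => (hf i).nonneg) ha)) h.tendsto_sum_nat

lemma rankOne (x y : Ell2 ℕ) : IdealLE (InnerProductSpace.rankOne ℂ x y) (‖x‖ * ‖y‖) where
  nonneg := by positivity
  norm_le := by simp
  hs n := by
    simp only [InnerProductSpace.rankOne_apply, norm_smul, mul_pow, ← Finset.sum_mul,
      norm_inner_symm y]
    rw [mul_comm]
    gcongr
    exact sum_norm_inner_bv_sq_le Function.injective_id _ y
  hs_star n := by
    simp only [ContinuousLinearMap.star_eq_adjoint, InnerProductSpace.adjoint_rankOne,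
      InnerProductSpace.rankOne_apply, norm_smul, mul_pow, ← Finset.sum_mul, norm_inner_symm x]
    gcongr
    exact sum_norm_inner_bv_sq_le Function.injective_id _ x
  diag p q n := by
    have h : ∀ i, ‖entry (InnerProductSpace.rankOne ℂ x y) (i + p) (i + q)‖
        = ‖⟪bv (i + p), x⟫_ℂ‖ * ‖⟪bv (i + q), y⟫_ℂ‖ := by
      intro i
      rw [entry, InnerProductSpace.rankOne_apply, inner_smul_right, norm_mul, mul_comm,
        norm_inner_symm y]
    simp only [h]
    refine (Real.sum_mul_le_sqrt_mul_sqrt _ _ _).trans ?_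
    gcongr
    · exact Real.sqrt_le_iff.2 ⟨norm_nonneg _, sum_norm_inner_bv_sq_le (add_left_injective p) _ x⟩
    · exact Real.sqrt_le_iff.2 ⟨norm_nonneg _, sum_norm_inner_bv_sq_le (add_left_injective q) _ y⟩

end IdealLE

/-- `MultLE A α` says that left and right multiplication by `A` enlarge the bound of `IdealLE` at
most by the factor `α`. -/
structure MultLE (A : Op) (α : ℝ) : Prop where
  nonneg : 0 ≤ α
  left : ∀ {K M}, IdealLE K M → IdealLE (A * K) (α * M)
  right : ∀ {K M}, IdealLE K M → IdealLE (K * A) (α * M)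

lemma IdealLE.multLE {K : Op} {M : ℝ} (hK : IdealLE K M) : MultLE K M where
  nonneg := hK.nonneg
  left h := hK.mul h
  right h := by rw [mul_comm M]; exact h.mul hK

namespace MultLE

variable {A B : Op} {α β : ℝ}

lemma one : MultLE 1 1 where
  nonneg := zero_le_one
  left h := by simpa using h
  right h := by simpa using h

lemma mono (hA : MultLE A α) (h : α ≤ β) : MultLE A β where
  nonneg := hA.nonneg.trans h
  left hK := (hA.left hK).mono (mul_le_mul_of_nonneg_right h hK.nonneg)
  right hK := (hA.right hK).mono (mul_le_mul_of_nonneg_right h hK.nonneg)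

lemma mul (hA : MultLE A α) (hB : MultLE B β) : MultLE (A * B) (α * β) where
  nonneg := mul_nonneg hA.nonneg hB.nonneg
  left h := by rw [mul_assoc, mul_assoc]; exact hA.left (hB.left h)
  right h := by rw [← mul_assoc, mul_comm α β, mul_assoc β]; exact hB.right (hA.right h)

lemma smul (hA : MultLE A α) (z : ℂ) : MultLE (z • A) (‖z‖ * α) where
  nonneg := mul_nonneg (norm_nonneg _) hA.nonneg
  left h := by rw [smul_mul_assoc, mul_assoc]; exact (hA.left h).smul z
  right h := by rw [mul_smul_comm, mul_assoc]; exact (hA.right h).smul z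

lemma neg (hA : MultLE A α) : MultLE (-A) α := by
  simpa using hA.smul (-1)

lemma pow (hA : MultLE A α) (n : ℕ) : MultLE (A ^ n) (α ^ n) := by
  induction n with
  | zero => simpa using one
  | succ n ih => rw [pow_succ, pow_succ]; exact ih.mul hA

lemma star (hA : MultLE A α) : MultLE (star A) α where
  nonneg := hA.nonneg
  left h := by simpa using (hA.right h.star).star
  right h := by simpa using (hA.left h.star).star

lemma hasSum {f : ℕ → Op} {a : ℕ → ℝ} {s : ℝ} (hf : ∀ n, MultLE (f n) (a n)) (ha : HasSum a s)
    (h : HasSum f A) : MultLE A s where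
  nonneg := ha.nonneg fun n => (hf n).nonneg
  left hK := IdealLE.hasSum (fun n => (hf n).left hK) (ha.mul_right _) (h.mul_right _)
  right hK := IdealLE.hasSum (fun n => (hf n).right hK) (ha.mul_right _) (h.mul_left _)

end MultLE

lemma hasSum_exp {𝔸 : Type*} [NormedRing 𝔸] [NormedAlgebra ℂ 𝔸] [CompleteSpace 𝔸] (A : 𝔸) :
    HasSum (fun n : ℕ => ((n.factorial : ℂ)⁻¹) • A ^ n) (NormedSpace.exp A) :=
  NormedSpace.exp_series_hasSum_exp' A

lemma hasSum_real_exp (a : ℝ) :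
    HasSum (fun n : ℕ => ((n.factorial : ℝ)⁻¹) * a ^ n) (Real.exp a) := by
  have h := NormedSpace.exp_series_hasSum_exp' (𝕂 := ℝ) a
  rw [← Real.exp_eq_exp_ℝ] at h
  simpa using h

lemma norm_inv_factorial (n : ℕ) : ‖((n.factorial : ℂ)⁻¹)‖ = (n.factorial : ℝ)⁻¹ := by
  simp

lemma MultLE.exp {A : Op} {α : ℝ} (hA : MultLE A α) : MultLE (NormedSpace.exp A) (Real.exp α) :=
  MultLE.hasSum (fun n => norm_inv_factorial n ▸ (hA.pow n).smul _) (hasSum_real_exp α)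
    (hasSum_exp A)

lemma MultLE.exp_sub_one {A : Op} {α : ℝ} (hA : MultLE A α) :
    MultLE (NormedSpace.exp A - 1) (Real.exp α - 1) := by
  have h1 := (hasSum_nat_add_iff' 1).2 (hasSum_exp A)
  have h2 := (hasSum_nat_add_iff' 1).2 (hasSum_real_exp α)
  simp only [Finset.range_one, Finset.sum_singleton, Nat.factorial_zero, Nat.cast_one, inv_one,
    pow_zero, one_smul, mul_one] at h1 h2
  exact MultLE.hasSum (fun n => norm_inv_factorial (n + 1) ▸ (hA.pow (n + 1)).smul _) h2 h1

/-! ### Closure of the finite-rank operators in the ideal -/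

/-- `F` is a finite sum of rank-one operators. -/
def IsFiniteRank (F : Op) : Prop :=
  ∃ (ι : Type) (_ : Fintype ι) (x y : ι → Ell2 ℕ),
    F = ∑ a, InnerProductSpace.rankOne ℂ (x a) (y a)

/-- `K` is a limit of finite-rank operators with respect to the bounds of `IdealLE`. These operators
form a two-sided ideal of the algebra of multipliers, and determinants of `1 + K` are defined by
finite sections. -/
def IdealMem (K : Op) : Prop :=
  ∀ ε > 0, ∃ F, IsFiniteRank F ∧ IdealLE (K - F) ε

namespace IsFiniteRank

variable {F G : Op}

lemma rankOne (x y : Ell2 ℕ) : IsFiniteRank (InnerProductSpace.rankOne ℂ x y) :=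
  ⟨Unit, inferInstance, fun _ => x, fun _ => y, by simp⟩

lemma zero : IsFiniteRank 0 :=
  ⟨Empty, inferInstance, fun _ => 0, fun _ => 0, by simp⟩

lemma add (hF : IsFiniteRank F) (hG : IsFiniteRank G) : IsFiniteRank (F + G) := by
  obtain ⟨ι, _, x, y, rfl⟩ := hF
  obtain ⟨κ, _, u, v, rfl⟩ := hG
  exact ⟨ι ⊕ κ, inferInstance, Sum.elim x u, Sum.elim y v, by simp [Fintype.sum_sum_type]⟩

lemma mul_left (hF : IsFiniteRank F) (A : Op) : IsFiniteRank (A * F) := by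
  obtain ⟨ι, _, x, y, rfl⟩ := hF
  refine ⟨ι, inferInstance, fun a => A (x a), y, ?_⟩
  rw [Finset.mul_sum]
  exact Finset.sum_congr rfl fun a _ => InnerProductSpace.comp_rankOne _ _ _

lemma mul_right (hF : IsFiniteRank F) (A : Op) : IsFiniteRank (F * A) := by
  obtain ⟨ι, _, x, y, rfl⟩ := hF
  refine ⟨ι, inferInstance, x, fun a => star A (y a), ?_⟩
  rw [Finset.sum_mul]
  exact Finset.sum_congr rfl fun a _ => InnerProductSpace.rankOne_comp _ _ _

lemma sum {κ : Type*} {f : κ → Op} (s : Finset κ) (hf : ∀ n, IsFiniteRank (f n)) :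
    IsFiniteRank (∑ n ∈ s, f n) := by
  classical
  induction s using Finset.induction_on with
  | empty => simpa using zero
  | insert i s hi ih =>
    rw [Finset.sum_insert hi]
    exact (hf i).add ih

lemma exists_idealLE (hF : IsFiniteRank F) : ∃ M, IdealLE F M := by
  obtain ⟨ι, _, x, y, rfl⟩ := hF
  exact ⟨_, IdealLE.sum _ fun a => IdealLE.rankOne (x a) (y a)⟩

lemma idealMem (hF : IsFiniteRank F) : IdealMem F := fun ε hε =>
  ⟨F, hF, by rw [sub_self]; exact IdealLE.zero.mono hε.le⟩

end IsFiniteRank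

namespace IdealMem

variable {K L A : Op} {α : ℝ}

lemma exists_idealLE (hK : IdealMem K) : ∃ M, IdealLE K M := by
  obtain ⟨F, hF, h⟩ := hK 1 one_pos
  obtain ⟨M, hM⟩ := hF.exists_idealLE
  exact ⟨_, by simpa using h.add hM⟩

lemma add (hK : IdealMem K) (hL : IdealMem L) : IdealMem (K + L) := by
  intro ε hε
  obtain ⟨F, hF, h⟩ := hK (ε / 2) (half_pos hε)
  obtain ⟨G, hG, h'⟩ := hL (ε / 2) (half_pos hε)
  refine ⟨F + G, hF.add hG, ?_⟩
  have := h.add h'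
  rwa [add_halves, ← add_sub_add_comm] at this

lemma mul_left (hK : IdealMem K) (hA : MultLE A α) : IdealMem (A * K) := by
  intro ε hε
  have hα := hA.nonneg
  obtain ⟨F, hF, h⟩ := hK (ε / (α + 1)) (by positivity)
  refine ⟨A * F, hF.mul_left A, ?_⟩
  rw [← mul_sub]
  refine (hA.left h).mono ?_
  rw [mul_div_assoc', div_le_iff₀ (by positivity)]
  nlinarith

lemma mul_right (hK : IdealMem K) (hA : MultLE A α) : IdealMem (K * A) := by
  intro ε hε
  have hα := hA.nonneg
  obtain ⟨F, hF, h⟩ := hK (ε / (α + 1)) (by positivity)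
  refine ⟨F * A, hF.mul_right A, ?_⟩
  rw [← sub_mul]
  refine (hA.right h).mono ?_
  rw [mul_div_assoc', div_le_iff₀ (by positivity)]
  nlinarith

lemma smul (hK : IdealMem K) (z : ℂ) : IdealMem (z • K) := by
  have := hK.mul_left (MultLE.one.smul z)
  rwa [smul_mul_assoc, one_mul] at this

lemma sum {κ : Type*} {f : κ → Op} (s : Finset κ) (hf : ∀ n, IdealMem (f n)) :
    IdealMem (∑ n ∈ s, f n) := by
  classical
  induction s using Finset.induction_on with
  | empty => simpa using IsFiniteRank.zero.idealMem
  | insert i s hi ih =>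
    rw [Finset.sum_insert hi]
    exact (hf i).add ih

lemma mul (hK : IdealMem K) (hL : IdealMem L) : IdealMem (K * L) := by
  obtain ⟨M, hM⟩ := hK.exists_idealLE
  exact hL.mul_left hM.multLE

lemma of_approx (h : ∀ ε > 0, ∃ L, IdealMem L ∧ IdealLE (K - L) ε) : IdealMem K := by
  intro ε hε
  obtain ⟨L, hL, h1⟩ := h (ε / 2) (half_pos hε)
  obtain ⟨F, hF, h2⟩ := hL (ε / 2) (half_pos hε)
  refine ⟨F, hF, ?_⟩
  have := h1.add h2
  rwa [add_halves, sub_add_sub_cancel] at this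

lemma hasSum {f : ℕ → Op} {a : ℕ → ℝ} (hf : ∀ n, IdealMem (f n)) (hfa : ∀ n, IdealLE (f n) (a n))
    (ha : Summable a) (h : HasSum f K) : IdealMem K := by
  refine of_approx fun ε hε => ?_
  have h0 := (tendsto_sum_nat_add a).eventually (gt_mem_nhds hε)
  obtain ⟨m, hm⟩ := h0.exists
  refine ⟨∑ i ∈ Finset.range m, f i, sum _ hf, ?_⟩
  have h1 := IdealLE.hasSum (fun n => hfa (n + m)) ((summable_nat_add_iff m).2 ha).hasSum
    ((hasSum_nat_add_iff' m).2 h)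
  exact h1.mono hm.le

end IdealMem

/-! ### Exponentials and operators that almost intertwine -/

/-- The sequence `∑_{i < n} A ^ (n - 1 - i) * D * B ^ i`; it equals `A ^ n * X - X * B ^ n` when
`D = A * X - X * B`. -/
def duhamel (A B D : Op) : ℕ → Op
  | 0 => 0
  | n + 1 => A * duhamel A B D n + D * B ^ n

section Duhamel

variable {A B D K : Op} {γ M : ℝ}

lemma idealLE_duhamel (hA : MultLE A γ) (hB : MultLE B γ) (hD : IdealLE D M) (n : ℕ) :
    IdealLE (duhamel A B D (n + 1)) ((n + 1) * γ ^ n * M) := by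
  induction n with
  | zero => simpa [duhamel] using hD
  | succ n ih =>
    have := (hA.left ih).add ((hB.pow (n + 1)).right hD)
    refine this.mono (le_of_eq ?_)
    push_cast
    ring

lemma idealMem_duhamel (hA : MultLE A γ) (hB : MultLE B γ) (hD : IdealMem D) (n : ℕ) :
    IdealMem (duhamel A B D n) := by
  induction n with
  | zero => exact IsFiniteRank.zero.idealMem
  | succ n ih => exact (ih.mul_left hA).add (hD.mul_right (hB.pow n))

lemma idealLE_duhamel_term (hA : MultLE A γ) (hB : MultLE B γ) (hD : IdealLE D M) (n : ℕ) :
    IdealLE ((((n + 1).factorial : ℂ)⁻¹) • duhamel A B D (n + 1))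
      ((n.factorial : ℝ)⁻¹ * γ ^ n * M) := by
  refine ((idealLE_duhamel hA hB hD n).smul _).mono (le_of_eq ?_)
  rw [norm_inv_factorial, Nat.factorial_succ]
  push_cast
  field_simp

/-- `K` plays the role of `exp A * X - X * exp B` with `D = A * X - X * B`. It is described by its
series, since `A` and `B` may also be compressions of one operator on a larger space and `D` the
obstruction to multiplicativity of the compression. -/
lemma idealLE_of_hasSum_duhamel (hA : MultLE A γ) (hB : MultLE B γ)
    (hK : HasSum (fun n => ((n.factorial : ℂ)⁻¹) • duhamel A B D n) K) (hD : IdealLE D M) :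
    IdealLE K (Real.exp γ * M) := by
  have h1 := (hasSum_nat_add_iff' 1).2 hK
  simp only [Finset.range_one, Finset.sum_singleton, duhamel, smul_zero, sub_zero] at h1
  exact IdealLE.hasSum (fun n => idealLE_duhamel_term hA hB hD n) ((hasSum_real_exp γ).mul_right M)
    h1

/-- The operator `K` agrees with `D` to first order in `γ`. -/
lemma idealLE_sub_of_hasSum_duhamel (hA : MultLE A γ) (hB : MultLE B γ)
    (hK : HasSum (fun n => ((n.factorial : ℂ)⁻¹) • duhamel A B D n) K) (hD : IdealLE D M) :
    IdealLE (K - D) ((Real.exp γ - 1) * M) := by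
  have h1 := (hasSum_nat_add_iff' 2).2 hK
  have h2 := (hasSum_nat_add_iff' 1).2 (hasSum_real_exp γ)
  simp only [Finset.sum_range_succ, Finset.range_zero, Finset.sum_empty, duhamel, smul_zero,
    zero_add, mul_zero, pow_zero, mul_one, Nat.factorial_one, Nat.factorial_zero, Nat.cast_one,
    inv_one, one_smul] at h1 h2
  exact IdealLE.hasSum (fun n => idealLE_duhamel_term hA hB hD (n + 1)) (h2.mul_right M) h1

lemma idealMem_of_hasSum_duhamel (hA : MultLE A γ) (hB : MultLE B γ)
    (hK : HasSum (fun n => ((n.factorial : ℂ)⁻¹) • duhamel A B D n) K) (hD : IdealMem D) :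
    IdealMem K := by
  obtain ⟨M, hM⟩ := hD.exists_idealLE
  have h1 := (hasSum_nat_add_iff' 1).2 hK
  simp only [Finset.range_one, Finset.sum_singleton, duhamel, smul_zero, sub_zero] at h1
  exact IdealMem.hasSum (fun n => (idealMem_duhamel hA hB hD (n + 1)).smul _)
    (fun n => idealLE_duhamel_term hA hB hM n) ((hasSum_real_exp γ).mul_right M).summable h1

end Duhamel

lemma duhamel_sub (A B X : Op) (n : ℕ) :
    duhamel A B (A * X - X * B) n = A ^ n * X - X * B ^ n := by
  induction n with
  | zero => simp [duhamel]
  | succ n ih => rw [duhamel, ih, pow_succ', pow_succ']; noncomm_ring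

lemma hasSum_duhamel_sub (A B X : Op) :
    HasSum (fun n => ((n.factorial : ℂ)⁻¹) • duhamel A B (A * X - X * B) n)
      (NormedSpace.exp A * X - X * NormedSpace.exp B) := by
  have := ((hasSum_exp A).mul_right X).sub ((hasSum_exp B).mul_left X)
  refine this.congr_fun fun n => ?_
  rw [duhamel_sub, smul_sub, smul_mul_assoc, mul_smul_comm]

/-! ### Diagonal operators -/

section Diagonal

variable {D : Op} {d : ℕ → ℝ}

lemma norm_le_one_of_diagonal (hs : star D = D) (hD : ∀ j, D (bv j) = (d j : ℂ) • bv j)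
    (hd : ∀ j, |d j| ≤ 1) : ‖D‖ ≤ 1 := by
  refine D.opNorm_le_bound zero_le_one fun x => ?_
  rw [one_mul]
  refine (pow_le_pow_iff_left₀ (norm_nonneg _) (norm_nonneg _) two_ne_zero).1 ?_
  refine hasSum_le (fun i => ?_) (hasSum_norm_sq (D x)) (hasSum_norm_sq x)
  have : ⟪bv i, D x⟫_ℂ = (d i : ℂ) * ⟪bv i, x⟫_ℂ := by
    have h1 : ⟪(star D) (bv i), x⟫_ℂ = ⟪bv i, D x⟫_ℂ :=
      ContinuousLinearMap.adjoint_inner_left D x (bv i)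
    rw [← h1, hs, hD, inner_smul_left, Complex.conj_ofReal]
  rw [this, norm_mul, mul_pow, Complex.norm_real, Real.norm_eq_abs]
  have h3 := hd i
  have h2 : |d i| ^ 2 ≤ 1 := pow_le_one₀ (abs_nonneg _) h3
  exact mul_le_of_le_one_left (by positivity) h2

/-- A self-adjoint diagonal contraction is a multiplier. -/
lemma multLE_of_diagonal (hs : star D = D) (hD : ∀ j, D (bv j) = (d j : ℂ) • bv j)
    (hd : ∀ j, |d j| ≤ 1) : MultLE D 1 := by
  have hn := norm_le_one_of_diagonal hs hD hd
  have hc : ∀ {K : Op} {M}, IdealLE K M → IdealLE (K * D) (1 * M) := by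
    intro K M hK
    have h1 : ∀ j, ‖(K * D) (bv j)‖ ≤ ‖K (bv j)‖ := by
      intro j
      rw [mul_apply_eq_comp, hD, map_smul, norm_smul, Complex.norm_real,
        Real.norm_eq_abs]
      exact mul_le_of_le_one_left (norm_nonneg _) (hd j)
    have h2 : ∀ j, ‖star (K * D) (bv j)‖ ≤ ‖star K (bv j)‖ := by
      intro j
      rw [star_mul, hs, mul_apply_eq_comp]
      simpa using D.le_of_opNorm_le hn (star K (bv j))
    rw [one_mul]
    refine ⟨hK.nonneg, ?_, fun n => ?_, fun n => ?_, fun p q n => ?_⟩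
    · calc ‖K * D‖ ≤ ‖K‖ * ‖D‖ := norm_mul_le _ _
        _ ≤ M * 1 := mul_le_mul hK.norm_le hn (norm_nonneg _) hK.nonneg
        _ = M := mul_one M
    · refine le_trans ?_ (hK.hs n)
      gcongr with j
      exact h1 j
    · refine le_trans ?_ (hK.hs_star n)
      gcongr with j
      exact h2 j
    · refine le_trans ?_ (hK.diag p q n)
      gcongr with j
      rw [entry, mul_apply_eq_comp, hD, map_smul, inner_smul_right, norm_mul,
        Complex.norm_real, Real.norm_eq_abs]
      exact mul_le_of_le_one_left (norm_nonneg _) (hd _)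
  refine ⟨zero_le_one, fun {K M} hK => ?_, hc⟩
  have := (hc hK.star).star
  rwa [star_mul, hs, star_star] at this

end Diagonal

/-- The diagonal operator with real entries `d j` of absolute value at most one. -/
def diagOp (d : ℕ → ℝ) (hd : ∀ j, |d j| ≤ 1) : Op :=
  LinearMap.mkContinuous
    { toFun := fun x => ⟨fun j => (d j : ℂ) * x j, by
        have hx := (lp.memℓp x).summable (by norm_num)
        refine memℓp_gen (hx.of_nonneg_of_le (fun j => by positivity) fun j => ?_)
        gcongr
        rw [norm_mul, Complex.norm_real, Real.norm_eq_abs]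
        exact mul_le_of_le_one_left (norm_nonneg _) (hd j)⟩
      map_add' := fun x y => by ext j; exact mul_add _ _ _
      map_smul' := fun z x => by ext j; exact mul_left_comm _ _ _ } 1
    (by
      intro x
      rw [one_mul]
      refine (pow_le_pow_iff_left₀ (norm_nonneg _) (norm_nonneg _) two_ne_zero).1 ?_
      refine hasSum_le (fun i => ?_) (hasSum_norm_sq _) (hasSum_norm_sq x)
      gcongr
      rw [inner_bv_left, inner_bv_left]
      change ‖(d i : ℂ) * x i‖ ≤ ‖x i‖
      rw [norm_mul, Complex.norm_real, Real.norm_eq_abs]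
      exact mul_le_of_le_one_left (norm_nonneg _) (hd i))

section DiagOp

variable (d : ℕ → ℝ) (hd : ∀ j, |d j| ≤ 1)

lemma inner_bv_diagOp (i : ℕ) (x : Ell2 ℕ) :
    ⟪bv i, diagOp d hd x⟫_ℂ = (d i : ℂ) * ⟪bv i, x⟫_ℂ := by
  rw [inner_bv_left, inner_bv_left]
  rfl

lemma diagOp_bv (j : ℕ) : diagOp d hd (bv j) = (d j : ℂ) • bv j := by
  refine ext_inner_bv fun i => ?_
  rw [inner_bv_diagOp, inner_smul_right, inner_bv_bv]
  split_ifs with h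
  · rw [h]
  · simp

lemma star_diagOp : star (diagOp d hd) = diagOp d hd := by
  refine ext_bv fun j => ext_inner_bv fun i => ?_
  have h1 : ⟪bv i, star (diagOp d hd) (bv j)⟫_ℂ = ⟪diagOp d hd (bv i), bv j⟫_ℂ :=
    ContinuousLinearMap.adjoint_inner_right _ _ _
  rw [h1, diagOp_bv, diagOp_bv, inner_smul_left, inner_smul_right, inner_bv_bv, Complex.conj_ofReal]
  split_ifs with h
  · rw [h]
  · simp

lemma multLE_diagOp : MultLE (diagOp d hd) 1 :=
  multLE_of_diagonal (star_diagOp d hd) (diagOp_bv d hd) hd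

end DiagOp

/-! ### Determinants by finite sections -/

/-- The upper left `n × n` corner of the matrix of `X`. -/
def corner (X : Op) (n : ℕ) : Matrix (Fin n) (Fin n) ℂ := Matrix.of fun i j => entry X i j

/-- The determinant of `X`, the limit of the determinants of its upper left corners; it is used for
`X - 1` in the ideal, where the limit exists. -/
def opDet (X : Op) : ℂ := limUnder atTop fun n => (corner X n).det

lemma corner_add (X Y : Op) (n : ℕ) : corner (X + Y) n = corner X n + corner Y n := by
  ext i j
  exact entry_add X Y i j

lemma corner_one (n : ℕ) : corner 1 n = 1 := by
  ext i j
  simp [corner, entry_one, Matrix.one_apply, Fin.ext_iff]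

lemma corner_one_add (K : Op) (n : ℕ) : corner (1 + K) n = 1 + corner K n := by
  rw [corner_add, corner_one]

lemma trace_corner (K : Op) (n : ℕ) :
    (corner K n).trace = ∑ i ∈ Finset.range n, entry K i i :=
  Fin.sum_univ_eq_sum_range (fun i => entry K i i) n

lemma IdealLE.norm_sum_entry_le {K : Op} {M : ℝ} (hK : IdealLE K M) (n : ℕ) :
    ‖∑ i ∈ Finset.range n, entry K i i‖ ≤ M :=
  (norm_sum_le _ _).trans (by simpa using hK.diag 0 0 n)

lemma IdealLE.traceFrobLE {K : Op} {M : ℝ} (hK : IdealLE K M) (n : ℕ) :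
    TraceFrobLE (corner K n) M := by
  refine ⟨hK.nonneg, ?_, ?_⟩
  · rw [trace_corner]
    exact hK.norm_sum_entry_le n
  · rw [Finset.sum_comm]
    refine le_trans ?_ (hK.hs n)
    rw [← Fin.sum_univ_eq_sum_range (fun j => ‖K (bv j)‖ ^ 2) n]
    gcongr with j
    exact sum_norm_inner_bv_sq_le Fin.val_injective _ _

/-- The constant in the Lipschitz estimate for determinants of corners. -/
def lipConst (M : ℝ) : ℝ := 2 * Real.exp ((M + 1) + (M + 1) ^ 2)

lemma lipConst_pos (M : ℝ) : 0 < lipConst M := by unfold lipConst; positivity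

lemma norm_det_corner_sub_le {K L : Op} {M ε : ℝ} (hK : IdealLE K M) (hL : IdealLE (K - L) ε)
    (hε : ε < 1) (n : ℕ) :
    ‖(corner (1 + L) n).det - (corner (1 + K) n).det‖ ≤ lipConst M * ε := by
  have h := norm_det_one_add_add_sub_le (hK.traceFrobLE n) (hL.neg.traceFrobLE n) hε
  rwa [← corner_add, neg_sub, add_sub_cancel, ← corner_one_add, ← corner_one_add] at h

lemma exists_lim_of_approx {f : ℕ → ℂ}
    (h : ∀ ε > 0, ∃ g : ℕ → ℂ, (∃ l, Tendsto g atTop (𝓝 l)) ∧ ∀ n, ‖f n - g n‖ ≤ ε) :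
    ∃ l, Tendsto f atTop (𝓝 l) := by
  refine cauchySeq_tendsto_of_complete (Metric.cauchySeq_iff.2 fun ε hε => ?_)
  obtain ⟨g, ⟨l, hl⟩, hg⟩ := h (ε / 4) (by positivity)
  obtain ⟨N, hN⟩ := Metric.cauchySeq_iff.1 hl.cauchySeq (ε / 4) (by positivity)
  refine ⟨N, fun m hm n hn => ?_⟩
  have h1 := hg m
  have h2 := hg n
  have h3 := hN m hm n hn
  rw [← dist_eq_norm] at h1 h2
  rw [dist_comm] at h2
  have := dist_triangle4 (f m) (g m) (g n) (f n)
  linarith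

lemma hasSum_inner_mul_inner (x y : Ell2 ℕ) :
    HasSum (fun i => ⟪x, bv i⟫_ℂ * ⟪bv i, y⟫_ℂ) ⟪x, y⟫_ℂ := by
  have := (hasSum_bv y).mapL (innerSL ℂ x)
  simpa [inner_bv_left, inner_smul_right, mul_comm] using this

section FiniteRank

variable {ι : Type} [Fintype ι] [DecidableEq ι] (x y : ι → Ell2 ℕ)

/-- The Gram-type matrix `⟨y a, x b⟩`. -/
def gram (x y : ι → Ell2 ℕ) : Matrix ι ι ℂ := Matrix.of fun a b => ⟪y a, x b⟫_ℂ

/-- For a finite-rank perturbation of the identity, Sylvester's identity turns the determinants of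
the corners into determinants of fixed size. -/
lemma tendsto_det_corner_finiteRank :
    Tendsto (fun n => (corner (1 + ∑ a, InnerProductSpace.rankOne ℂ (x a) (y a)) n).det) atTop
      (𝓝 (1 + gram x y).det) := by
  let V : ∀ n, Matrix (Fin n) ι ℂ := fun n => Matrix.of fun i a => ⟪bv (i : ℕ), x a⟫_ℂ
  let U : ∀ n, Matrix ι (Fin n) ℂ := fun n => Matrix.of fun a i => ⟪y a, bv (i : ℕ)⟫_ℂ
  have h1 : ∀ n, corner (1 + ∑ a, InnerProductSpace.rankOne ℂ (x a) (y a)) n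
      = 1 + V n * U n := by
    intro n
    rw [corner_one_add]
    congr 1
    ext i j
    simp [corner, entry, V, U, Matrix.mul_apply, mul_comm]
  simp only [h1, Matrix.det_one_add_mul_comm (V _) (U _)]
  have h2 : Tendsto (fun n => 1 + U n * V n) atTop (𝓝 (1 + gram x y)) := by
    refine tendsto_const_nhds.add (tendsto_pi_nhds.2 fun a => tendsto_pi_nhds.2 fun b => ?_)
    have := (hasSum_inner_mul_inner (y a) (x b)).tendsto_sum_nat
    refine this.congr fun n => ?_
    rw [Matrix.mul_apply, ← Fin.sum_univ_eq_sum_range (fun i => ⟪y a, bv i⟫_ℂ * ⟪bv i, x b⟫_ℂ) n]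
    rfl
  exact (Continuous.matrix_det continuous_id).continuousAt.tendsto.comp h2

end FiniteRank

lemma IdealMem.exists_tendsto {K : Op} (hK : IdealMem K) :
    ∃ d, Tendsto (fun n => (corner (1 + K) n).det) atTop (𝓝 d) := by
  classical
  obtain ⟨M, hM⟩ := hK.exists_idealLE
  refine exists_lim_of_approx fun ε hε => ?_
  have hC := lipConst_pos M
  obtain ⟨F, ⟨ι, _, x, y, rfl⟩, h⟩ := hK (min (ε / lipConst M) 2⁻¹) (by positivity)
  refine ⟨_, ⟨_, tendsto_det_corner_finiteRank x y⟩, fun n => ?_⟩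
  rw [norm_sub_rev]
  refine (norm_det_corner_sub_le hM h (by
    exact (min_le_right _ _).trans_lt (by norm_num)) n).trans ?_
  calc lipConst M * min (ε / lipConst M) 2⁻¹ ≤ lipConst M * (ε / lipConst M) := by
        gcongr; exact min_le_left _ _
    _ = ε := mul_div_cancel₀ _ hC.ne'

/-- `X` differs from the identity by an element of the ideal. -/
def DetClass (X : Op) : Prop := IdealMem (X - 1)

lemma DetClass.tendsto {X : Op} (hX : DetClass X) :
    Tendsto (fun n => (corner X n).det) atTop (𝓝 (opDet X)) := by
  obtain ⟨d, hd⟩ := IdealMem.exists_tendsto hX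
  rw [add_sub_cancel] at hd
  exact tendsto_nhds_limUnder ⟨d, hd⟩

lemma DetClass.one_add {K : Op} (hK : IdealMem K) : DetClass (1 + K) := by
  rwa [DetClass, add_sub_cancel_left]

lemma DetClass.one : DetClass 1 := by
  rw [DetClass, sub_self]
  exact IsFiniteRank.zero.idealMem

lemma DetClass.mul {X Y : Op} (hX : DetClass X) (hY : DetClass Y) : DetClass (X * Y) := by
  have h : X * Y - 1 = (X - 1) + (Y - 1) + (X - 1) * (Y - 1) := by noncomm_ring
  rw [DetClass, h]
  exact (IdealMem.add hX hY).add (IdealMem.mul hX hY)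

lemma DetClass.conj {X A A' : Op} {α α' : ℝ} (hX : DetClass X) (hA : MultLE A α)
    (hA' : MultLE A' α') (h : A * A' = 1) : DetClass (A * X * A') := by
  have h : A * X * A' - 1 = A * (X - 1) * A' := by
    rw [mul_sub, sub_mul, mul_one, h]
  rw [DetClass, h]
  exact (IdealMem.mul_left hX hA).mul_right hA'

/-- Conjugation by a multiplier preserves the determinant: for `1 +` a finite-rank operator the
determinant is that of a Gram-type matrix, which does not change. -/
lemma opDet_conj {X A A' : Op} {α α' : ℝ} (hX : DetClass X) (hA : MultLE A α)
    (hA' : MultLE A' α') (h : A * A' = 1) (h' : A' * A = 1) : opDet (A * X * A') = opDet X := by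
  classical
  have hY := hX.conj hA hA' h
  obtain ⟨M, hM⟩ := IdealMem.exists_idealLE hX
  obtain ⟨N, hN⟩ := IdealMem.exists_idealLE hY
  have hα := hA.nonneg
  have hα' := hA'.nonneg
  have hCM := lipConst_pos M
  have hCN := lipConst_pos N
  have key : ∀ δ, 0 < δ → δ < 1 → α * α' * δ < 1 →
      ‖opDet (A * X * A') - opDet X‖ ≤ lipConst N * (α * α' * δ) + lipConst M * δ := by
    intro δ h0 h1 h2
    obtain ⟨F, ⟨ι, _, x, y, rfl⟩, hF⟩ := hX δ h0
    have hG : A * X * A' - 1 - ∑ a, InnerProductSpace.rankOne ℂ (A (x a)) (star A' (y a))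
        = A * (X - 1 - ∑ a, InnerProductSpace.rankOne ℂ (x a) (y a)) * A' := by
      have h3 : ∑ a, InnerProductSpace.rankOne ℂ (A (x a)) (star A' (y a))
          = A * (∑ a, InnerProductSpace.rankOne ℂ (x a) (y a)) * A' := by
        rw [Finset.mul_sum, Finset.sum_mul]
        refine Finset.sum_congr rfl fun a _ => ?_
        have h4 : A * InnerProductSpace.rankOne ℂ (x a) (y a)
            = InnerProductSpace.rankOne ℂ (A (x a)) (y a) := InnerProductSpace.comp_rankOne _ _ _
        rw [h4]
        exact (InnerProductSpace.rankOne_comp _ _ _).symm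
      rw [h3, mul_sub, mul_sub, sub_mul, sub_mul, mul_one, h]
    have hG' : IdealLE (A * X * A' - 1
        - ∑ a, InnerProductSpace.rankOne ℂ (A (x a)) (star A' (y a))) (α * α' * δ) := by
      rw [hG]
      exact (hA'.right (hA.left hF)).mono (le_of_eq (by ring))
    have hgram : gram (fun a => A (x a)) (fun a => star A' (y a)) = gram x y := by
      ext a b
      have h5 : ⟪(star A') (y a), A (x b)⟫_ℂ = ⟪y a, A' (A (x b))⟫_ℂ :=
        ContinuousLinearMap.adjoint_inner_left _ _ _
      have h6 : A' (A (x b)) = x b := congrArg (fun T : Op => T (x b)) h'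
      simp only [gram, Matrix.of_apply, h5, h6]
    have e1 : ‖(1 + gram x y).det - opDet X‖ ≤ lipConst M * δ := by
      refine le_of_tendsto ((tendsto_det_corner_finiteRank x y).sub hX.tendsto).norm
        (Eventually.of_forall fun n => ?_)
      have := norm_det_corner_sub_le hM hF h1 n
      rwa [add_sub_cancel] at this
    have e2 : ‖(1 + gram x y).det - opDet (A * X * A')‖ ≤ lipConst N * (α * α' * δ) := by
      rw [← hgram]
      refine le_of_tendsto ((tendsto_det_corner_finiteRank _ _).sub hY.tendsto).norm
        (Eventually.of_forall fun n => ?_)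
      have := norm_det_corner_sub_le hN hG' h2 n
      rwa [add_sub_cancel] at this
    calc ‖opDet (A * X * A') - opDet X‖
        = ‖((1 + gram x y).det - opDet X) - ((1 + gram x y).det - opDet (A * X * A'))‖ := by
          congr 1; ring
      _ ≤ _ := (norm_sub_le _ _).trans (by linarith)
  have hlim : Tendsto (fun δ : ℝ => lipConst N * (α * α' * δ) + lipConst M * δ) (𝓝[>] 0)
      (𝓝 0) := by
    have hc : Continuous fun δ : ℝ => lipConst N * (α * α' * δ) + lipConst M * δ := by fun_prop
    simpa using (hc.tendsto 0).mono_left nhdsWithin_le_nhds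
  have hc2 : Tendsto (fun δ : ℝ => α * α' * δ) (𝓝[>] 0) (𝓝 0) := by
    have hc : Continuous fun δ : ℝ => α * α' * δ := by fun_prop
    simpa using (hc.tendsto 0).mono_left nhdsWithin_le_nhds
  have h0 : ‖opDet (A * X * A') - opDet X‖ ≤ 0 := by
    refine ge_of_tendsto hlim ?_
    filter_upwards [self_mem_nhdsWithin, Ioo_mem_nhdsGT one_pos,
      hc2.eventually (gt_mem_nhds one_pos)] with δ h1 h2 h3
    exact key δ h1 h2.2 h3
  exact sub_eq_zero.1 (norm_le_zero_iff.1 h0)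

/-- The projection to the span of the `bv j` with `n ≤ j`. -/
def tailProj (n : ℕ) : Op :=
  diagOp (fun j => if j < n then 0 else 1) (fun j => by split_ifs <;> simp)

lemma tailProj_bv (n j : ℕ) : tailProj n (bv j) = if j < n then 0 else bv j := by
  rw [tailProj, diagOp_bv]
  split_ifs <;> simp

lemma one_sub_tailProj (n : ℕ) :
    1 - tailProj n = ∑ l ∈ Finset.range n, InnerProductSpace.rankOne ℂ (bv l) (bv l) := by
  refine ext_bv fun j => ?_
  simp only [_root_.sub_apply, one_apply_eq_self, tailProj_bv,
    _root_.sum_apply, InnerProductSpace.rankOne_apply, inner_bv_bv, ite_smul, one_smul,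
    zero_smul, Finset.sum_ite_eq', Finset.mem_range]
  split_ifs <;> simp

lemma tendsto_tailProj (x : Ell2 ℕ) : Tendsto (fun n => tailProj n x) atTop (𝓝 0) := by
  have h1 := (hasSum_bv x).tendsto_sum_nat
  have h2 : ∀ n, tailProj n x = x - ∑ i ∈ Finset.range n, x i • bv i := by
    intro n
    have h3 := congrArg (fun T : Op => T x) (one_sub_tailProj n)
    simp only [_root_.sub_apply, one_apply_eq_self,
      _root_.sum_apply, InnerProductSpace.rankOne_apply, inner_bv_left] at h3
    rw [← h3]
    abel
  simp only [h2]
  simpa using (tendsto_const_nhds (x := x)).sub h1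

lemma corner_mul_one_sub_tailProj (K L : Op) (n : ℕ) :
    corner (K * (1 - tailProj n) * L) n = corner K n * corner L n := by
  ext i j
  rw [one_sub_tailProj, Matrix.mul_apply]
  simp only [corner, Matrix.of_apply, entry, mul_apply_eq_comp, _root_.sum_apply,
    InnerProductSpace.rankOne_apply, map_sum, map_smul, inner_sum, inner_smul_right]
  rw [← Fin.sum_univ_eq_sum_range (fun l => ⟪bv l, L (bv j)⟫_ℂ * ⟪bv (i : ℕ), K (bv l)⟫_ℂ) n]
  exact Finset.sum_congr rfl fun l _ => mul_comm _ _

lemma IsFiniteRank.tendsto_mul_tailProj {F : Op} (hF : IsFiniteRank F) (L : Op) :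
    ∃ a : ℕ → ℝ, Tendsto a atTop (𝓝 0) ∧ ∀ n, IdealLE (F * tailProj n * L) (a n) := by
  obtain ⟨ι, _, x, y, rfl⟩ := hF
  refine ⟨fun n => ∑ a, ‖x a‖ * ‖star L (tailProj n (y a))‖, ?_, fun n => ?_⟩
  · have h : ∀ a ∈ (Finset.univ : Finset ι),
        Tendsto (fun n => ‖x a‖ * ‖star L (tailProj n (y a))‖) atTop (𝓝 (‖x a‖ * ‖star L 0‖)) :=
      fun a _ => (((star L).continuous.tendsto 0).comp (tendsto_tailProj (y a))).norm.const_mul _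
    simpa using tendsto_finsetSum _ h
  · rw [Finset.sum_mul, Finset.sum_mul]
    refine IdealLE.sum _ fun a => ?_
    have h1 : InnerProductSpace.rankOne ℂ (x a) (y a) * tailProj n
        = InnerProductSpace.rankOne ℂ (x a) (star (tailProj n) (y a)) :=
      InnerProductSpace.rankOne_comp _ _ _
    have h2 : InnerProductSpace.rankOne ℂ (x a) (star (tailProj n) (y a)) * L
        = InnerProductSpace.rankOne ℂ (x a) (star L (star (tailProj n) (y a))) :=
      InnerProductSpace.rankOne_comp _ _ _
    rw [h1, h2, tailProj, star_diagOp]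
    exact IdealLE.rankOne _ _

/-- The determinant is multiplicative: the corner of `K * L` and the product of the corners differ
by the corner of `K * tailProj n * L`, which tends to zero in the ideal. -/
lemma opDet_mul {X Y : Op} (hX : DetClass X) (hY : DetClass Y) :
    opDet (X * Y) = opDet X * opDet Y := by
  set K := X - 1 with hK
  set L := Y - 1
  have hXY := hX.mul hY
  obtain ⟨M, hM⟩ := IdealMem.exists_idealLE hXY
  obtain ⟨N, hN⟩ := IdealMem.exists_idealLE hY
  have hN0 := hN.nonneg
  have hC := lipConst_pos M
  have hcorner : ∀ n, corner X n * corner Y n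
      = corner (1 + (X * Y - 1 - K * tailProj n * L)) n := by
    intro n
    have e1 : X = 1 + K := by rw [hK]; abel
    have e2 : Y = 1 + L := by simp only [L]; abel
    have e3 : (1 : Op) + (X * Y - 1 - K * tailProj n * L)
        = 1 + K + L + K * (1 - tailProj n) * L := by
      rw [e1, e2]; noncomm_ring
    rw [e3, corner_add, corner_mul_one_sub_tailProj, corner_add, corner_add, corner_one, e1, e2,
      corner_one_add, corner_one_add]
    noncomm_ring
  have key : ∀ ε > 0, ε < 1 → ‖opDet X * opDet Y - opDet (X * Y)‖ ≤ lipConst M * ε := by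
    intro ε hε hε1
    obtain ⟨F, hF, hF'⟩ := hX (ε / 2 / (N + 1)) (by positivity)
    obtain ⟨a, ha, ha'⟩ := hF.tendsto_mul_tailProj L
    refine le_of_tendsto ((hX.tendsto.mul hY.tendsto).sub hXY.tendsto).norm ?_
    filter_upwards [ha.eventually (gt_mem_nhds (half_pos hε))] with n hn
    rw [← Matrix.det_mul, hcorner]
    have h1 : IdealLE (K * tailProj n * L) ε := by
      have h2 : IdealLE ((K - F) * tailProj n * L) (ε / 2) := by
        refine (((multLE_diagOp _ _).right hF').mul hN).mono ?_
        rw [one_mul, div_mul_eq_mul_div, div_le_iff₀ (by positivity)]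
        nlinarith
      have h3 := h2.add (ha' n)
      rw [← add_mul, ← add_mul, sub_add_cancel] at h3
      exact h3.mono (by linarith)
    have h4 := norm_det_corner_sub_le hM (L := X * Y - 1 - K * tailProj n * L) (ε := ε)
      (by rwa [sub_sub_cancel]) hε1 n
    rwa [add_sub_cancel] at h4
  have hlim : Tendsto (fun δ : ℝ => lipConst M * δ) (𝓝[>] 0) (𝓝 0) := by
    have hc : Continuous fun δ : ℝ => lipConst M * δ := by fun_prop
    simpa using (hc.tendsto 0).mono_left nhdsWithin_le_nhds
  have h0 : ‖opDet X * opDet Y - opDet (X * Y)‖ ≤ 0 := by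
    refine ge_of_tendsto hlim ?_
    filter_upwards [self_mem_nhdsWithin, Ioo_mem_nhdsGT one_pos] with δ h1 h2
    exact key δ h1 h2.2
  exact (sub_eq_zero.1 (norm_le_zero_iff.1 h0)).symm

/-- If `X` is close to `1 + z • K`, then its determinant is close to `1 + z * trace K`. -/
lemma norm_opDet_sub_le {X K : Op} {a ρ : ℝ} {z τ : ℂ} (hX : DetClass X) (ha : IdealLE (X - 1) a)
    (ha1 : a < 1) (hρ : IdealLE (X - 1 - z • K) ρ)
    (hτ : Tendsto (fun n => ∑ i ∈ Finset.range n, entry K i i) atTop (𝓝 τ)) :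
    ‖opDet X - 1 - z * τ‖ ≤ 10 * a ^ 2 + ρ := by
  refine le_of_tendsto ((hX.tendsto.sub_const 1).sub (hτ.const_mul z)).norm
    (Eventually.of_forall fun n => ?_)
  have h1 := norm_det_one_add_sub_trace_le (ha.traceFrobLE n) ha1
  have h2 := hρ.norm_sum_entry_le n
  rw [← corner_one_add, add_sub_cancel, trace_corner] at h1
  simp only [entry_sub (X - 1), entry_smul, Finset.sum_sub_distrib, ← Finset.mul_sum] at h2
  refine (norm_sub_le_norm_sub_add_norm_sub _ (∑ i ∈ Finset.range n, entry (X - 1) i i) _).trans ?_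
  exact add_le_add h1 h2

/-! ### Shifts -/

section Relabel

variable {ι κ : Type} [DecidableEq ι] [DecidableEq κ] (σ : ι → κ) (hσ : Function.Injective σ)

lemma orthonormal_bv_comp (hσ : Function.Injective σ) : Orthonormal ℂ fun i => bv (σ i) := by
  rw [orthonormal_iff_ite]
  intro i j
  simp [inner_bv_bv, hσ.eq_iff]

/-- The isometry `ℓ²(ι) → ℓ²(κ)` with `bv i ↦ bv (σ i)`, for an injective map `σ`. -/
def relabel : Ell2 ι →L[ℂ] Ell2 κ :=
  (orthonormal_bv_comp σ hσ).orthogonalFamily.linearIsometry.toContinuousLinearMap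

lemma relabel_bv (i : ι) : relabel σ hσ (bv i) = bv (σ i) := by
  simp [relabel, bv]

lemma norm_relabel_apply (x : Ell2 ι) : ‖relabel σ hσ x‖ = ‖x‖ :=
  (orthonormal_bv_comp σ hσ).orthogonalFamily.linearIsometry.norm_map x

lemma norm_relabel_le : ‖relabel σ hσ‖ ≤ 1 :=
  (relabel σ hσ).opNorm_le_bound zero_le_one fun x => by rw [norm_relabel_apply, one_mul]

lemma norm_adjoint_relabel_le : ‖(relabel σ hσ)†‖ ≤ 1 := by
  rw [LinearIsometryEquiv.norm_map]
  exact norm_relabel_le σ hσ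

lemma inner_bv_adjoint_relabel (i : ι) (y : Ell2 κ) :
    ⟪bv i, ((relabel σ hσ)†) y⟫_ℂ = ⟪bv (σ i), y⟫_ℂ := by
  rw [ContinuousLinearMap.adjoint_inner_right, relabel_bv]

lemma adjoint_relabel_bv (i : ι) : ((relabel σ hσ)†) (bv (σ i)) = bv i := by
  refine ext_inner_bv fun j => ?_
  rw [inner_bv_adjoint_relabel, inner_bv_bv, inner_bv_bv]
  simp [hσ.eq_iff]

lemma adjoint_relabel_bv_of_ne {k : κ} (hk : ∀ i, σ i ≠ k) : ((relabel σ hσ)†) (bv k) = 0 := by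
  refine ext_inner_bv fun j => ?_
  rw [inner_bv_adjoint_relabel, inner_bv_bv, if_neg (hk j), inner_zero_right]

lemma adjoint_relabel_comp_relabel : (relabel σ hσ)† ∘L relabel σ hσ = 1 := by
  refine ext_bv fun i => ?_
  rw [ContinuousLinearMap.comp_apply, relabel_bv, adjoint_relabel_bv, one_apply_eq_self]

end Relabel

/-- The unilateral shift `bv j ↦ bv (j + 1)` on `ℓ²(ℕ)`. -/
def shift : Op := relabel Nat.succ Nat.succ_injective

/-- The bilateral shift `bv k ↦ bv (k - 1)` on `ℓ²(ℤ)`. -/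
def bishift : Ell2 ℤ →L[ℂ] Ell2 ℤ := relabel (fun k => k - 1) (sub_left_injective)

/-- The embedding `ℓ²(ℕ) → ℓ²(ℤ)` with `bv i ↦ bv (-i)`. -/
def incl : Ell2 ℕ →L[ℂ] Ell2 ℤ :=
  relabel (fun i : ℕ => -(i : ℤ)) fun i j h => by simpa using h

/-- The embedding `ℓ²(ℕ) → ℓ²(ℤ)` with `bv m ↦ bv (m + 1)`, onto the complement of the range of
`incl`. -/
def coincl : Ell2 ℕ →L[ℂ] Ell2 ℤ :=
  relabel (fun m : ℕ => (m : ℤ) + 1) fun i j h => by simpa using h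

lemma shift_bv (j : ℕ) : shift (bv j) = bv (j + 1) := relabel_bv _ _ j

lemma star_shift_bv_succ (j : ℕ) : star shift (bv (j + 1)) = bv j :=
  adjoint_relabel_bv Nat.succ Nat.succ_injective j

lemma star_shift_bv_zero : star shift (bv 0) = 0 :=
  adjoint_relabel_bv_of_ne _ _ fun i => Nat.succ_ne_zero i

lemma bishift_bv (k : ℤ) : bishift (bv k) = bv (k - 1) := relabel_bv _ _ k

lemma star_bishift_bv (k : ℤ) : star bishift (bv k) = bv (k + 1) := by
  have := adjoint_relabel_bv (fun k : ℤ => k - 1) sub_left_injective (k + 1)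
  rwa [add_sub_cancel_right] at this

lemma incl_bv (i : ℕ) : incl (bv i) = bv (-(i : ℤ)) := relabel_bv _ _ i

lemma coincl_bv (m : ℕ) : coincl (bv m) = bv ((m : ℤ) + 1) := relabel_bv _ _ m

lemma adjoint_incl_comp_incl : incl† ∘L incl = 1 := adjoint_relabel_comp_relabel _ _

lemma adjoint_coincl_comp_coincl : coincl† ∘L coincl = 1 := adjoint_relabel_comp_relabel _ _

lemma adjoint_incl_bv_neg (i : ℕ) : (incl†) (bv (-(i : ℤ))) = bv i := adjoint_relabel_bv _ _ i

lemma adjoint_incl_bv_pos (m : ℕ) : (incl†) (bv ((m : ℤ) + 1)) = 0 :=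
  adjoint_relabel_bv_of_ne _ _ fun i => by omega

lemma adjoint_coincl_bv_neg (i : ℕ) : (coincl†) (bv (-(i : ℤ))) = 0 :=
  adjoint_relabel_bv_of_ne _ _ fun j => by omega

lemma adjoint_coincl_bv_pos (m : ℕ) : (coincl†) (bv ((m : ℤ) + 1)) = bv m :=
  adjoint_relabel_bv _ _ m

lemma incl_comp_adjoint_add : incl ∘L incl† + coincl ∘L coincl† = 1 := by
  refine ext_bv fun k => ?_
  simp only [_root_.add_apply, ContinuousLinearMap.comp_apply, one_apply_eq_self]
  rcases le_or_gt k 0 with h | h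
  · obtain ⟨i, rfl⟩ : ∃ i : ℕ, k = -(i : ℤ) := ⟨k.natAbs, by omega⟩
    rw [adjoint_incl_bv_neg, adjoint_coincl_bv_neg, incl_bv, map_zero, add_zero]
  · obtain ⟨m, rfl⟩ : ∃ m : ℕ, k = (m : ℤ) + 1 := ⟨(k - 1).natAbs, by omega⟩
    rw [adjoint_incl_bv_pos, adjoint_coincl_bv_pos, coincl_bv, map_zero, zero_add]

lemma bishift_comp_incl : bishift ∘L incl = incl ∘L shift := by
  refine ext_bv fun i => ?_
  simp only [ContinuousLinearMap.comp_apply, incl_bv, shift_bv, bishift_bv]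
  congr 1
  push_cast
  ring

lemma star_bishift_comp_coincl : star bishift ∘L coincl = coincl ∘L shift := by
  refine ext_bv fun i => ?_
  simp only [ContinuousLinearMap.comp_apply, coincl_bv, shift_bv, star_bishift_bv]
  congr 1

lemma adjoint_incl_comp_star_bishift : incl† ∘L star bishift = star shift ∘L incl† := by
  have := congrArg ContinuousLinearMap.adjoint bishift_comp_incl
  rwa [ContinuousLinearMap.adjoint_comp, ContinuousLinearMap.adjoint_comp] at this

lemma adjoint_coincl_comp_bishift : coincl† ∘L bishift = star shift ∘L coincl† := by
  have := congrArg ContinuousLinearMap.adjoint star_bishift_comp_coincl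
  rw [ContinuousLinearMap.adjoint_comp, ContinuousLinearMap.adjoint_comp] at this
  rwa [← ContinuousLinearMap.star_eq_adjoint (star bishift), star_star] at this

lemma bishift_mul_star : bishift * star bishift = 1 := by
  refine ext_bv fun k => ?_
  rw [mul_apply_eq_comp, star_bishift_bv, bishift_bv, one_apply_eq_self, add_sub_cancel_right]

lemma star_bishift_mul : star bishift * bishift = 1 := adjoint_relabel_comp_relabel _ _

lemma norm_shift_le : ‖shift‖ ≤ 1 := norm_relabel_le _ _

lemma norm_star_shift_le : ‖star shift‖ ≤ 1 := norm_adjoint_relabel_le _ _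

lemma norm_bishift_le : ‖bishift‖ ≤ 1 := norm_relabel_le _ _

lemma norm_star_bishift_le : ‖star bishift‖ ≤ 1 := norm_adjoint_relabel_le _ _

lemma multLE_of_left {A : Op} {α : ℝ} (hα : 0 ≤ α)
    (h : ∀ {K M}, IdealLE K M → IdealLE (A * K) (α * M))
    (h' : ∀ {K M}, IdealLE K M → IdealLE (star A * K) (α * M)) : MultLE A α where
  nonneg := hα
  left := h
  right hK := by simpa using (h' hK.star).star

lemma norm_mul_apply_le {A : Op} (hA : ‖A‖ ≤ 1) (K : Op) (x : Ell2 ℕ) : ‖(A * K) x‖ ≤ ‖K x‖ := by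
  simpa using A.le_of_opNorm_le hA (K x)

lemma multLE_shift : MultLE shift 1 := by
  refine multLE_of_left zero_le_one (fun {K M} hK => ?_) (fun {K M} hK => ?_) <;> rw [one_mul]
  · refine ⟨hK.nonneg, ?_, fun n => ?_, fun n => ?_, fun p q n => ?_⟩
    · calc ‖shift * K‖ ≤ ‖shift‖ * ‖K‖ := norm_mul_le _ _
        _ ≤ 1 * M := mul_le_mul norm_shift_le hK.norm_le (norm_nonneg _) zero_le_one
        _ = M := one_mul M
    · refine le_trans ?_ (hK.hs n)
      gcongr
      exact norm_mul_apply_le norm_shift_le _ _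
    · simp only [star_mul, mul_apply_eq_comp]
      cases n with
      | zero => simpa using sq_nonneg M
      | succ n =>
        rw [Finset.sum_range_succ', star_shift_bv_zero]
        simpa [star_shift_bv_succ] using hK.hs_star n
    · have hsucc : ∀ i j, entry (shift * K) (i + 1) j = entry K i j := by
        intro i j
        rw [entry_mul_eq_inner, star_shift_bv_succ, entry]
      have hzero : ∀ j, entry (shift * K) 0 j = 0 := by
        intro j
        rw [entry_mul_eq_inner, star_shift_bv_zero, inner_zero_left]
      cases p with
      | zero =>
        cases n with
        | zero => simpa using hK.nonneg
        | succ n =>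
          rw [Finset.sum_range_succ']
          simp only [add_zero, hsucc, hzero, norm_zero]
          simpa [add_assoc] using hK.diag 0 (1 + q) n
      | succ p =>
        simp only [← add_assoc, hsucc]
        exact hK.diag p q n
  · refine ⟨hK.nonneg, ?_, fun n => ?_, fun n => ?_, fun p q n => ?_⟩
    · calc ‖star shift * K‖ ≤ ‖star shift‖ * ‖K‖ := norm_mul_le _ _
        _ ≤ 1 * M := mul_le_mul norm_star_shift_le hK.norm_le (norm_nonneg _) zero_le_one
        _ = M := one_mul M
    · refine le_trans ?_ (hK.hs n)
      gcongr
      exact norm_mul_apply_le norm_star_shift_le _ _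
    · simp only [star_mul, star_star, mul_apply_eq_comp, shift_bv]
      exact IdealLE.sum_shift_sq_le hK.hs_star 1 n
    · have hsucc : ∀ i j, entry (star shift * K) i j = entry K (i + 1) j := by
        intro i j
        rw [entry_mul_eq_inner, star_star, shift_bv, entry]
      simp only [hsucc, add_assoc]
      exact hK.diag (p + 1) q n

/-! ### Power series in a contraction -/

section Series

variable {𝔸 : Type*} [NormedRing 𝔸] [NormedAlgebra ℂ 𝔸]

/-- The power series `∑ γ k * X ^ (k + 1)`, without constant term. -/
def ser (γ : ℕ → ℂ) (X : 𝔸) : 𝔸 := ∑' k, γ k • X ^ (k + 1)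

lemma norm_ser_term_le {X : 𝔸} (hX : ‖X‖ ≤ 1) (γ : ℕ → ℂ) (k : ℕ) :
    ‖γ k • X ^ (k + 1)‖ ≤ ‖γ k‖ := by
  rw [norm_smul]
  refine mul_le_of_le_one_right (norm_nonneg _) ?_
  exact (norm_pow_le' X k.succ_pos).trans (pow_le_one₀ (norm_nonneg _) hX)

lemma norm_ser_le {γ : ℕ → ℂ} (hγ : Summable fun k => ‖γ k‖) {X : 𝔸} (hX : ‖X‖ ≤ 1) :
    ‖ser γ X‖ ≤ ∑' k, ‖γ k‖ :=
  tsum_of_norm_bounded hγ.hasSum (norm_ser_term_le hX γ)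

variable [CompleteSpace 𝔸]

lemma hasSum_ser {γ : ℕ → ℂ} (hγ : Summable fun k => ‖γ k‖) {X : 𝔸} (hX : ‖X‖ ≤ 1) :
    HasSum (fun k => γ k • X ^ (k + 1)) (ser γ X) :=
  (Summable.of_norm_bounded hγ (norm_ser_term_le hX γ)).hasSum

lemma ser_add {γ δ : ℕ → ℂ} (hγ : Summable fun k => ‖γ k‖) (hδ : Summable fun k => ‖δ k‖)
    {X : 𝔸} (hX : ‖X‖ ≤ 1) : ser (γ + δ) X = ser γ X + ser δ X := by
  refine HasSum.tsum_eq ?_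
  simpa [add_smul] using (hasSum_ser hγ hX).add (hasSum_ser hδ hX)

lemma ser_smul {γ : ℕ → ℂ} (hγ : Summable fun k => ‖γ k‖) (z : ℂ)
    {X : 𝔸} (hX : ‖X‖ ≤ 1) : ser (z • γ) X = z • ser γ X := by
  refine HasSum.tsum_eq ?_
  simpa [mul_smul] using (hasSum_ser hγ hX).const_smul z

lemma commute_ser {γ δ : ℕ → ℂ} (hγ : Summable fun k => ‖γ k‖) (hδ : Summable fun k => ‖δ k‖)
    {X Y : 𝔸} (hX : ‖X‖ ≤ 1) (hY : ‖Y‖ ≤ 1) (h : Commute X Y) :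
    Commute (ser γ X) (ser δ Y) := by
  have h1 : ∀ k, Commute (X ^ (k + 1)) (ser δ Y) := by
    intro k
    refine ((hasSum_ser hδ hY).mul_left _).unique ?_
    refine ((hasSum_ser hδ hY).mul_right _).congr_fun fun j => ?_
    rw [mul_smul_comm, smul_mul_assoc, (h.pow_pow _ _).eq]
  refine ((hasSum_ser hγ hX).mul_right _).unique ?_
  refine ((hasSum_ser hγ hX).mul_left _).congr_fun fun j => ?_
  rw [mul_smul_comm, smul_mul_assoc, (h1 j).eq]

end Series

section Intertwining

variable {E F : Type*} [NormedAddCommGroup E] [NormedSpace ℂ E]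
  [NormedAddCommGroup F] [NormedSpace ℂ F]
  {X : E →L[ℂ] E} {Y : F →L[ℂ] F} {A : E →L[ℂ] F}

lemma intertwine_pow (h : A ∘L X = Y ∘L A) (n : ℕ) : A ∘L (X ^ n) = (Y ^ n) ∘L A := by
  induction n with
  | zero => rfl
  | succ n ih =>
    calc A ∘L (X ^ (n + 1)) = (A ∘L (X ^ n)) ∘L X := by rw [pow_succ]; rfl
      _ = (Y ^ n) ∘L (A ∘L X) := by rw [ih]; rfl
      _ = (Y ^ (n + 1)) ∘L A := by rw [h, pow_succ]; rfl

lemma intertwine_hasSum {κ : Type*} {f : κ → E →L[ℂ] E} {g : κ → F →L[ℂ] F} (hf : HasSum f X)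
    (hg : HasSum g Y) (h : ∀ k, A ∘L f k = g k ∘L A) : A ∘L X = Y ∘L A := by
  have h1 := hf.mapL (ContinuousLinearMap.compL ℂ E E F A)
  have h2 := hg.mapL ((ContinuousLinearMap.compL ℂ E F F).flip A)
  simp only [ContinuousLinearMap.compL_apply, ContinuousLinearMap.flip_apply, h] at h1 h2
  exact h1.unique h2

variable [CompleteSpace E] [CompleteSpace F]

lemma intertwine_exp (h : A ∘L X = Y ∘L A) :
    A ∘L NormedSpace.exp X = NormedSpace.exp Y ∘L A :=
  intertwine_hasSum (hasSum_exp X) (hasSum_exp Y) fun n => by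
    rw [ContinuousLinearMap.comp_smul, ContinuousLinearMap.smul_comp, intertwine_pow h]

lemma intertwine_ser {γ : ℕ → ℂ} (hγ : Summable fun k => ‖γ k‖) (hX : ‖X‖ ≤ 1) (hY : ‖Y‖ ≤ 1)
    (h : A ∘L X = Y ∘L A) : A ∘L ser γ X = ser γ Y ∘L A :=
  intertwine_hasSum (hasSum_ser hγ hX) (hasSum_ser hγ hY) fun n => by
    rw [ContinuousLinearMap.comp_smul, ContinuousLinearMap.smul_comp, intertwine_pow h]

end Intertwining

lemma multLE_ser {X : Op} (hX : MultLE X 1) (hX1 : ‖X‖ ≤ 1) {γ : ℕ → ℂ}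
    (hγ : Summable fun k => ‖γ k‖) : MultLE (ser γ X) (∑' k, ‖γ k‖) :=
  MultLE.hasSum (fun k => ((hX.pow (k + 1)).smul (γ k)).mono (by simp)) hγ.hasSum
    (hasSum_ser hγ hX1)

/-! ### Hankel operators -/

/-- The smoothness condition on the coefficients of the logarithm of the symbol; `γ k` is the
coefficient with index `k + 1`. -/
structure IsKrein (γ : ℕ → ℂ) : Prop where
  summable : Summable fun k => ‖γ k‖
  summable_sq : Summable fun k : ℕ => ((k : ℝ) + 1) * ‖γ k‖ ^ 2

namespace IsKrein

variable {γ δ : ℕ → ℂ}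

lemma of_norm_le (hδ : IsKrein δ) (h : ∀ k, ‖γ k‖ ≤ ‖δ k‖) : IsKrein γ where
  summable := hδ.summable.of_nonneg_of_le (fun _ => norm_nonneg _) h
  summable_sq := hδ.summable_sq.of_nonneg_of_le (fun _ => by positivity) fun k => by
    gcongr
    exact h k

lemma smul (hγ : IsKrein γ) (z : ℂ) : IsKrein (z • γ) where
  summable := by
    simpa [norm_smul] using hγ.summable.mul_left ‖z‖
  summable_sq := by
    refine (hγ.summable_sq.mul_left (‖z‖ ^ 2)).congr fun k => ?_
    simp only [Pi.smul_apply, norm_smul]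
    ring

lemma star (hγ : IsKrein γ) : IsKrein (star γ) :=
  hγ.of_norm_le fun k => by simp

lemma summable_mul (hγ : IsKrein γ) (hδ : IsKrein δ) :
    Summable fun k : ℕ => ((k : ℝ) + 1) * (‖γ k‖ * ‖δ k‖) :=
  (hγ.summable_sq.add hδ.summable_sq).of_nonneg_of_le (fun _ => by positivity) fun k => by
    have h4 : (0 : ℝ) ≤ (k : ℝ) + 1 := by positivity
    have h1 : ‖γ k‖ * ‖δ k‖ ≤ ‖γ k‖ ^ 2 + ‖δ k‖ ^ 2 := by
      nlinarith [sq_nonneg (‖γ k‖ - ‖δ k‖), sq_nonneg (‖γ k‖), sq_nonneg (‖δ k‖)]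
    nlinarith [mul_le_mul_of_nonneg_left h1 h4]

end IsKrein

/-- The index `k = p.1 + p.2` occurs `k + 1` times; this is the source of the weights `k + 1`. -/
lemma hasSum_antidiagonal {𝕜 : Type*} [RCLike 𝕜] {φ : ℕ → 𝕜}
    (hφ : Summable fun k : ℕ => ((k : ℝ) + 1) * ‖φ k‖) :
    HasSum (fun p : ℕ × ℕ => φ (p.1 + p.2)) (∑' k : ℕ, ((k : 𝕜) + 1) * φ k) := by
  have hs : Summable fun p : ℕ × ℕ => ‖φ (p.1 + p.2)‖ := by
    rw [← (Finset.HasAntidiagonal.sigmaAntidiagonalEquivProd (A := ℕ)).summable_iff]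
    refine (summable_sigma_of_nonneg fun x => norm_nonneg (φ _)).2
      ⟨fun n => (hasSum_fintype _).summable, hφ.congr fun k => ?_⟩
    have h1 : ∀ x : Finset.HasAntidiagonal.antidiagonal k,
        ‖φ ((Finset.HasAntidiagonal.sigmaAntidiagonalEquivProd ⟨k, x⟩).1
          + (Finset.HasAntidiagonal.sigmaAntidiagonalEquivProd ⟨k, x⟩).2)‖ = ‖φ k‖ := by
      rintro ⟨x, hx⟩
      simp [Finset.HasAntidiagonal.sigmaAntidiagonalEquivProd,
        Finset.HasAntidiagonal.mem_antidiagonal.1 hx]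
    simp only [h1, tsum_fintype, Finset.sum_const, Finset.card_univ, Fintype.card_coe,
      Finset.Nat.card_antidiagonal, nsmul_eq_mul]
    push_cast
    ring
  have hs' : Summable fun p : ℕ × ℕ => φ (p.1 + p.2) := hs.of_norm
  convert hs'.hasSum using 1
  have hs'' : Summable fun c : (n : ℕ) × Finset.HasAntidiagonal.antidiagonal n =>
      φ ((Finset.HasAntidiagonal.sigmaAntidiagonalEquivProd c).1
        + (Finset.HasAntidiagonal.sigmaAntidiagonalEquivProd c).2) :=
    (Finset.HasAntidiagonal.sigmaAntidiagonalEquivProd (A := ℕ)).summable_iff.2 hs'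
  rw [← (Finset.HasAntidiagonal.sigmaAntidiagonalEquivProd (A := ℕ)).tsum_eq, hs''.tsum_sigma]
  refine tsum_congr fun k => ?_
  have h1 : ∀ x : Finset.HasAntidiagonal.antidiagonal k,
      φ ((Finset.HasAntidiagonal.sigmaAntidiagonalEquivProd ⟨k, x⟩).1
        + (Finset.HasAntidiagonal.sigmaAntidiagonalEquivProd ⟨k, x⟩).2) = φ k := by
    rintro ⟨x, hx⟩
    simp [Finset.HasAntidiagonal.sigmaAntidiagonalEquivProd,
        Finset.HasAntidiagonal.mem_antidiagonal.1 hx]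
  simp only [h1, tsum_fintype, Finset.sum_const, Finset.card_univ, Fintype.card_coe,
    Finset.Nat.card_antidiagonal, nsmul_eq_mul]
  push_cast
  ring

/-- The Hankel operator with matrix entries `γ (i + m)`, as a compression of a function of the
bilateral shift. -/
def hankel (γ : ℕ → ℂ) : Op := incl† ∘L ser γ bishift ∘L coincl

lemma bishift_pow_bv (n : ℕ) (k : ℤ) : (bishift ^ n) (bv k) = bv (k - n) := by
  induction n with
  | zero => simp
  | succ n ih =>
    rw [pow_succ', mul_apply_eq_comp, ih, bishift_bv]
    congr 1
    push_cast
    ring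

section Hankel

variable {γ : ℕ → ℂ}

lemma hasSum_inner_ser_bishift (hγ : Summable fun k => ‖γ k‖) (l m : ℤ) :
    HasSum (fun k : ℕ => γ k * if l = m - ((k : ℤ) + 1) then 1 else 0)
      ⟪bv l, ser γ bishift (bv m)⟫_ℂ := by
  have h1 := (hasSum_ser hγ norm_bishift_le).mapL (ContinuousLinearMap.apply ℂ (Ell2 ℤ) (bv m))
  have h2 := h1.mapL (innerSL ℂ (bv l))
  refine h2.congr_fun fun k => ?_
  simp only [ContinuousLinearMap.apply_apply, _root_.smul_apply, bishift_pow_bv,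
    innerSL_apply_apply, inner_smul_right, inner_bv_bv]
  push_cast
  rfl

lemma entry_hankel (hγ : Summable fun k => ‖γ k‖) (i m : ℕ) : entry (hankel γ) i m = γ (i + m) := by
  have h0 : entry (hankel γ) i m = ⟪bv (-(i : ℤ)), ser γ bishift (bv ((m : ℤ) + 1))⟫_ℂ := by
    rw [entry, hankel, ContinuousLinearMap.comp_apply, ContinuousLinearMap.comp_apply,
      ContinuousLinearMap.adjoint_inner_right, incl_bv, coincl_bv]
  rw [h0]
  refine (hasSum_inner_ser_bishift hγ _ _).unique ?_
  convert hasSum_ite_eq (i + m) (γ (i + m)) using 2 with k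
  by_cases hk : k = i + m
  · subst hk
    rw [if_pos (by push_cast; ring)]
    simp
  · rw [if_neg (by omega), if_neg hk, mul_zero]

/-- The sum of the `ℓ¹` norm and the weighted `ℓ²` norm in `IsKrein`. -/
def kreinNorm (γ : ℕ → ℂ) : ℝ := ∑' k, ‖γ k‖ + √(∑' k : ℕ, ((k : ℝ) + 1) * ‖γ k‖ ^ 2)

lemma norm_hankel_le (hγ : Summable fun k => ‖γ k‖) : ‖hankel γ‖ ≤ ∑' k, ‖γ k‖ := by
  have h1 : ‖incl†‖ ≤ 1 := norm_adjoint_relabel_le _ _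
  have h2 : ‖coincl‖ ≤ 1 := norm_relabel_le _ _
  have h3 := norm_ser_le hγ norm_bishift_le
  calc ‖hankel γ‖ ≤ ‖incl†‖ * (‖ser γ bishift‖ * ‖coincl‖) :=
        (ContinuousLinearMap.opNorm_comp_le _ _).trans
          (by gcongr; exact ContinuousLinearMap.opNorm_comp_le _ _)
    _ ≤ 1 * ((∑' k, ‖γ k‖) * 1) := by gcongr
    _ = _ := by ring

/-- The square of the Hilbert–Schmidt norm of a Hankel operator is a weighted `ℓ²` norm. -/
lemma sum_norm_sq_le_of_entry {K : Op} {γ : ℕ → ℂ} (hγ : IsKrein γ)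
    (hK : ∀ i j, ‖⟪bv i, K (bv j)⟫_ℂ‖ = ‖γ (i + j)‖) (n : ℕ) :
    ∑ j ∈ Finset.range n, ‖K (bv j)‖ ^ 2 ≤ ∑' k : ℕ, ((k : ℝ) + 1) * ‖γ k‖ ^ 2 := by
  have h2 : HasSum (fun p : ℕ × ℕ => ‖γ (p.1 + p.2)‖ ^ 2)
      (∑' k : ℕ, ((k : ℝ) + 1) * ‖γ k‖ ^ 2) :=
    hasSum_antidiagonal (𝕜 := ℝ) (φ := fun k => ‖γ k‖ ^ 2) (by simpa using hγ.summable_sq)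
  have h3 : ∀ j ∈ Finset.range n, HasSum (fun i => ‖γ (j + i)‖ ^ 2) (‖K (bv j)‖ ^ 2) := by
    intro j _
    refine (hasSum_norm_sq (K (bv j))).congr_fun fun i => ?_
    rw [hK, add_comm]
  have h4 := h2.prod_fiberwise fun j => (h2.summable.prod_factor j).hasSum
  refine le_trans (le_of_eq (Finset.sum_congr rfl fun j hj => ?_))
    (sum_le_hasSum (Finset.range n) (fun j _ => ?_) h4)
  · exact ((h3 j hj).tsum_eq).symm
  · exact tsum_nonneg fun _ => by positivity

lemma idealLE_hankel (hγ : IsKrein γ) : IdealLE (hankel γ) (kreinNorm γ) := by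
  have h1 : 0 ≤ ∑' k, ‖γ k‖ := tsum_nonneg fun _ => norm_nonneg _
  have h2 : 0 ≤ √(∑' k : ℕ, ((k : ℝ) + 1) * ‖γ k‖ ^ 2) := Real.sqrt_nonneg _
  have h3 : ∑' k : ℕ, ((k : ℝ) + 1) * ‖γ k‖ ^ 2 ≤ kreinNorm γ ^ 2 := by
    have h4 : 0 ≤ ∑' k : ℕ, ((k : ℝ) + 1) * ‖γ k‖ ^ 2 := tsum_nonneg fun _ => by positivity
    have h5 := Real.sq_sqrt h4
    unfold kreinNorm
    nlinarith
  have hH := entry_hankel hγ.summable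
  refine ⟨add_nonneg h1 h2, (norm_hankel_le hγ.summable).trans (le_add_of_nonneg_right h2),
    fun n => ?_, fun n => ?_, fun p q n => ?_⟩
  · refine (sum_norm_sq_le_of_entry hγ (fun i j => ?_) n).trans h3
    exact congrArg norm (hH i j)
  · refine (sum_norm_sq_le_of_entry hγ (fun i j => ?_) n).trans h3
    have := entry_star (hankel γ) i j
    rw [hH] at this
    rw [← entry, this, norm_star, add_comm]
  · simp only [hH]
    refine le_trans ?_ (le_add_of_nonneg_right h2)
    have hinj : Function.Injective fun i : ℕ => i + p + (i + q) := fun i j h => by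
      simp only at h
      omega
    have := hγ.summable.sum_le_tsum ((Finset.range n).map ⟨_, hinj⟩) fun _ _ => norm_nonneg _
    simpa using this

lemma hankel_add {δ : ℕ → ℂ} (hγ : Summable fun k => ‖γ k‖) (hδ : Summable fun k => ‖δ k‖) :
    hankel (γ + δ) = hankel γ + hankel δ := by
  rw [hankel, ser_add hγ hδ norm_bishift_le]
  simp [hankel]

lemma hankel_smul (hγ : Summable fun k => ‖γ k‖) (z : ℂ) : hankel (z • γ) = z • hankel γ := by
  rw [hankel, ser_smul hγ z norm_bishift_le]
  simp [hankel]

lemma isFiniteRank_one_sub_tailProj (n : ℕ) : IsFiniteRank (1 - tailProj n) := by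
  rw [one_sub_tailProj]
  exact IsFiniteRank.sum _ fun l => IsFiniteRank.rankOne _ _

lemma ext_entry {K L : Op} (h : ∀ i j, entry K i j = entry L i j) : K = L :=
  ext_bv fun j => ext_inner_bv fun i => h i j

lemma idealMem_hankel (hγ : IsKrein γ) : IdealMem (hankel γ) := by
  intro ε hε
  let τ : ℕ → ℕ → ℂ := fun d k => if k < d then 0 else γ k
  have hτ : ∀ d, IsKrein (τ d) := fun d => hγ.of_norm_le fun k => by
    simp only [τ]
    split_ifs <;> simp
  -- the tails `τ d` of `γ` tend to zero, and the truncations have finite rank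
  have hlim : Tendsto (fun d => kreinNorm (τ d)) atTop (𝓝 0) := by
    have key : ∀ (a : ℕ → ℝ), Summable a → Tendsto (fun d => ∑' k, if k < d then 0 else a k) atTop
        (𝓝 0) := by
      intro a ha
      have := tendsto_sum_nat_add a
      refine this.congr fun d => ?_
      have hs : Summable fun k => if k < d then 0 else a k :=
        ha.norm.of_norm_bounded fun k => by split_ifs <;> simp
      rw [← hs.sum_add_tsum_nat_add d,
        Finset.sum_eq_zero fun i hi => if_pos (Finset.mem_range.1 hi),
        zero_add]
      exact tsum_congr fun k => (if_neg (by omega)).symm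
    have h1 := key _ hγ.summable
    have h2 := (key _ hγ.summable_sq).sqrt
    rw [Real.sqrt_zero] at h2
    have h3 := h1.add h2
    rw [add_zero] at h3
    refine h3.congr fun d => ?_
    simp only [kreinNorm, τ]
    congr 2
    · funext k
      split_ifs <;> simp
    · exact tsum_congr fun k => by split_ifs <;> simp
  obtain ⟨d, hd⟩ := (hlim.eventually (gt_mem_nhds hε)).exists
  have hsplit : (γ - τ d) + τ d = γ := sub_add_cancel _ _
  have hρ : IsKrein (γ - τ d) := hγ.of_norm_le fun k => by
    simp only [τ, Pi.sub_apply]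
    split_ifs <;> simp
  refine ⟨hankel (γ - τ d), ?_, ?_⟩
  · have : hankel (γ - τ d) = hankel (γ - τ d) * (1 - tailProj d) := by
      rw [mul_sub, mul_one, eq_comm, sub_eq_self]
      refine ext_entry fun i j => ?_
      have h0 : ∀ j, ¬ j < d → entry (hankel (γ - τ d)) i j = 0 := by
        intro j hj
        rw [entry_hankel hρ.summable]
        simp only [τ, Pi.sub_apply]
        rw [if_neg (by omega), sub_self]
      rw [entry, mul_apply_eq_comp, tailProj_bv]
      split_ifs with h
      · simp [entry]
      · rw [← entry, h0 j h]
        simp [entry]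
    rw [this]
    exact (isFiniteRank_one_sub_tailProj d).mul_left _
  · have : hankel γ - hankel (γ - τ d) = hankel (τ d) := by
      conv_lhs => rw [← hsplit, hankel_add (by simpa [hsplit] using hρ.summable) (hτ d).summable]
      rw [hsplit]
      abel
    rw [this]
    exact (idealLE_hankel (hτ d)).mono hd.le

end Hankel

/-! ### Triangular Toeplitz operators and their multiplicative commutators -/

/-- The lower triangular Toeplitz operator with symbol `exp (∑ γ k t ^ (k + 1))`. -/
def low (γ : ℕ → ℂ) : Op := NormedSpace.exp (ser γ shift)

/-- The upper triangular Toeplitz operator with symbol `exp (∑ β k t ^ (-(k + 1)))`. -/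
def up (β : ℕ → ℂ) : Op := NormedSpace.exp (ser β (star shift))

section ExpSer

variable {𝔸 : Type*} [NormedRing 𝔸] [NormedAlgebra ℂ 𝔸] [CompleteSpace 𝔸]

lemma exp_add_of_commute' {X Y : 𝔸} (h : Commute X Y) :
    NormedSpace.exp (X + Y) = NormedSpace.exp X * NormedSpace.exp Y := by
  let _ : NormedAlgebra ℚ 𝔸 := NormedAlgebra.restrictScalars ℚ ℂ 𝔸
  exact NormedSpace.exp_add_of_commute h

lemma ser_neg {γ : ℕ → ℂ} (hγ : Summable fun k => ‖γ k‖) {X : 𝔸} (hX : ‖X‖ ≤ 1) :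
    ser (-γ) X = -ser γ X := by
  simpa using ser_smul hγ (-1) hX

end ExpSer

section LowUp

variable {β γ δ : ℕ → ℂ}

lemma low_add (hγ : IsKrein γ) (hδ : IsKrein δ) : low (γ + δ) = low γ * low δ := by
  rw [low, ser_add hγ.summable hδ.summable norm_shift_le]
  exact exp_add_of_commute' (commute_ser hγ.summable hδ.summable norm_shift_le norm_shift_le rfl)

lemma up_add (hγ : IsKrein γ) (hδ : IsKrein δ) : up (γ + δ) = up γ * up δ := by
  rw [up, ser_add hγ.summable hδ.summable norm_star_shift_le]
  exact exp_add_of_commute'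
    (commute_ser hγ.summable hδ.summable norm_star_shift_le norm_star_shift_le rfl)

lemma IsKrein.neg (hγ : IsKrein γ) : IsKrein (-γ) := by
  simpa using hγ.smul (-1)

lemma low_zero : low 0 = 1 := by simp [low, ser]

lemma up_zero : up 0 = 1 := by simp [up, ser]

lemma low_mul_low_neg (hγ : IsKrein γ) : low γ * low (-γ) = 1 := by
  rw [← low_add hγ hγ.neg, add_neg_cancel, low_zero]

lemma low_neg_mul_low (hγ : IsKrein γ) : low (-γ) * low γ = 1 := by
  rw [← low_add hγ.neg hγ, neg_add_cancel, low_zero]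

lemma up_mul_up_neg (hγ : IsKrein γ) : up γ * up (-γ) = 1 := by
  rw [← up_add hγ hγ.neg, add_neg_cancel, up_zero]

lemma up_neg_mul_up (hγ : IsKrein γ) : up (-γ) * up γ = 1 := by
  rw [← up_add hγ.neg hγ, neg_add_cancel, up_zero]

lemma multLE_ser_shift (hγ : IsKrein γ) : MultLE (ser γ shift) (∑' k, ‖γ k‖) :=
  multLE_ser multLE_shift norm_shift_le hγ.summable

lemma multLE_ser_star_shift (hγ : IsKrein γ) : MultLE (ser γ (star shift)) (∑' k, ‖γ k‖) :=
  multLE_ser multLE_shift.star norm_star_shift_le hγ.summable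

lemma multLE_low (hγ : IsKrein γ) : MultLE (low γ) (Real.exp (∑' k, ‖γ k‖)) :=
  (multLE_ser_shift hγ).exp

lemma multLE_up (hγ : IsKrein γ) : MultLE (up γ) (Real.exp (∑' k, ‖γ k‖)) :=
  (multLE_ser_star_shift hγ).exp

end LowUp

section Commutator

variable {B C : Op} {g M : ℝ}

lemma idealMem_exp_commutator (hB : MultLE B g) (hC : MultLE C g)
    (hD : IdealMem (B * C - C * B)) :
    IdealMem (NormedSpace.exp B * NormedSpace.exp C - NormedSpace.exp C * NormedSpace.exp B) := by
  have h1 := idealMem_of_hasSum_duhamel hB hB (hasSum_duhamel_sub B B C) hD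
  have h2 := idealMem_of_hasSum_duhamel hC hC (hasSum_duhamel_sub C C (NormedSpace.exp B))
    (by simpa using h1.smul (-1))
  simpa using h2.smul (-1)

/-- To leading order, the multiplicative commutator of `exp B` and `exp C` is
`1 + (B * C - C * B)`. -/
lemma idealLE_exp_commutator (hB : MultLE B g) (hC : MultLE C g)
    (hD : IdealLE (B * C - C * B) M) {K : Op}
    (hK : K = NormedSpace.exp (-C) * (NormedSpace.exp B * NormedSpace.exp C
      - NormedSpace.exp C * NormedSpace.exp B) * NormedSpace.exp (-B)) :
    IdealLE K (Real.exp g ^ 4 * M) ∧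
      IdealLE (K - (B * C - C * B)) ((Real.exp g - 1) * (4 * Real.exp g ^ 3 * M)) := by
  set U := NormedSpace.exp B
  set L := NormedSpace.exp C
  set e := Real.exp g
  have he : 1 ≤ e := Real.one_le_exp hB.nonneg
  have hM := hD.nonneg
  have a1 : IdealLE (U * C - C * U) (e * M) :=
    idealLE_of_hasSum_duhamel hB hB (hasSum_duhamel_sub B B C) hD
  have a2 : IdealLE (U * C - C * U - (B * C - C * B)) ((e - 1) * M) :=
    idealLE_sub_of_hasSum_duhamel hB hB (hasSum_duhamel_sub B B C) hD
  have a1' : IdealLE (C * U - U * C) (e * M) := by simpa using a1.neg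
  have b1 : IdealLE (L * U - U * L) (e * (e * M)) :=
    idealLE_of_hasSum_duhamel hC hC (hasSum_duhamel_sub C C U) a1'
  have b2 : IdealLE (L * U - U * L - (C * U - U * C)) ((e - 1) * (e * M)) :=
    idealLE_sub_of_hasSum_duhamel hC hC (hasSum_duhamel_sub C C U) a1'
  have b1' : IdealLE (U * L - L * U) (e * (e * M)) := by simpa using b1.neg
  have hL' : MultLE (NormedSpace.exp (-C)) e := hC.neg.exp
  have hL'' : MultLE (NormedSpace.exp (-C) - 1) (e - 1) := hC.neg.exp_sub_one
  have hU' : MultLE (NormedSpace.exp (-B)) e := hB.neg.exp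
  have hU'' : MultLE (NormedSpace.exp (-B) - 1) (e - 1) := hB.neg.exp_sub_one
  constructor
  · rw [hK]
    exact (hU'.right (hL'.left b1')).mono (le_of_eq (by ring))
  · have c1 := hU'.right (hL''.left b1')
    have c2 := hU''.right b1'
    have h := ((c1.add c2).sub b2).add a2
    have e1 : (NormedSpace.exp (-C) - 1) * (U * L - L * U) * NormedSpace.exp (-B)
        + (U * L - L * U) * (NormedSpace.exp (-B) - 1) - (L * U - U * L - (C * U - U * C))
        + (U * C - C * U - (B * C - C * B)) = K - (B * C - C * B) := by
      rw [hK]; noncomm_ring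
    rw [e1] at h
    refine h.mono ?_
    have h1 : e ≤ e ^ 3 := le_self_pow₀ he (by norm_num)
    have h2 : e ^ 2 ≤ e ^ 3 := pow_le_pow_right₀ he (by norm_num)
    have h3 : 1 ≤ e ^ 3 := one_le_pow₀ he
    have h4 : (0 : ℝ) ≤ (e - 1) * M := mul_nonneg (by linarith) hM
    have h5 : e * ((e - 1) * (e * (e * M))) + (e - 1) * (e * (e * M)) + (e - 1) * (e * M)
        + (e - 1) * M = (e - 1) * M * (e ^ 3 + e ^ 2 + e + 1) := by ring
    rw [h5]
    calc (e - 1) * M * (e ^ 3 + e ^ 2 + e + 1) ≤ (e - 1) * M * (4 * e ^ 3) := by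
          gcongr
          linarith
      _ = _ := by ring

end Commutator

lemma star_ser {H : Type*} [NormedAddCommGroup H] [InnerProductSpace ℂ H] [CompleteSpace H]
    {γ : ℕ → ℂ} (hγ : Summable fun k => ‖γ k‖) {X : H →L[ℂ] H} (hX : ‖X‖ ≤ 1) :
    star (ser γ X) = ser (star γ) (star X) := by
  refine (HasSum.tsum_eq ?_).symm
  have := (hasSum_ser hγ hX).star
  simpa only [star_smul, star_pow, Pi.star_apply] using this

section Szego

variable {β γ δ : ℕ → ℂ}

lemma ser_bishift_incl (hγ : Summable fun k => ‖γ k‖) (x : Ell2 ℕ) :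
    ser γ bishift (incl x) = incl (ser γ shift x) :=
  (congrArg (fun A => A x)
    (intertwine_ser hγ norm_shift_le norm_bishift_le bishift_comp_incl.symm)).symm

lemma adjoint_incl_incl (x : Ell2 ℕ) : (incl†) (incl x) = x :=
  congrArg (fun A => A x) adjoint_incl_comp_incl

lemma adjoint_coincl_coincl (x : Ell2 ℕ) : (coincl†) (coincl x) = x :=
  congrArg (fun A => A x) adjoint_coincl_comp_coincl

lemma incl_adjoint_add (x : Ell2 ℤ) : incl ((incl†) x) + coincl ((coincl†) x) = x :=
  congrArg (fun A => A x) incl_comp_adjoint_add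

lemma hankel_apply (γ : ℕ → ℂ) (x : Ell2 ℕ) :
    hankel γ x = (incl†) (ser γ bishift (coincl x)) := rfl

/-- A lower triangular Toeplitz operator is a compression of a Laurent operator up to a Hankel
operator. -/
lemma adjoint_incl_ser_bishift (hγ : Summable fun k => ‖γ k‖) (x : Ell2 ℤ) :
    (incl†) (ser γ bishift x) = ser γ shift ((incl†) x) + hankel γ ((coincl†) x) := by
  conv_lhs => rw [← incl_adjoint_add x]
  rw [map_add, map_add, ser_bishift_incl hγ, adjoint_incl_incl, hankel_apply]

lemma adjoint_incl_ser_star_bishift (hβ : Summable fun k => ‖β k‖) (x : Ell2 ℤ) :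
    (incl†) (ser β (star bishift) x) = ser β (star shift) ((incl†) x) :=
  congrArg (fun A => A x) (intertwine_ser hβ norm_star_bishift_le norm_star_shift_le
    adjoint_incl_comp_star_bishift)

lemma adjoint_coincl_comp_ser_star_bishift (hβ : IsKrein β) :
    coincl† ∘L ser β (star bishift) ∘L incl = star (hankel (star β)) := by
  rw [hankel, ContinuousLinearMap.star_eq_adjoint (incl† ∘L _), ContinuousLinearMap.adjoint_comp,
    ContinuousLinearMap.adjoint_comp, ContinuousLinearMap.adjoint_adjoint,
    ← ContinuousLinearMap.star_eq_adjoint (ser (star β) bishift),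
    star_ser hβ.star.summable norm_bishift_le, star_star, ContinuousLinearMap.comp_assoc]

lemma commute_ser_bishift (hβ : IsKrein β) (hγ : IsKrein γ) :
    Commute (ser β (star bishift)) (ser γ bishift) :=
  commute_ser hβ.summable hγ.summable norm_star_bishift_le norm_bishift_le
    (by rw [commute_iff_eq, star_bishift_mul, bishift_mul_star])

/-- The commutator of an upper and a lower triangular Toeplitz operator is a product of two Hankel
operators. -/
lemma ser_commutator (hβ : IsKrein β) (hγ : IsKrein γ) :
    ser β (star shift) * ser γ shift - ser γ shift * ser β (star shift)
      = hankel γ * star (hankel (star β)) := by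
  ext1 x
  have h3 : ser β (star bishift) (ser γ bishift (incl x))
      = ser γ bishift (ser β (star bishift) (incl x)) :=
    congrArg (fun A => A (incl x)) (commute_ser_bishift hβ hγ).eq
  have h4 : (incl†) (ser β (star bishift) (ser γ bishift (incl x)))
      = ser β (star shift) (ser γ shift x) := by
    rw [adjoint_incl_ser_star_bishift hβ.summable, ser_bishift_incl hγ.summable, adjoint_incl_incl]
  have h5 : (coincl†) (ser β (star bishift) (incl x)) = star (hankel (star β)) x :=
    congrArg (fun A => A x) (adjoint_coincl_comp_ser_star_bishift hβ)
  rw [h3, adjoint_incl_ser_bishift hγ.summable, adjoint_incl_ser_star_bishift hβ.summable,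
    adjoint_incl_incl, h5] at h4
  simp only [_root_.sub_apply, mul_apply_eq_comp]
  rw [← h4, add_sub_cancel_left]

lemma tendsto_trace_ser_commutator (hβ : IsKrein β) (hγ : IsKrein γ) :
    Tendsto (fun n => ∑ i ∈ Finset.range n, entry (hankel γ * star (hankel (star β))) i i) atTop
      (𝓝 (∑' k : ℕ, ((k : ℂ) + 1) * (β k * γ k))) := by
  have h1 := hasSum_antidiagonal (φ := fun k => β k * γ k)
    (by simpa using hβ.summable_mul hγ)
  have h2 : ∀ i, HasSum (fun m => β (i + m) * γ (i + m))
      (entry (hankel γ * star (hankel (star β))) i i) := by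
    intro i
    rw [entry_mul_eq_inner]
    refine (hasSum_inner_mul_inner _ _).congr_fun fun m => ?_
    rw [← entry_eq_inner_star, ← entry, entry_star, entry_hankel hγ.summable,
      entry_hankel hβ.star.summable, Pi.star_apply, star_star, mul_comm]
  exact (h1.prod_fiberwise h2).tendsto_sum_nat

/-- The multiplicative commutator of `up β` and `low γ`. -/
def toeplitzComm (β γ : ℕ → ℂ) : Op := low (-γ) * up β * low γ * up (-β)

/-- The constant in Szegő's strong limit theorem. -/
def szego (β γ : ℕ → ℂ) : ℂ := opDet (toeplitzComm β γ)

lemma toeplitzComm_sub_one (hβ : IsKrein β) (hγ : IsKrein γ) :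
    toeplitzComm β γ - 1 = low (-γ) * (up β * low γ - low γ * up β) * up (-β) := by
  have h : low (-γ) * (low γ * up β) * up (-β) = 1 := by
    rw [← mul_assoc, low_neg_mul_low hγ, one_mul, up_mul_up_neg hβ]
  rw [mul_sub, sub_mul, h, toeplitzComm]
  simp only [mul_assoc]

lemma idealMem_ser_commutator (hβ : IsKrein β) (hγ : IsKrein γ) :
    IdealMem (ser β (star shift) * ser γ shift - ser γ shift * ser β (star shift)) := by
  rw [ser_commutator hβ hγ]
  exact (idealMem_hankel hγ).mul_right (idealLE_hankel hβ.star).star.multLE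

lemma detClass_toeplitzComm (hβ : IsKrein β) (hγ : IsKrein γ) : DetClass (toeplitzComm β γ) := by
  rw [DetClass, toeplitzComm_sub_one hβ hγ]
  refine (IdealMem.mul_left ?_ (multLE_low hγ.neg)).mul_right (multLE_up hβ.neg)
  exact idealMem_exp_commutator ((multLE_ser_star_shift hβ).mono (le_max_left _ _))
    ((multLE_ser_shift hγ).mono (le_max_right _ _)) (idealMem_ser_commutator hβ hγ)

/-- Additivity of the commutator in its first argument, up to conjugation by `up β`. -/
lemma szego_add_left (hβ : IsKrein β) (hδ : IsKrein δ) (hγ : IsKrein γ) :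
    szego (β + δ) γ = szego β γ * szego δ γ := by
  have h : toeplitzComm (β + δ) γ = toeplitzComm β γ * (up β * toeplitzComm δ γ * up (-β)) := by
    simp only [toeplitzComm]
    rw [neg_add_rev, up_add hβ hδ, up_add hδ.neg hβ.neg]
    have h1 := up_neg_mul_up hβ
    have h2 := low_mul_low_neg hγ
    calc low (-γ) * (up β * up δ) * low γ * (up (-δ) * up (-β))
        = low (-γ) * up β * (low γ * low (-γ)) * up δ * low γ * up (-δ) * up (-β) := by
          rw [h2, mul_one]
          simp only [mul_assoc]
      _ = low (-γ) * up β * low γ * (up (-β) * up β) * low (-γ) * up δ * low γ * up (-δ)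
          * up (-β) := by
          rw [h1, mul_one]
          simp only [mul_assoc]
      _ = _ := by simp only [mul_assoc]
  rw [szego, h, opDet_mul (detClass_toeplitzComm hβ hγ)
    ((detClass_toeplitzComm hδ hγ).conj (multLE_up hβ) (multLE_up hβ.neg) (up_mul_up_neg hβ)),
    opDet_conj (detClass_toeplitzComm hδ hγ) (multLE_up hβ) (multLE_up hβ.neg) (up_mul_up_neg hβ)
      (up_neg_mul_up hβ)]
  rfl

/-- Additivity of the commutator in its second argument, up to conjugation by `low δ`. -/
lemma szego_add_right (hβ : IsKrein β) (hγ : IsKrein γ) (hδ : IsKrein δ) :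
    szego β (γ + δ) = szego β γ * szego β δ := by
  have h : toeplitzComm β (γ + δ)
      = (low (-δ) * toeplitzComm β γ * low δ) * toeplitzComm β δ := by
    simp only [toeplitzComm]
    rw [neg_add_rev, low_add hγ hδ, low_add hδ.neg hγ.neg]
    have h1 := up_neg_mul_up hβ
    have h2 := low_mul_low_neg hδ
    calc low (-δ) * low (-γ) * up β * (low γ * low δ) * up (-β)
        = low (-δ) * low (-γ) * up β * low γ * (up (-β) * up β) * low δ * up (-β) := by
          rw [h1, mul_one]
          simp only [mul_assoc]
      _ = low (-δ) * low (-γ) * up β * low γ * up (-β) * (low δ * low (-δ)) * up β * low δ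
          * up (-β) := by
          rw [h2, mul_one]
          simp only [mul_assoc]
      _ = _ := by simp only [mul_assoc]
  have hc := detClass_toeplitzComm hβ hγ
  rw [szego, h, opDet_mul (hc.conj (multLE_low hδ.neg) (multLE_low hδ) (low_neg_mul_low hδ))
    (detClass_toeplitzComm hβ hδ),
    opDet_conj hc (multLE_low hδ.neg) (multLE_low hδ) (low_neg_mul_low hδ) (low_mul_low_neg hδ)]
  rfl

lemma opDet_one : opDet 1 = 1 := by
  have h := DetClass.one.tendsto
  simp only [corner_one, Matrix.det_one] at h
  exact tendsto_nhds_unique h tendsto_const_nhds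

lemma szego_zero_left (hγ : IsKrein γ) : szego 0 γ = 1 := by
  rw [szego, toeplitzComm, neg_zero, up_zero, mul_one, mul_one, low_neg_mul_low hγ, opDet_one]

lemma szego_zero_right (hβ : IsKrein β) : szego β 0 = 1 := by
  rw [szego, toeplitzComm, neg_zero, low_zero, mul_one, one_mul, up_mul_up_neg hβ, opDet_one]

lemma szego_nsmul_left (hβ : IsKrein β) (hγ : IsKrein γ) (m : ℕ) :
    szego ((m : ℂ) • β) γ = szego β γ ^ m := by
  induction m with
  | zero => simpa using szego_zero_left hγ
  | succ m ih =>
    rw [Nat.cast_succ, add_smul, one_smul, szego_add_left (hβ.smul _) hβ hγ, ih, pow_succ]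

lemma szego_nsmul_right (hβ : IsKrein β) (hγ : IsKrein γ) (m : ℕ) :
    szego β ((m : ℂ) • γ) = szego β γ ^ m := by
  induction m with
  | zero => simpa using szego_zero_right hβ
  | succ m ih =>
    rw [Nat.cast_succ, add_smul, one_smul, szego_add_right hβ (hγ.smul _) hγ, ih, pow_succ]

end Szego

/-! ### The constant in Szegő's strong limit theorem -/

lemma tendsto_pow_exp {a : ℕ → ℕ} {ψ : ℕ → ℂ} {τ : ℂ} (ha : Tendsto a atTop atTop)
    (h : Tendsto (fun m => (a m : ℂ) * (ψ m - 1)) atTop (𝓝 τ)) :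
    Tendsto (fun m => ψ m ^ a m) atTop (𝓝 (Complex.exp τ)) := by
  have hinv : Tendsto (fun m => ((a m : ℂ))⁻¹) atTop (𝓝 0) :=
    (tendsto_inv_atTop_nhds_zero_nat (𝕜 := ℂ)).comp ha
  have ha0 : ∀ᶠ m in atTop, a m ≠ 0 := ha.eventually_ne_atTop 0
  have hu : Tendsto (fun m => ψ m - 1) atTop (𝓝 0) := by
    have := hinv.mul h
    rw [zero_mul] at this
    refine this.congr' (ha0.mono fun m hm => ?_)
    rw [← mul_assoc, inv_mul_cancel₀ (Nat.cast_ne_zero.2 hm), one_mul]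
  have hu2 : ∀ᶠ m in atTop, ‖ψ m - 1‖ < 1 / 2 :=
    hu.norm.eventually (gt_mem_nhds (by norm_num))
  have hlog : Tendsto (fun m => (a m : ℂ) * Complex.log (1 + (ψ m - 1))) atTop (𝓝 τ) := by
    have h0 : Tendsto (fun m => (a m : ℂ) * Complex.log (1 + (ψ m - 1)) - a m * (ψ m - 1)) atTop
        (𝓝 0) := by
      have hb : Tendsto (fun m => ‖(a m : ℂ) * (ψ m - 1)‖ * ‖ψ m - 1‖) atTop (𝓝 0) := by
        have := h.norm.mul hu.norm
        rwa [norm_zero, mul_zero] at this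
      refine squeeze_zero_norm' (hu2.mono fun m hm => ?_) hb
      have h1 := Complex.norm_log_one_add_sub_self_le (z := ψ m - 1) (by linarith)
      have h2 : (1 - ‖ψ m - 1‖)⁻¹ ≤ 2 := by
        rw [inv_le_comm₀ (by linarith) two_pos]
        linarith
      rw [← mul_sub, norm_mul, norm_mul, mul_assoc]
      gcongr
      refine h1.trans ?_
      have h3 := sq_nonneg ‖ψ m - 1‖
      nlinarith
    simpa using h0.add h
  refine ((Complex.continuous_exp.tendsto τ).comp hlog).congr' (hu2.mono fun m hm => ?_)
  have h1 : ψ m ≠ 0 := by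
    intro h0
    rw [h0] at hm
    norm_num at hm
  rw [Function.comp_apply, add_sub_cancel, Complex.exp_nat_mul, Complex.exp_log h1]

/-- The exponent in Szegő's strong limit theorem. -/
def szegoExponent (β γ : ℕ → ℂ) : ℂ := ∑' k : ℕ, ((k : ℂ) + 1) * (β k * γ k)

/-- The numbers `1 / (m + 1)` by which the symbols are scaled. -/
def scale (m : ℕ) : ℝ := ((m : ℝ) + 1)⁻¹

lemma scale_pos (m : ℕ) : 0 < scale m := by unfold scale; positivity

lemma tendsto_scale : Tendsto scale atTop (𝓝 0) := by
  refine (tendsto_one_div_add_atTop_nhds_zero_nat (𝕜 := ℝ)).congr fun m => ?_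
  rw [scale, one_div]

lemma norm_scale (m : ℕ) : ‖(scale m : ℂ)‖ = scale m := by
  rw [Complex.norm_real, Real.norm_of_nonneg (scale_pos m).le]

lemma scale_mul (m : ℕ) : ((m + 1 : ℕ) : ℂ) * (scale m : ℂ) = 1 := by
  unfold scale
  push_cast
  exact mul_inv_cancel₀ (by exact_mod_cast Nat.succ_ne_zero m)

lemma scale_mul_smul (m : ℕ) (γ : ℕ → ℂ) : ((m + 1 : ℕ) : ℂ) • ((scale m : ℂ) • γ) = γ := by
  rw [smul_smul, scale_mul, one_smul]

/-- If `ψ m - 1` is `scale m ^ p * τ` to leading order, then `ψ m ^ ((m + 1) ^ p)` tends to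
`exp τ`. -/
lemma tendsto_pow_of_scale {ψ : ℕ → ℂ} {τ : ℂ} {p : ℕ} (hp : p ≠ 0) {φ : ℝ → ℝ}
    (hφ : Continuous φ) (hφ0 : φ 0 = 0)
    (h : ∀ᶠ m in atTop, ‖ψ m - 1 - (scale m : ℂ) ^ p * τ‖ ≤ scale m ^ p * φ (scale m)) :
    Tendsto (fun m => ψ m ^ ((m + 1) ^ p)) atTop (𝓝 (Complex.exp τ)) := by
  refine tendsto_pow_exp ((tendsto_pow_atTop hp).comp (tendsto_add_atTop_nat 1)) ?_
  have h1 : Tendsto (fun m => φ (scale m)) atTop (𝓝 0) := by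
    have := (hφ.tendsto 0).comp tendsto_scale
    rwa [hφ0] at this
  have h2 := squeeze_zero_norm' (a := fun m => φ (scale m))
    (f := fun m => (((m + 1) ^ p : ℕ) : ℂ) * (ψ m - 1) - τ) (h.mono fun m hm => ?_) h1
  · simpa using h2.add_const τ
  · have h3 : (((m + 1) ^ p : ℕ) : ℂ) * (scale m : ℂ) ^ p = 1 := by
      rw [Nat.cast_pow, ← mul_pow, scale_mul, one_pow]
    have h4 : (((m + 1) ^ p : ℕ) : ℂ) * (ψ m - 1) - τ
        = (((m + 1) ^ p : ℕ) : ℂ) * (ψ m - 1 - (scale m : ℂ) ^ p * τ) := by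
      linear_combination τ * h3
    have h5 : (((m + 1) ^ p : ℕ) : ℝ) * scale m ^ p = 1 := by exact_mod_cast h3
    rw [h4, norm_mul, Complex.norm_natCast]
    calc (((m + 1) ^ p : ℕ) : ℝ) * ‖ψ m - 1 - (scale m : ℂ) ^ p * τ‖
        ≤ (((m + 1) ^ p : ℕ) : ℝ) * (scale m ^ p * φ (scale m)) := by gcongr
      _ = φ (scale m) := by rw [← mul_assoc, h5, one_mul]

lemma szego_eq_pow {β γ : ℕ → ℂ} (hβ : IsKrein β) (hγ : IsKrein γ) (m : ℕ) :
    szego β γ = szego ((scale m : ℂ) • β) ((scale m : ℂ) • γ) ^ ((m + 1) ^ 2) := by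
  rw [sq, pow_mul, ← szego_nsmul_left (hβ.smul _) (hγ.smul _),
    ← szego_nsmul_right ((hβ.smul _).smul _) (hγ.smul _), scale_mul_smul, scale_mul_smul]

/-- By bimultiplicativity the constant is determined by its behaviour at `β / m` and `γ / m` for
large `m`, where it is `1 + tr (B * C - C * B) / m²` to leading order. -/
theorem szego_eq {β γ : ℕ → ℂ} (hβ : IsKrein β) (hγ : IsKrein γ) :
    szego β γ = Complex.exp (szegoExponent β γ) := by
  set B := ser β (star shift)
  set C := ser γ shift
  set H := hankel γ * star (hankel (star β))
  set g := max (∑' k, ‖β k‖) (∑' k, ‖γ k‖)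
  set M := kreinNorm γ * kreinNorm (star β)
  have hB : MultLE B g := (multLE_ser_star_shift hβ).mono (le_max_left _ _)
  have hC : MultLE C g := (multLE_ser_shift hγ).mono (le_max_right _ _)
  have hH : IdealLE H M := (idealLE_hankel hγ).mul (idealLE_hankel hβ.star).star
  -- the bounds for the symbols scaled by `z`, as continuous functions of `z`
  let a : ℝ → ℝ := fun z => Real.exp (z * g) ^ 4 * (z ^ 2 * M)
  let φ : ℝ → ℝ := fun z => 10 * (Real.exp (z * g) ^ 8 * (z ^ 2 * M ^ 2))
    + (Real.exp (z * g) - 1) * (4 * Real.exp (z * g) ^ 3 * M)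
  have ha1 : ∀ᶠ m in atTop, a (scale m) < 1 := by
    have ha : Continuous a := by fun_prop
    have := (ha.tendsto 0).comp tendsto_scale
    refine this.eventually (gt_mem_nhds ?_)
    simp [a]
  have key := tendsto_pow_of_scale (ψ := fun m => szego ((scale m : ℂ) • β) ((scale m : ℂ) • γ))
    (τ := szegoExponent β γ) (p := 2) (φ := φ) two_ne_zero (by fun_prop) (by simp [φ])
    (ha1.mono fun m hm => ?_)
  · exact tendsto_nhds_unique (tendsto_const_nhds.congr (szego_eq_pow hβ hγ)) key
  · set z := scale m
    have hβ' := hβ.smul (z : ℂ)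
    have hγ' := hγ.smul (z : ℂ)
    have hz := norm_scale m
    have e1 : ser ((z : ℂ) • β) (star shift) = (z : ℂ) • B :=
      ser_smul hβ.summable _ norm_star_shift_le
    have e2 : ser ((z : ℂ) • γ) shift = (z : ℂ) • C := ser_smul hγ.summable _ norm_shift_le
    have e3 : ((z : ℂ) • B) * ((z : ℂ) • C) - ((z : ℂ) • C) * ((z : ℂ) • B) = (z : ℂ) ^ 2 • H := by
      rw [show H = B * C - C * B from (ser_commutator hβ hγ).symm, smul_sub,
        smul_mul_smul_comm, smul_mul_smul_comm, sq]
    have hD : IdealLE (((z : ℂ) • B) * ((z : ℂ) • C) - ((z : ℂ) • C) * ((z : ℂ) • B))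
        (z ^ 2 * M) := by
      rw [e3]
      exact (hH.smul _).mono (by rw [norm_pow, hz])
    have hB' : MultLE ((z : ℂ) • B) (z * g) := (hB.smul _).mono (by rw [hz])
    have hC' : MultLE ((z : ℂ) • C) (z * g) := (hC.smul _).mono (by rw [hz])
    obtain ⟨h1, h2⟩ := idealLE_exp_commutator hB' hC' hD
      (K := toeplitzComm ((z : ℂ) • β) ((z : ℂ) • γ) - 1) (by
        rw [toeplitzComm_sub_one hβ' hγ', low, up, low, up,
          ser_neg hβ'.summable norm_star_shift_le, ser_neg hγ'.summable norm_shift_le, e1, e2])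
    rw [e3] at h2
    refine (norm_opDet_sub_le (detClass_toeplitzComm hβ' hγ') h1 hm h2
      (tendsto_trace_ser_commutator hβ hγ)).trans (le_of_eq ?_)
    simp only [φ]
    ring

/-! ### Folding the bilateral sequence space onto the unilateral one -/

/-- The operator `ℓ²(ℕ) → ℓ²(ℤ)` whose components along `incl` and `coincl` are `M` and `R`. -/
def unfold (M R : Op) : Ell2 ℕ →L[ℂ] Ell2 ℤ := incl ∘L M + coincl ∘L R

/-- The range of `unfold M R` is invariant under `bishift + q • star bishift`, hence under the
Laurent operators with symbol `t ^ n + (q / t) ^ n`. The component `M` is an invertible finite-rank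
perturbation of the identity, with inverse `M'`. -/
structure IsFold (q : ℝ) (M M' R : Op) : Prop where
  nonneg : 0 ≤ q
  le_one : q ≤ 1
  mul_inv : M * M' = 1
  inv_mul : M' * M = 1
  reflect_mul_inv : R * M' = R
  isFiniteRank : IsFiniteRank (M - 1)
  multLE : MultLE R 1
  intertwine : ∃ Γ : Op, ∀ x, bishift (unfold M R x) + (q : ℂ) • star bishift (unfold M R x)
    = unfold M R (Γ x)

/-- The coefficients of the image of `∑ γ k t ^ (k + 1)` under `t ↦ q / t`. -/
def twist (q : ℝ) (γ : ℕ → ℂ) : ℕ → ℂ := fun k => (q : ℂ) ^ (k + 1) * γ k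

lemma unfold_apply (M R : Op) (x : Ell2 ℕ) : unfold M R x = incl (M x) + coincl (R x) := rfl

lemma twist_smul (q : ℝ) (z : ℂ) (γ : ℕ → ℂ) : twist q (z • γ) = z • twist q γ := by
  funext k
  simp only [twist, Pi.smul_apply, smul_eq_mul]
  ring

lemma adjoint_incl_coincl (x : Ell2 ℕ) : (incl†) (coincl x) = 0 := by
  have : incl† ∘L coincl = 0 := ext_bv fun i => by
    rw [ContinuousLinearMap.comp_apply, coincl_bv, adjoint_incl_bv_pos, _root_.zero_apply]
  exact congrArg (fun A => A x) this

lemma adjoint_incl_unfold (M R : Op) (x : Ell2 ℕ) : (incl†) (unfold M R x) = M x := by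
  rw [unfold_apply, map_add, adjoint_incl_incl, adjoint_incl_coincl, add_zero]

/-- The bilateral Laurent operator with symbol `exp (∑ γ k t ^ (k + 1))`. -/
def laurentLow (γ : ℕ → ℂ) : Ell2 ℤ →L[ℂ] Ell2 ℤ := NormedSpace.exp (ser γ bishift)

/-- The bilateral Laurent operator with symbol `exp (∑ β k t ^ (-(k + 1)))`. -/
def laurentUp (β : ℕ → ℂ) : Ell2 ℤ →L[ℂ] Ell2 ℤ := NormedSpace.exp (ser β (star bishift))

section Laurent

variable {β γ δ : ℕ → ℂ}

lemma laurentLow_incl (hγ : IsKrein γ) (x : Ell2 ℕ) :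
    laurentLow γ (incl x) = incl (low γ x) :=
  (congrArg (fun A => A x) (intertwine_exp (intertwine_ser hγ.summable norm_shift_le
    norm_bishift_le bishift_comp_incl.symm))).symm

lemma adjoint_incl_laurentUp (hβ : IsKrein β) (x : Ell2 ℤ) :
    (incl†) (laurentUp β x) = up β ((incl†) x) :=
  congrArg (fun A => A x) (intertwine_exp (intertwine_ser hβ.summable norm_star_bishift_le
    norm_star_shift_le adjoint_incl_comp_star_bishift))

lemma laurentLow_add (hγ : IsKrein γ) (hδ : IsKrein δ) :
    laurentLow (γ + δ) = laurentLow γ * laurentLow δ := by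
  rw [laurentLow, ser_add hγ.summable hδ.summable norm_bishift_le]
  exact exp_add_of_commute'
    (commute_ser hγ.summable hδ.summable norm_bishift_le norm_bishift_le rfl)

lemma laurentUp_neg_mul (hβ : IsKrein β) : laurentUp (-β) * laurentUp β = 1 := by
  rw [laurentUp, laurentUp, ← exp_add_of_commute' (commute_ser hβ.neg.summable hβ.summable
    norm_star_bishift_le norm_star_bishift_le rfl),
    ← ser_add hβ.neg.summable hβ.summable norm_star_bishift_le, neg_add_cancel]
  simp [ser]

lemma laurentUp_mul_laurentLow (hβ : IsKrein β) (hγ : IsKrein γ) :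
    laurentUp β * laurentLow γ
      = NormedSpace.exp (ser β (star bishift) + ser γ bishift) :=
  (exp_add_of_commute' (commute_ser_bishift hβ hγ)).symm

lemma commute_laurent (hβ : IsKrein β) (hγ : IsKrein γ) :
    laurentUp β * laurentLow γ = laurentLow γ * laurentUp β := by
  rw [laurentUp_mul_laurentLow hβ hγ, add_comm]
  exact exp_add_of_commute' (commute_ser_bishift hβ hγ).symm

end Laurent

/-- The component of `laurentLow γ` from the range of `coincl` to that of `incl`. -/
def offDiag (γ : ℕ → ℂ) : Op := incl† ∘L laurentLow γ ∘L coincl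

section OffDiag

variable {γ : ℕ → ℂ}

lemma adjoint_coincl_ser_bishift_pow (hγ : IsKrein γ) (n : ℕ) (x : Ell2 ℤ) :
    (coincl†) ((ser γ bishift ^ n) x) = (ser γ (star shift) ^ n) ((coincl†) x) :=
  congrArg (fun A => A x) (intertwine_pow (intertwine_ser hγ.summable norm_bishift_le
    norm_star_shift_le adjoint_coincl_comp_bishift) n)

/-- The off-diagonal blocks of the powers of a block triangular operator. -/
lemma adjoint_incl_ser_bishift_pow (hγ : IsKrein γ) (n : ℕ) (x : Ell2 ℕ) :
    (incl†) ((ser γ bishift ^ n) (coincl x))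
      = duhamel (ser γ shift) (ser γ (star shift)) (hankel γ) n x := by
  induction n with
  | zero => rw [pow_zero, one_apply_eq_self, adjoint_incl_coincl, duhamel, _root_.zero_apply]
  | succ n ih =>
    rw [pow_succ', mul_apply_eq_comp, adjoint_incl_ser_bishift hγ.summable, ih,
      adjoint_coincl_ser_bishift_pow hγ, adjoint_coincl_coincl, duhamel, _root_.add_apply,
      mul_apply_eq_comp, mul_apply_eq_comp]

lemma hasSum_duhamel_offDiag (hγ : IsKrein γ) :
    HasSum (fun n => ((n.factorial : ℂ)⁻¹) •
      duhamel (ser γ shift) (ser γ (star shift)) (hankel γ) n) (offDiag γ) := by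
  have h := ((hasSum_exp (ser γ bishift)).mapL
    ((ContinuousLinearMap.compL ℂ (Ell2 ℕ) (Ell2 ℤ) (Ell2 ℤ)).flip coincl)).mapL
    (ContinuousLinearMap.compL ℂ (Ell2 ℕ) (Ell2 ℤ) (Ell2 ℕ) (incl†))
  refine h.congr_fun fun n => ?_
  ext1 x
  simp only [map_smul, _root_.smul_apply]
  congr 1
  exact (adjoint_incl_ser_bishift_pow hγ n x).symm

lemma idealMem_offDiag (hγ : IsKrein γ) : IdealMem (offDiag γ) :=
  idealMem_of_hasSum_duhamel (multLE_ser_shift hγ) (multLE_ser_star_shift hγ)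
    (hasSum_duhamel_offDiag hγ) (idealMem_hankel hγ)

end OffDiag

/-- The action of `laurentLow γ` on the range of `unfold M R`, compressed to the range of `incl`. Up
to a factor on the left, its matrix is the Toeplitz+Hankel matrix. -/
def folded (M R : Op) (γ : ℕ → ℂ) : Op := incl† ∘L laurentLow γ ∘L unfold M R

lemma folded_apply (M R : Op) (γ : ℕ → ℂ) (x : Ell2 ℕ) :
    folded M R γ x = (incl†) (laurentLow γ (unfold M R x)) := rfl

lemma folded_eq {γ : ℕ → ℂ} (hγ : IsKrein γ) (M R : Op) :
    folded M R γ = low γ * M + offDiag γ * R := by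
  ext1 x
  rw [folded_apply, unfold_apply, map_add, map_add, laurentLow_incl hγ, adjoint_incl_incl]
  rfl

/-- The quotient of `folded M R γ` by its main part `low γ * M`. -/
def foldedQuot (M M' R : Op) (γ : ℕ → ℂ) : Op := low (-γ) * folded M R γ * M'

/-- The determinant of `foldedQuot`, the reflection part of the constant. -/
def foldedDet (M M' R : Op) (γ : ℕ → ℂ) : ℂ := opDet (foldedQuot M M' R γ)

namespace IsFold

variable {q : ℝ} {M M' R : Op} {β γ δ : ℕ → ℂ}

lemma norm_pow_le (h : IsFold q M M' R) (n : ℕ) : ‖((q : ℂ)) ^ n‖ ≤ 1 := by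
  rw [norm_pow, Complex.norm_real, Real.norm_of_nonneg h.nonneg]
  exact pow_le_one₀ h.nonneg h.le_one

lemma isKrein_twist (h : IsFold q M M' R) (hγ : IsKrein γ) : IsKrein (twist q γ) :=
  hγ.of_norm_le fun k => by
    rw [twist, norm_mul]
    exact mul_le_of_le_one_left (norm_nonneg _) (h.norm_pow_le _)

lemma foldedQuot_eq (h : IsFold q M M' R) (hγ : IsKrein γ) :
    foldedQuot M M' R γ = 1 + low (-γ) * offDiag γ * R := by
  rw [foldedQuot, folded_eq hγ, mul_add, add_mul, ← mul_assoc, low_neg_mul_low hγ, one_mul,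
    h.mul_inv, ← mul_assoc, mul_assoc _ R, h.reflect_mul_inv]

lemma detClass_foldedQuot (h : IsFold q M M' R) (hγ : IsKrein γ) :
    DetClass (foldedQuot M M' R γ) := by
  rw [h.foldedQuot_eq hγ]
  exact DetClass.one_add (((idealMem_offDiag hγ).mul_left (multLE_low hγ.neg)).mul_right h.multLE)

lemma folded_eq_mul (h : IsFold q M M' R) (hγ : IsKrein γ) :
    folded M R γ = low γ * foldedQuot M M' R γ * M := by
  rw [foldedQuot, ← mul_assoc, ← mul_assoc, low_mul_low_neg hγ, one_mul, mul_assoc, h.inv_mul,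
    mul_one]

/-- `X` preserves the range of `unfold M R`. As `M' ∘L incl†` is a left inverse of `unfold M R`,
this is the stated identity, which is visibly closed under limits. -/
def Preserves (M M' R : Op) (X : Ell2 ℤ →L[ℂ] Ell2 ℤ) : Prop :=
  X ∘L unfold M R = unfold M R ∘L M' ∘L incl† ∘L X ∘L unfold M R

lemma preserves_iff (h : IsFold q M M' R) {X : Ell2 ℤ →L[ℂ] Ell2 ℤ} :
    Preserves M M' R X ↔ ∃ Γ : Op, ∀ x, X (unfold M R x) = unfold M R (Γ x) := by
  constructor
  · intro hX
    exact ⟨M' ∘L incl† ∘L X ∘L unfold M R, fun x => congrArg (fun A => A x) hX⟩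
  · rintro ⟨Γ, hΓ⟩
    have h1 : ∀ x, M' (M x) = x := fun x => congrArg (fun A => A x) h.inv_mul
    unfold Preserves
    ext1 x
    simp only [ContinuousLinearMap.comp_apply]
    rw [hΓ, adjoint_incl_unfold, h1]

lemma preserves_one (h : IsFold q M M' R) : Preserves M M' R 1 :=
  h.preserves_iff.2 ⟨1, fun _ => rfl⟩

lemma preserves_mul (h : IsFold q M M' R) {X Y : Ell2 ℤ →L[ℂ] Ell2 ℤ} (hX : Preserves M M' R X)
    (hY : Preserves M M' R Y) : Preserves M M' R (X * Y) := by
  obtain ⟨Γ, hΓ⟩ := h.preserves_iff.1 hX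
  obtain ⟨Γ', hΓ'⟩ := h.preserves_iff.1 hY
  refine h.preserves_iff.2 ⟨Γ * Γ', fun x => ?_⟩
  rw [mul_apply_eq_comp, mul_apply_eq_comp, hΓ', hΓ]

lemma preserves_sub (h : IsFold q M M' R) {X Y : Ell2 ℤ →L[ℂ] Ell2 ℤ} (hX : Preserves M M' R X)
    (hY : Preserves M M' R Y) : Preserves M M' R (X - Y) := by
  obtain ⟨Γ, hΓ⟩ := h.preserves_iff.1 hX
  obtain ⟨Γ', hΓ'⟩ := h.preserves_iff.1 hY
  refine h.preserves_iff.2 ⟨Γ - Γ', fun x => ?_⟩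
  rw [_root_.sub_apply, _root_.sub_apply, map_sub, hΓ', hΓ]

lemma preserves_smul (h : IsFold q M M' R) {X : Ell2 ℤ →L[ℂ] Ell2 ℤ} (hX : Preserves M M' R X)
    (z : ℂ) : Preserves M M' R (z • X) := by
  obtain ⟨Γ, hΓ⟩ := h.preserves_iff.1 hX
  refine h.preserves_iff.2 ⟨z • Γ, fun x => ?_⟩
  rw [_root_.smul_apply, _root_.smul_apply, map_smul, hΓ]

lemma preserves_hasSum {f : ℕ → Ell2 ℤ →L[ℂ] Ell2 ℤ} {X : Ell2 ℤ →L[ℂ] Ell2 ℤ}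
    (hf : ∀ n, Preserves M M' R (f n)) (hX : HasSum f X) : Preserves M M' R X := by
  have h1 := hX.mapL
    ((ContinuousLinearMap.compL ℂ (Ell2 ℕ) (Ell2 ℤ) (Ell2 ℤ)).flip (unfold M R))
  have h2 := h1.mapL (ContinuousLinearMap.compL ℂ (Ell2 ℕ) (Ell2 ℤ) (Ell2 ℤ)
    (unfold M R ∘L M' ∘L incl†))
  exact h1.unique (h2.congr_fun fun n => hf n)

lemma preserves_exp (h : IsFold q M M' R) {X : Ell2 ℤ →L[ℂ] Ell2 ℤ} (hX : Preserves M M' R X) :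
    Preserves M M' R (NormedSpace.exp X) := by
  refine preserves_hasSum (fun n => h.preserves_smul ?_ _) (hasSum_exp X)
  induction n with
  | zero => exact h.preserves_one
  | succ n ih => exact h.preserves_mul ih hX

lemma preserves_pow_add (h : IsFold q M M' R) (n : ℕ) :
    Preserves M M' R (bishift ^ (n + 1) + ((q : ℂ) ^ (n + 1)) • star bishift ^ (n + 1)) := by
  have h1 : Preserves M M' R (bishift + (q : ℂ) • star bishift) := by
    obtain ⟨Γ, hΓ⟩ := h.intertwine
    exact h.preserves_iff.2 ⟨Γ, hΓ⟩
  have h2 : ∀ n : ℕ, Preserves M M' R (bishift ^ n + ((q : ℂ) ^ n) • star bishift ^ n)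
      ∧ Preserves M M' R
        (bishift ^ (n + 1) + ((q : ℂ) ^ (n + 1)) • star bishift ^ (n + 1)) := by
    intro n
    induction n with
    | zero =>
      refine ⟨?_, by simpa using h1⟩
      have := h.preserves_smul h.preserves_one 2
      rw [pow_zero, pow_zero, pow_zero, one_smul]
      rwa [two_smul] at this
    | succ n ih =>
      refine ⟨ih.2, ?_⟩
      -- the three-term recursion for `t ^ n + (q / t) ^ n`
      have h3 := h.preserves_sub (h.preserves_mul h1 ih.2) (h.preserves_smul ih.1 (q : ℂ))
      have e1 : bishift * star bishift ^ (n + 1) = star bishift ^ n := by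
        rw [pow_succ', ← mul_assoc, bishift_mul_star, one_mul]
      have e2 : star bishift * bishift ^ (n + 1) = bishift ^ n := by
        rw [pow_succ', ← mul_assoc, star_bishift_mul, one_mul]
      have e3 : (bishift + (q : ℂ) • star bishift)
          * (bishift ^ (n + 1) + ((q : ℂ) ^ (n + 1)) • star bishift ^ (n + 1))
          - (q : ℂ) • (bishift ^ n + ((q : ℂ) ^ n) • star bishift ^ n)
          = bishift ^ (n + 1 + 1) + ((q : ℂ) ^ (n + 1 + 1)) • star bishift ^ (n + 1 + 1) := by
        simp only [add_mul, mul_add, smul_mul_assoc, mul_smul_comm, e1, e2, smul_add, smul_smul,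
          ← pow_succ']
        abel
      rwa [e3] at h3
  exact (h2 n).2

/-- The symbol `exp (∑ δ k (t ^ (k + 1) + (q / t) ^ (k + 1)))` is invariant under `t ↦ q / t`. -/
lemma preserves_laurent (h : IsFold q M M' R) (hδ : IsKrein δ) :
    Preserves M M' R (laurentUp (twist q δ) * laurentLow δ) := by
  have hδ' := h.isKrein_twist hδ
  rw [laurentUp_mul_laurentLow hδ' hδ]
  refine h.preserves_exp (preserves_hasSum (fun n => ?_)
    ((hasSum_ser hδ'.summable norm_star_bishift_le).add (hasSum_ser hδ.summable norm_bishift_le)))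
  have := h.preserves_smul (h.preserves_pow_add n) (δ n)
  rwa [smul_add, smul_smul, mul_comm, add_comm] at this

/-- The factor `laurentLow δ` acts within the range of `unfold M R` once it is completed to the
invariant operator `laurentUp (twist q δ) * laurentLow δ`. -/
lemma folded_add (h : IsFold q M M' R) (hγ : IsKrein γ) (hδ : IsKrein δ) :
    folded M R (γ + δ)
      = up (-twist q δ) * folded M R γ * M' * up (twist q δ) * folded M R δ := by
  have hδ' := h.isKrein_twist hδ
  ext1 x
  have h1 : laurentUp (twist q δ) (laurentLow δ (unfold M R x))
      = unfold M R (M' (up (twist q δ) (folded M R δ x))) := by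
    rw [folded_apply, ← adjoint_incl_laurentUp hδ']
    exact congrArg (fun A => A x) (h.preserves_laurent hδ)
  have h2 : laurentLow δ (unfold M R x) = laurentUp (-twist q δ)
      (unfold M R (M' (up (twist q δ) (folded M R δ x)))) := by
    rw [← h1]
    exact (congrArg (fun A => A (laurentLow δ (unfold M R x))) (laurentUp_neg_mul hδ')).symm
  rw [folded_apply, laurentLow_add hγ hδ, mul_apply_eq_comp, h2, ← mul_apply_eq_comp,
    ← commute_laurent hδ'.neg hγ, mul_apply_eq_comp, adjoint_incl_laurentUp hδ'.neg,
    ← folded_apply]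
  rfl

lemma foldedQuot_add (h : IsFold q M M' R) (hγ : IsKrein γ) (hδ : IsKrein δ) :
    foldedQuot M M' R (γ + δ)
      = low (-δ) * (toeplitzComm (-twist q δ) γ
        * (up (-twist q δ) * foldedQuot M M' R γ * up (twist q δ))) * low δ
        * foldedQuot M M' R δ := by
  have hδ' := h.isKrein_twist hδ
  have h1 := up_mul_up_neg hδ'
  have h2 := low_mul_low_neg hγ
  have h3 := low_mul_low_neg hδ
  rw [foldedQuot, h.folded_add hγ hδ, neg_add_rev, low_add hδ.neg hγ.neg, toeplitzComm, neg_neg,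
    foldedQuot, foldedQuot]
  set F := folded M R γ
  set G := folded M R δ
  calc low (-δ) * low (-γ) * (up (-twist q δ) * F * M' * up (twist q δ) * G) * M'
      = low (-δ) * low (-γ) * up (-twist q δ) * (low γ * low (-γ)) * F * M' * up (twist q δ)
        * (low δ * low (-δ)) * G * M' := by
        rw [h2, h3, mul_one, mul_one]
        simp only [mul_assoc]
    _ = low (-δ) * low (-γ) * up (-twist q δ) * low γ * (up (twist q δ) * up (-twist q δ))
        * low (-γ) * F * M' * up (twist q δ) * low δ * low (-δ) * G * M' := by
        rw [h1, mul_one]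
        simp only [mul_assoc]
    _ = _ := by simp only [mul_assoc]

/-- The determinant is multiplicative up to a constant of Szegő type, which is due to the
completion by `up (twist q δ)`. -/
lemma foldedDet_add (h : IsFold q M M' R) (hγ : IsKrein γ) (hδ : IsKrein δ) :
    foldedDet M M' R (γ + δ)
      = szego (-twist q δ) γ * foldedDet M M' R γ * foldedDet M M' R δ := by
  have hδ' := h.isKrein_twist hδ
  have d1 := detClass_toeplitzComm hδ'.neg hγ
  have d2 := h.detClass_foldedQuot hγ
  have d3 := d2.conj (multLE_up hδ'.neg) (multLE_up hδ') (up_neg_mul_up hδ')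
  rw [foldedDet, h.foldedQuot_add hγ hδ,
    opDet_mul ((d1.mul d3).conj (multLE_low hδ.neg) (multLE_low hδ) (low_neg_mul_low hδ))
      (h.detClass_foldedQuot hδ),
    opDet_conj (d1.mul d3) (multLE_low hδ.neg) (multLE_low hδ) (low_neg_mul_low hδ)
      (low_mul_low_neg hδ),
    opDet_mul d1 d3, opDet_conj d2 (multLE_up hδ'.neg) (multLE_up hδ') (up_neg_mul_up hδ')
      (up_mul_up_neg hδ')]
  rfl

end IsFold

/-! ### The constant from the reflection -/

namespace IsFold

variable {q : ℝ} {M M' R : Op} {β γ δ : ℕ → ℂ}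

lemma foldedDet_zero (h : IsFold q M M' R) : foldedDet M M' R 0 = 1 := by
  have h1 : laurentLow 0 = 1 := by simp [laurentLow, ser]
  have h2 : folded M R 0 = M := by
    ext1 x
    rw [folded_apply, h1, one_apply_eq_self, adjoint_incl_unfold]
  rw [foldedDet, foldedQuot, h2, neg_zero, low_zero, one_mul, h.mul_inv, opDet_one]

/-- The exponent `m.choose 2` counts the constants collected in `m - 1` applications of
`foldedDet_add`; it is responsible for the factor `1 / 2` in `foldedDet_eq`. -/
lemma foldedDet_nsmul (h : IsFold q M M' R) (hγ : IsKrein γ) (m : ℕ) :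
    foldedDet M M' R ((m : ℂ) • γ)
      = foldedDet M M' R γ ^ m * szego (-twist q γ) γ ^ m.choose 2 := by
  induction m with
  | zero => simpa using h.foldedDet_zero
  | succ m ih =>
    rw [Nat.cast_succ, add_smul, one_smul, h.foldedDet_add (hγ.smul _) hγ,
      szego_nsmul_right (h.isKrein_twist hγ).neg hγ, ih, Nat.choose_succ_succ' m 1,
      Nat.choose_one_right]
    ring

/-- The determinant `foldedDet` of a scaled symbol to first order. -/
lemma tendsto_foldedDet_scale (h : IsFold q M M' R) (hγ : IsKrein γ) {lam : ℂ}
    (hlam : Tendsto (fun n => ∑ i ∈ Finset.range n, entry (hankel γ * R) i i) atTop (𝓝 lam)) :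
    Tendsto (fun m => foldedDet M M' R ((scale m : ℂ) • γ) ^ (m + 1)) atTop
      (𝓝 (Complex.exp lam)) := by
  set g := ∑' k, ‖γ k‖
  set N := kreinNorm γ
  let a : ℝ → ℝ := fun z => Real.exp (z * g) ^ 2 * (z * N)
  let φ : ℝ → ℝ := fun z => 10 * (Real.exp (z * g) ^ 4 * (z * N ^ 2))
    + (Real.exp (z * g) - 1) * ((Real.exp (z * g) + 1) * N)
  have ha1 : ∀ᶠ m in atTop, a (scale m) < 1 := by
    have ha : Continuous a := by fun_prop
    have := (ha.tendsto 0).comp tendsto_scale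
    refine this.eventually (gt_mem_nhds ?_)
    simp [a]
  have key := tendsto_pow_of_scale (ψ := fun m => foldedDet M M' R ((scale m : ℂ) • γ))
    (τ := lam) (p := 1) (φ := φ) one_ne_zero (by fun_prop) (by simp [φ])
    (ha1.mono fun m hm => ?_)
  · simpa only [pow_one] using key
  · set z := scale m
    have hγ' := hγ.smul (z : ℂ)
    have hz := norm_scale m
    have e2 : ser ((z : ℂ) • γ) shift = (z : ℂ) • ser γ shift :=
      ser_smul hγ.summable _ norm_shift_le
    have e3 : ser ((z : ℂ) • γ) (star shift) = (z : ℂ) • ser γ (star shift) :=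
      ser_smul hγ.summable _ norm_star_shift_le
    have hB : MultLE (ser ((z : ℂ) • γ) (star shift)) (z * g) := by
      rw [e3]
      exact ((multLE_ser_star_shift hγ).smul _).mono (by rw [hz])
    have hC : MultLE (ser ((z : ℂ) • γ) shift) (z * g) := by
      rw [e2]
      exact ((multLE_ser_shift hγ).smul _).mono (by rw [hz])
    have hH : IdealLE (hankel ((z : ℂ) • γ)) (z * N) := by
      rw [hankel_smul hγ.summable]
      exact ((idealLE_hankel hγ).smul _).mono (by rw [hz])
    have hL : MultLE (low (-((z : ℂ) • γ))) (Real.exp (z * g)) := by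
      rw [low, ser_neg hγ'.summable norm_shift_le]
      exact hC.neg.exp
    have hL' : MultLE (low (-((z : ℂ) • γ)) - 1) (Real.exp (z * g) - 1) := by
      rw [low, ser_neg hγ'.summable norm_shift_le]
      exact hC.neg.exp_sub_one
    have b1 := idealLE_of_hasSum_duhamel hC hB (hasSum_duhamel_offDiag hγ') hH
    have b2 := idealLE_sub_of_hasSum_duhamel hC hB (hasSum_duhamel_offDiag hγ') hH
    have c1 : IdealLE (foldedQuot M M' R ((z : ℂ) • γ) - 1) (a z) := by
      rw [h.foldedQuot_eq hγ', add_sub_cancel_left]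
      exact (h.multLE.right (hL.left b1)).mono (le_of_eq (by ring))
    have c2 : IdealLE (foldedQuot M M' R ((z : ℂ) • γ) - 1 - (z : ℂ) • (hankel γ * R))
        ((Real.exp (z * g) - 1) * ((Real.exp (z * g) + 1) * (z * N))) := by
      have h1 := h.multLE.right ((hL'.left b1).add b2)
      have h2 : ((low (-((z : ℂ) • γ)) - 1) * offDiag ((z : ℂ) • γ)
          + (offDiag ((z : ℂ) • γ) - hankel ((z : ℂ) • γ))) * R
          = foldedQuot M M' R ((z : ℂ) • γ) - 1 - (z : ℂ) • (hankel γ * R) := by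
        rw [h.foldedQuot_eq hγ', add_sub_cancel_left, hankel_smul hγ.summable, ← smul_mul_assoc]
        noncomm_ring
      rw [h2] at h1
      exact h1.mono (le_of_eq (by ring))
    have d1 := norm_opDet_sub_le (h.detClass_foldedQuot hγ') c1 hm c2 hlam
    rw [pow_one, pow_one]
    refine d1.trans (le_of_eq ?_)
    simp only [a, φ]
    ring

lemma szegoExponent_neg_twist_smul (z : ℂ) (γ : ℕ → ℂ) (q : ℝ) :
    szegoExponent (-twist q (z • γ)) (z • γ) = -(z ^ 2 * szegoExponent (twist q γ) γ) := by
  rw [szegoExponent, szegoExponent, ← tsum_mul_left, ← tsum_neg, twist_smul]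
  refine tsum_congr fun k => ?_
  simp only [Pi.neg_apply, Pi.smul_apply, smul_eq_mul]
  ring

/-- The constant due to the reflection; `lam` is the trace of the Hankel operator composed with
the reflection. -/
theorem foldedDet_eq (h : IsFold q M M' R) (hγ : IsKrein γ) {lam : ℂ}
    (hlam : Tendsto (fun n => ∑ i ∈ Finset.range n, entry (hankel γ * R) i i) atTop (𝓝 lam)) :
    foldedDet M M' R γ = Complex.exp (lam - szegoExponent (twist q γ) γ / 2) := by
  have h1 := h.tendsto_foldedDet_scale hγ hlam
  set σ := szegoExponent (twist q γ) γ
  have h2 : ∀ m : ℕ, foldedDet M M' R γ = foldedDet M M' R ((scale m : ℂ) • γ) ^ (m + 1)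
      * Complex.exp (-(1 - (scale m : ℂ)) * σ / 2) := by
    intro m
    have hγ' := hγ.smul (scale m : ℂ)
    have h3 := h.foldedDet_nsmul hγ' (m + 1)
    rw [scale_mul_smul, szego_eq (h.isKrein_twist hγ').neg hγ', ← Complex.exp_nat_mul,
      szegoExponent_neg_twist_smul] at h3
    rw [h3]
    congr 2
    have h4 : (((m + 1).choose 2 : ℕ) : ℂ) = ((m : ℂ) + 1) * m / 2 := by
      rw [Nat.cast_choose_two]
      push_cast
      ring
    have h5 := scale_mul m
    push_cast at h5
    rw [h4]
    linear_combination (-(m : ℂ) * σ * scale m / 2 - σ / 2) * h5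
  have h3 : Tendsto (fun m => Complex.exp (-(1 - (scale m : ℂ)) * σ / 2)) atTop
      (𝓝 (Complex.exp (-σ / 2))) := by
    have hc : Continuous fun z : ℝ => Complex.exp (-(1 - (z : ℂ)) * σ / 2) := by fun_prop
    have := (hc.tendsto 0).comp tendsto_scale
    simpa [Function.comp_def] using this
  have h4 := h1.mul h3
  rw [← Complex.exp_add] at h4
  have h5 := tendsto_nhds_unique (tendsto_const_nhds.congr h2) h4
  rw [h5]
  congr 1
  ring

end IsFold

/-! ### Triangular factors and finite sections -/

section Triangular

variable {β γ : ℕ → ℂ}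

lemma low_shift (hγ : IsKrein γ) (x : Ell2 ℕ) : low γ (shift x) = shift (low γ x) := by
  have h : shift ∘L low γ = low γ ∘L shift :=
    intertwine_exp (intertwine_ser hγ.summable norm_shift_le norm_shift_le rfl)
  exact (congrArg (fun A => A x) h).symm

lemma star_exp_op {E : Type*} [NormedAddCommGroup E] [InnerProductSpace ℂ E] [CompleteSpace E]
    (X : E →L[ℂ] E) : star (NormedSpace.exp X) = NormedSpace.exp (star X) := by
  refine ((hasSum_exp X).star).unique ((hasSum_exp (star X)).congr_fun fun n => ?_)
  rw [star_smul, star_pow]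
  simp

lemma star_low (hγ : IsKrein γ) : star (low γ) = up (star γ) := by
  rw [low, star_exp_op, star_ser hγ.summable norm_shift_le, up]

lemma star_up (hγ : IsKrein γ) : star (up γ) = low (star γ) := by
  rw [up, star_exp_op, star_ser hγ.summable norm_star_shift_le, star_star, low]

lemma up_bv_zero (hβ : IsKrein β) : up β (bv 0) = bv 0 := by
  have h1 : ser β (star shift) (bv 0) = 0 := by
    have := (hasSum_ser hβ.summable norm_star_shift_le).mapL
      (ContinuousLinearMap.apply ℂ (Ell2 ℕ) (bv 0))
    refine this.unique (hasSum_zero.congr_fun fun k => ?_)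
    simp only [ContinuousLinearMap.apply_apply, _root_.smul_apply, pow_succ, mul_apply_eq_comp,
      star_shift_bv_zero, map_zero, smul_zero]
  have h2 := (hasSum_exp (ser β (star shift))).mapL
      (ContinuousLinearMap.apply ℂ (Ell2 ℕ) (bv 0))
  refine h2.unique ?_
  convert hasSum_ite_eq (0 : ℕ) (bv 0 : Ell2 ℕ) using 2 with n
  cases n with
  | zero => simp
  | succ n =>
    simp only [ContinuousLinearMap.apply_apply, _root_.smul_apply, pow_succ, mul_apply_eq_comp,
      h1, map_zero, smul_zero]
    simp

/-- `low γ` is lower triangular with ones on the diagonal. -/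
lemma entry_low (hγ : IsKrein γ) (i j : ℕ) (hij : i ≤ j) :
    entry (low γ) i j = if i = j then 1 else 0 := by
  induction j generalizing i with
  | zero =>
    obtain rfl : i = 0 := by omega
    rw [entry_eq_inner_star, star_low hγ, up_bv_zero hγ.star, inner_bv_bv]
  | succ j ih =>
    rw [entry, ← shift_bv, low_shift hγ, ← ContinuousLinearMap.adjoint_inner_left,
      ← ContinuousLinearMap.star_eq_adjoint]
    cases i with
    | zero => rw [star_shift_bv_zero, inner_zero_left, if_neg (by omega)]
    | succ i =>
      rw [star_shift_bv_succ, ← entry, ih i (by omega)]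
      simp

/-- `up β` is upper triangular with ones on the diagonal. -/
lemma entry_up (hβ : IsKrein β) (i j : ℕ) (hij : j ≤ i) :
    entry (up β) i j = if i = j then 1 else 0 := by
  have h := entry_star (star (up β)) i j
  rw [star_star, star_up hβ, entry_low hβ.star j i hij] at h
  rw [h]
  simp [eq_comm]

lemma det_corner_low (hγ : IsKrein γ) (n : ℕ) : (corner (low γ) n).det = 1 := by
  rw [Matrix.det_of_isLowerTriangular]
  · exact Finset.prod_eq_one fun i _ => by
      rw [corner, Matrix.of_apply, entry_low hγ _ _ le_rfl, if_pos rfl]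
  · intro i j hij
    have hij' : (i : ℕ) < j := hij
    rw [corner, Matrix.of_apply, entry_low hγ _ _ hij'.le, if_neg hij'.ne]

lemma det_corner_up (hβ : IsKrein β) (n : ℕ) : (corner (up β) n).det = 1 := by
  rw [Matrix.det_of_isUpperTriangular]
  · exact Finset.prod_eq_one fun i _ => by
      rw [corner, Matrix.of_apply, entry_up hβ _ _ le_rfl, if_pos rfl]
  · intro i j hij
    have hij' : (j : ℕ) < i := hij
    rw [corner, Matrix.of_apply, entry_up hβ _ _ hij'.le, if_neg hij'.ne']

lemma hasSum_entry_mul (K L : Op) (i j : ℕ) :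
    HasSum (fun k => entry K i k * entry L k j) (entry (K * L) i j) := by
  rw [entry_mul_eq_inner]
  refine (hasSum_inner_mul_inner _ _).congr_fun fun k => ?_
  rw [← entry_eq_inner_star]
  rfl

lemma corner_mul_of_forall (K L : Op) (n : ℕ)
    (h : ∀ i < n, ∀ j < n, ∀ k, n ≤ k → entry K i k * entry L k j = 0) :
    corner (K * L) n = corner K n * corner L n := by
  ext i j
  rw [Matrix.mul_apply]
  have h1 := (hasSum_entry_mul K L i j).unique (hasSum_sum_of_ne_finset_zero (s := Finset.range n)
    fun k hk => h i i.2 j j.2 k (by simpa using hk))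
  exact h1.trans (Fin.sum_univ_eq_sum_range (fun k => entry K i k * entry L k j) n).symm

/-- The finite sections of `X` and of `low γ * X * up β` have the same determinants. -/
lemma det_corner_low_mul_up (hγ : IsKrein γ) (hβ : IsKrein β) (X : Op) (n : ℕ) :
    (corner (low γ * X * up β) n).det = (corner X n).det := by
  rw [corner_mul_of_forall, corner_mul_of_forall, Matrix.det_mul, Matrix.det_mul,
    det_corner_low hγ, det_corner_up hβ, one_mul, mul_one]
  · intro i hi j hj k hk
    rw [entry_low hγ _ _ (by omega), if_neg (by omega), zero_mul]
  · intro i hi j hj k hk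
    rw [entry_up hβ _ _ (by omega), if_neg (by omega), mul_zero]

end Triangular

namespace IsFold

variable {q : ℝ} {M M' R : Op} {β γ : ℕ → ℂ}

lemma detClass (h : IsFold q M M' R) : DetClass M := h.isFiniteRank.idealMem

/-- The limit of the determinants of the finite sections of `up β * folded M R γ`. -/
theorem tendsto_det_corner (h : IsFold q M M' R) (hβ : IsKrein β) (hγ : IsKrein γ) {lam : ℂ}
    (hlam : Tendsto (fun n => ∑ i ∈ Finset.range n, entry (hankel γ * R) i i) atTop (𝓝 lam)) :
    Tendsto (fun n => (corner (up β * folded M R γ) n).det) atTop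
      (𝓝 (opDet M * Complex.exp
        (szegoExponent β γ + lam - szegoExponent (twist q γ) γ / 2))) := by
  have d1 := detClass_toeplitzComm hβ hγ
  have d2 := (h.detClass_foldedQuot hγ).mul h.detClass
  have d3 := d2.conj (multLE_up hβ) (multLE_up hβ.neg) (up_mul_up_neg hβ)
  have h1 : up β * folded M R γ
      = low γ * (toeplitzComm β γ * (up β * (foldedQuot M M' R γ * M) * up (-β))) * up β := by
    have e1 := low_mul_low_neg hγ
    have e2 := up_neg_mul_up hβ
    rw [h.folded_eq_mul hγ, toeplitzComm]
    symm
    calc _ = (low γ * low (-γ)) * up β * low γ * (up (-β) * up β) * foldedQuot M M' R γ * M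
          * (up (-β) * up β) := by simp only [mul_assoc]
      _ = _ := by
        rw [e1, e2]
        simp only [mul_assoc, one_mul, mul_one]
  have h2 : opDet (toeplitzComm β γ * (up β * (foldedQuot M M' R γ * M) * up (-β)))
      = opDet M * Complex.exp (szegoExponent β γ + lam - szegoExponent (twist q γ) γ / 2) := by
    rw [opDet_mul d1 d3, opDet_conj d2 (multLE_up hβ) (multLE_up hβ.neg) (up_mul_up_neg hβ)
      (up_neg_mul_up hβ), opDet_mul (h.detClass_foldedQuot hγ) h.detClass, ← szego,
      szego_eq hβ hγ, ← foldedDet, h.foldedDet_eq hγ hlam, add_sub_assoc, Complex.exp_add]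
    ring
  rw [← h2]
  refine (d1.mul d3).tendsto.congr fun n => ?_
  rw [h1, det_corner_low_mul_up hγ hβ]

end IsFold

/-! ### The two reflections -/

/-- The coefficient of `t ^ (-l)` in `exp (∑ β k t ^ (-(k + 1)) + ∑ γ k t ^ (k + 1))`. -/
def laurentCoeff (β γ : ℕ → ℂ) (l : ℤ) : ℂ := ⟪bv l, laurentUp β (laurentLow γ (bv 0))⟫_ℂ

lemma laurent_bishift {β γ : ℕ → ℂ} (hβ : IsKrein β) (hγ : IsKrein γ) (x : Ell2 ℤ) :
    laurentUp β (laurentLow γ (bishift x)) = bishift (laurentUp β (laurentLow γ x)) := by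
  have h1 : bishift ∘L laurentLow γ = laurentLow γ ∘L bishift :=
    intertwine_exp (intertwine_ser hγ.summable norm_bishift_le norm_bishift_le rfl)
  have h2 : bishift ∘L laurentUp β = laurentUp β ∘L bishift :=
    intertwine_exp (intertwine_ser hβ.summable norm_star_bishift_le norm_star_bishift_le
      (bishift_mul_star.trans star_bishift_mul.symm))
  have h3 := congrArg (fun A => A x) h1
  have h4 := congrArg (fun A => A (laurentLow γ x)) h2
  simp only [ContinuousLinearMap.comp_apply] at h3 h4
  rw [← h3, ← h4]

/-- Laurent operators commute with the bilateral shift, so their entries depend on `l - m` only. -/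
lemma inner_bv_laurent {β γ : ℕ → ℂ} (hβ : IsKrein β) (hγ : IsKrein γ) (l m : ℤ) :
    ⟪bv l, laurentUp β (laurentLow γ (bv m))⟫_ℂ = laurentCoeff β γ (l - m) := by
  have step : ∀ l m : ℤ, ⟪bv (l - 1), laurentUp β (laurentLow γ (bv (m - 1)))⟫_ℂ
      = ⟪bv l, laurentUp β (laurentLow γ (bv m))⟫_ℂ := by
    intro l m
    rw [← bishift_bv m, laurent_bishift hβ hγ, ← ContinuousLinearMap.adjoint_inner_left,
      ← ContinuousLinearMap.star_eq_adjoint, star_bishift_bv, sub_add_cancel]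
  induction m using Int.induction_on generalizing l with
  | zero => rw [sub_zero, laurentCoeff]
  | succ m ih => rw [← step, add_sub_cancel_right, ih]; congr 1; ring
  | pred m ih =>
    have := step (l + 1) (-(m : ℤ))
    rw [add_sub_cancel_right] at this
    rw [this, ih]; congr 1; ring

lemma entry_up_mul_folded {β γ : ℕ → ℂ} (hβ : IsKrein β) (M R : Op) (i j : ℕ) :
    entry (up β * folded M R γ) i j
      = ⟪bv (-(i : ℤ)), laurentUp β (laurentLow γ (unfold M R (bv j)))⟫_ℂ := by
  rw [entry, mul_apply_eq_comp, folded_apply, ← adjoint_incl_laurentUp hβ,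
    ContinuousLinearMap.adjoint_inner_right, incl_bv]

section Reflections

variable {q : ℝ} {β γ : ℕ → ℂ}

/-- The diagonal operator with entries `q ^ j`. -/
def powDiag (q : ℝ) (h0 : 0 ≤ q) (h1 : q ≤ 1) : Op :=
  diagOp (fun j => q ^ j) fun j => by
    rw [abs_of_nonneg (pow_nonneg h0 j)]
    exact pow_le_one₀ h0 h1

lemma powDiag_bv (h0 : 0 ≤ q) (h1 : q ≤ 1) (j : ℕ) :
    powDiag q h0 h1 (bv j) = (q : ℂ) ^ j • bv j := by
  rw [powDiag, diagOp_bv, Complex.ofReal_pow]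

lemma multLE_powDiag (h0 : 0 ≤ q) (h1 : q ≤ 1) : MultLE (powDiag q h0 h1) 1 := multLE_diagOp _ _

/-- The projection onto the span of `bv 0`. -/
def proj : Op := InnerProductSpace.rankOne ℂ (bv 0) (bv 0)

lemma proj_bv (j : ℕ) : proj (bv j) = if j = 0 then bv 0 else 0 := by
  rw [proj, InnerProductSpace.rankOne_apply, inner_bv_bv]
  simp only [ite_smul, one_smul, zero_smul, eq_comm]

lemma proj_mul_proj : proj * proj = proj := by
  refine ext_bv fun j => ?_
  rw [mul_apply_eq_comp, proj_bv]
  split_ifs <;> simp [proj_bv]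

/-- The reflection part of the even extension `bv j ↦ bv (-j) + q ^ j • bv j`. -/
def evenReflect (q : ℝ) (h0 : 0 ≤ q) (h1 : q ≤ 1) : Op := star shift * powDiag q h0 h1

/-- The reflection part of the odd extension `bv j ↦ bv (-j) - q ^ (j + 1) • bv (j + 2)`. -/
def oddReflect (q : ℝ) (h0 : 0 ≤ q) (h1 : q ≤ 1) : Op := (-(q : ℂ)) • (shift * powDiag q h0 h1)

lemma evenReflect_bv_zero (h0 : 0 ≤ q) (h1 : q ≤ 1) : evenReflect q h0 h1 (bv 0) = 0 := by
  rw [evenReflect, mul_apply_eq_comp, powDiag_bv, map_smul, star_shift_bv_zero, smul_zero]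

lemma evenReflect_bv_succ (h0 : 0 ≤ q) (h1 : q ≤ 1) (j : ℕ) :
    evenReflect q h0 h1 (bv (j + 1)) = (q : ℂ) ^ (j + 1) • bv j := by
  rw [evenReflect, mul_apply_eq_comp, powDiag_bv, map_smul, star_shift_bv_succ]

lemma oddReflect_bv (h0 : 0 ≤ q) (h1 : q ≤ 1) (j : ℕ) :
    oddReflect q h0 h1 (bv j) = -((q : ℂ) ^ (j + 1) • bv (j + 1)) := by
  rw [oddReflect, _root_.smul_apply, mul_apply_eq_comp, powDiag_bv, map_smul, shift_bv, smul_smul,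
    ← neg_smul, pow_succ]
  congr 1
  ring

lemma unfold_even_bv (h0 : 0 ≤ q) (h1 : q ≤ 1) (j : ℕ) :
    unfold (1 + proj) (evenReflect q h0 h1) (bv j)
      = bv (-(j : ℤ)) + (q : ℂ) ^ j • bv (j : ℤ) := by
  rw [unfold_apply, _root_.add_apply, one_apply_eq_self, map_add, incl_bv, proj_bv]
  cases j with
  | zero => simp [evenReflect_bv_zero, incl_bv]
  | succ j => simp [evenReflect_bv_succ, coincl_bv]

lemma unfold_odd_bv (h0 : 0 ≤ q) (h1 : q ≤ 1) (j : ℕ) :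
    unfold 1 (oddReflect q h0 h1) (bv j)
      = bv (-(j : ℤ)) - (q : ℂ) ^ (j + 1) • bv ((j : ℤ) + 2) := by
  rw [unfold_apply, one_apply_eq_self, incl_bv, oddReflect_bv, map_neg, map_smul, coincl_bv,
    ← sub_eq_add_neg]
  push_cast
  rw [add_assoc, one_add_one_eq_two]

/-- The even extension. It maps `bv 0` to `2 • bv 0`, whence the term `proj` and, in the limit, the
factor `2`. -/
lemma isFold_even (h0 : 0 ≤ q) (h1 : q ≤ 1) :
    IsFold q (1 + proj) (1 - (2⁻¹ : ℂ) • proj) (evenReflect q h0 h1) where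
  nonneg := h0
  le_one := h1
  mul_inv := by
    have : (1 + proj) * (1 - (2⁻¹ : ℂ) • proj)
        = 1 + proj - (2⁻¹ : ℂ) • proj - (2⁻¹ : ℂ) • (proj * proj) := by
      simp only [add_mul, mul_sub, mul_smul_comm, one_mul, mul_one, smul_add]
      abel
    rw [this, proj_mul_proj]
    module
  inv_mul := by
    have : (1 - (2⁻¹ : ℂ) • proj) * (1 + proj)
        = 1 + proj - (2⁻¹ : ℂ) • proj - (2⁻¹ : ℂ) • (proj * proj) := by
      simp only [sub_mul, mul_add, smul_mul_assoc, one_mul, mul_one]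
      abel
    rw [this, proj_mul_proj]
    module
  reflect_mul_inv := by
    rw [mul_sub, mul_one, sub_eq_self, mul_smul_comm, smul_eq_zero]
    right
    -- `evenReflect` vanishes on the range of `proj`
    refine ext_bv fun j => ?_
    rw [mul_apply_eq_comp, proj_bv, _root_.zero_apply]
    split_ifs
    · exact evenReflect_bv_zero h0 h1
    · exact map_zero _
  isFiniteRank := by
    rw [add_sub_cancel_left]
    exact IsFiniteRank.rankOne _ _
  multLE := (multLE_shift.star.mul (multLE_powDiag h0 h1)).mono (one_mul 1).le
  intertwine := by
    set W := unfold (1 + proj) (evenReflect q h0 h1)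
    let Γ : Op := shift + (q : ℂ) • star shift + shift * proj
    have h : (bishift + (q : ℂ) • star bishift) ∘L W = W ∘L Γ := by
      refine ext_bv fun j => ?_
      simp only [ContinuousLinearMap.comp_apply, Γ, _root_.add_apply, _root_.smul_apply,
        mul_apply_eq_comp, map_add, map_smul, shift_bv, proj_bv, W, unfold_even_bv, bishift_bv,
        star_bishift_bv]
      cases j with
      | zero =>
        simp only [star_shift_bv_zero, map_zero, if_pos, shift_bv, unfold_even_bv]
        norm_num
      | succ j =>
        simp only [star_shift_bv_succ, unfold_even_bv, if_neg (Nat.succ_ne_zero j), map_zero]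
        push_cast
        rw [show -((j : ℤ) + 1) + 1 = -j by ring, show (j : ℤ) + 1 - 1 = j by ring,
          show -((j : ℤ) + 1) - 1 = -(j + 1 + 1) by ring]
        simp only [pow_succ]
        module
    exact ⟨Γ, fun x => congrArg (fun A => A x) h⟩

lemma isFold_odd (h0 : 0 ≤ q) (h1 : q ≤ 1) : IsFold q 1 1 (oddReflect q h0 h1) where
  nonneg := h0
  le_one := h1
  mul_inv := one_mul 1
  inv_mul := one_mul 1
  reflect_mul_inv := mul_one _
  isFiniteRank := by
    rw [sub_self]
    exact IsFiniteRank.zero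
  multLE := by
    refine ((multLE_shift.mul (multLE_powDiag h0 h1)).smul (-(q : ℂ))).mono ?_
    rw [norm_neg, Complex.norm_real, Real.norm_of_nonneg h0]
    linarith
  intertwine := by
    set W := unfold 1 (oddReflect q h0 h1)
    let Γ : Op := shift + (q : ℂ) • star shift
    have h : (bishift + (q : ℂ) • star bishift) ∘L W = W ∘L Γ := by
      refine ext_bv fun j => ?_
      simp only [ContinuousLinearMap.comp_apply, Γ, _root_.add_apply, _root_.smul_apply,
        map_add, map_sub, map_smul, shift_bv, W, unfold_odd_bv, bishift_bv, star_bishift_bv]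
      cases j with
      | zero =>
        simp only [star_shift_bv_zero, map_zero]
        norm_num
        module
      | succ j =>
        simp only [star_shift_bv_succ, unfold_odd_bv]
        push_cast
        rw [show -((j : ℤ) + 1) + 1 = -j by ring, show (j : ℤ) + 1 + 2 - 1 = j + 2 by ring,
          show -((j : ℤ) + 1) - 1 = -(j + 1 + 1) by ring,
          show (j : ℤ) + 1 + 2 + 1 = j + 1 + 1 + 2 by ring]
        simp only [pow_succ]
        module
    exact ⟨Γ, fun x => congrArg (fun A => A x) h⟩

/-- The linear part of the exponent contributed by the reflection. -/
def reflectExponent (q : ℝ) (γ : ℕ → ℂ) : ℂ := ∑' k : ℕ, (q : ℂ) ^ (k + 1) * γ (2 * k + 1)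

lemma hasSum_reflectExponent (h0 : 0 ≤ q) (h1 : q ≤ 1) (hγ : IsKrein γ) :
    HasSum (fun k : ℕ => (q : ℂ) ^ (k + 1) * γ (2 * k + 1)) (reflectExponent q γ) := by
  have hinj : Function.Injective fun k : ℕ => 2 * k + 1 := fun i j h => by
    simp only at h
    omega
  refine (Summable.of_norm_bounded (hγ.summable.comp_injective hinj) fun k => ?_).hasSum
  rw [norm_mul]
  exact mul_le_of_le_one_left (norm_nonneg _) ((isFold_odd h0 h1).norm_pow_le _)

lemma tendsto_trace_even (h0 : 0 ≤ q) (h1 : q ≤ 1) (hγ : IsKrein γ) :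
    Tendsto (fun n => ∑ i ∈ Finset.range n, entry (hankel γ * evenReflect q h0 h1) i i) atTop
      (𝓝 (reflectExponent q γ)) := by
  have hz : entry (hankel γ * evenReflect q h0 h1) 0 0 = 0 := by
    rw [entry, mul_apply_eq_comp, evenReflect_bv_zero, map_zero, inner_zero_right]
  have hs : ∀ i : ℕ, entry (hankel γ * evenReflect q h0 h1) (i + 1) (i + 1)
      = (q : ℂ) ^ (i + 1) * γ (2 * i + 1) := by
    intro i
    rw [entry, mul_apply_eq_comp, evenReflect_bv_succ, map_smul, inner_smul_right, ← entry,
      entry_hankel hγ.summable]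
    congr 2
    ring
  have := (hasSum_nat_add_iff (f := fun i => entry (hankel γ * evenReflect q h0 h1) i i) 1).1
    ((hasSum_reflectExponent h0 h1 hγ).congr_fun fun i => hs i)
  rw [Finset.sum_range_one, hz, add_zero] at this
  exact this.tendsto_sum_nat

lemma tendsto_trace_odd (h0 : 0 ≤ q) (h1 : q ≤ 1) (hγ : IsKrein γ) :
    Tendsto (fun n => ∑ i ∈ Finset.range n, entry (hankel γ * oddReflect q h0 h1) i i) atTop
      (𝓝 (-reflectExponent q γ)) := by
  refine ((hasSum_reflectExponent h0 h1 hγ).neg.congr_fun fun i => ?_).tendsto_sum_nat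
  rw [entry, mul_apply_eq_comp, oddReflect_bv, map_neg, map_smul, inner_neg_right,
    inner_smul_right, ← entry, entry_hankel hγ.summable]
  congr 3
  ring

lemma opDet_one_add_proj : opDet (1 + proj) = 2 := by
  have hd : DetClass (1 + proj) := (isFold_even (q := 0) le_rfl zero_le_one).detClass
  refine tendsto_nhds_unique ((tendsto_add_atTop_iff_nat 1).2 hd.tendsto)
    (tendsto_const_nhds.congr fun n => ?_)
  have h : corner (1 + proj) (n + 1)
      = Matrix.diagonal fun i : Fin (n + 1) => if i = 0 then (2 : ℂ) else 1 := by
    ext i j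
    rw [corner, Matrix.of_apply, entry_add, entry_one, Matrix.diagonal_apply, entry, proj_bv]
    by_cases hij : i = j
    · subst hij
      by_cases h0 : i = 0
      · subst h0
        simp only [Fin.val_zero, if_pos, inner_bv_bv]
        norm_num
      · have h0' : (i : ℕ) ≠ 0 := fun h => h0 (Fin.ext h)
        simp [h0, h0']
    · have hij' : (i : ℕ) ≠ j := fun h => hij (Fin.ext h)
      by_cases h0 : (j : ℕ) = 0
      · have h0' : (i : ℕ) ≠ 0 := fun h => hij' (h.trans h0.symm)
        rw [if_pos h0, if_neg hij, if_neg hij', inner_bv_bv, if_neg h0', add_zero]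
      · simp [h0, hij, hij']
  rw [h, Matrix.det_diagonal, Fin.prod_univ_succ]
  simp [Fin.succ_ne_zero]

theorem tendsto_det_even (h0 : 0 ≤ q) (h1 : q ≤ 1) (hβ : IsKrein β) (hγ : IsKrein γ) :
    Tendsto (fun n => (Matrix.of fun i j : Fin n => laurentCoeff β γ ((j : ℤ) - i)
        + (q : ℂ) ^ (j : ℕ) * laurentCoeff β γ (-(i : ℤ) - j)).det) atTop
      (𝓝 (2 * Complex.exp (szegoExponent β γ + reflectExponent q γ
        - szegoExponent (twist q γ) γ / 2))) := by
  have h := (isFold_even h0 h1).tendsto_det_corner hβ hγ (tendsto_trace_even h0 h1 hγ)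
  rw [opDet_one_add_proj] at h
  refine h.congr fun n => congrArg Matrix.det ?_
  ext i j
  rw [corner, Matrix.of_apply, Matrix.of_apply, entry_up_mul_folded hβ, unfold_even_bv]
  simp only [map_add, map_smul, inner_add_right, inner_smul_right, inner_bv_laurent hβ hγ]
  congr 2
  ring

theorem tendsto_det_odd (h0 : 0 ≤ q) (h1 : q ≤ 1) (hβ : IsKrein β) (hγ : IsKrein γ) :
    Tendsto (fun n => (Matrix.of fun i j : Fin n => laurentCoeff β γ ((j : ℤ) - i)
        - (q : ℂ) ^ ((j : ℕ) + 1) * laurentCoeff β γ (-(i : ℤ) - j - 2)).det) atTop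
      (𝓝 (Complex.exp (szegoExponent β γ - reflectExponent q γ
        - szegoExponent (twist q γ) γ / 2))) := by
  have h := (isFold_odd h0 h1).tendsto_det_corner hβ hγ (tendsto_trace_odd h0 h1 hγ)
  rw [opDet_one, one_mul, ← sub_eq_add_neg] at h
  refine h.congr fun n => congrArg Matrix.det ?_
  ext i j
  rw [corner, Matrix.of_apply, Matrix.of_apply, entry_up_mul_folded hβ, unfold_odd_bv]
  simp only [map_sub, map_smul, inner_sub_right, inner_smul_right, inner_bv_laurent hβ hγ]
  rw [show -(i : ℤ) - -(j : ℤ) = j - i by ring, show -(i : ℤ) - (j + 2) = -i - j - 2 by ring]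

end Reflections

/-! ### Functions on the circle -/

instance factTwoPi : Fact (0 < 2 * Real.pi) := ⟨Real.two_pi_pos⟩

/-- Continuous functions on the circle `ℝ / 2πℤ`. -/
abbrev CircleFun : Type := C(AddCircle (2 * Real.pi), ℂ)

/-- The sequence of Fourier coefficients of a continuous function. -/
def fourierMap : CircleFun →L[ℂ] Ell2 ℤ :=
  (fourierBasis (T := 2 * Real.pi)).repr.toContinuousLinearEquiv.toContinuousLinearMap ∘L
    ContinuousMap.toLp 2 AddCircle.haarAddCircle ℂ

lemma inner_bv_fourierMap (n : ℤ) (u : CircleFun) : ⟪bv n, fourierMap u⟫_ℂ = fourierCoeff u n := by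
  rw [inner_bv_left]
  exact (fourierBasis_repr _ n).trans (fourierCoeff_toLp u n)

lemma fourierCoeff_fourier_mul (k n : ℤ) (u : CircleFun) :
    fourierCoeff (fourier k * u : CircleFun) n = fourierCoeff u (n - k) := by
  unfold fourierCoeff
  congr 1
  funext t
  rw [ContinuousMap.mul_apply, smul_eq_mul, smul_eq_mul, ← mul_assoc, ← fourier_add, neg_sub,
    neg_add_eq_sub]

lemma fourierMap_fourier_neg_one_mul (u : CircleFun) :
    fourierMap (fourier (-1) * u) = bishift (fourierMap u) := by
  refine ext_inner_bv fun n => ?_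
  rw [inner_bv_fourierMap, ← ContinuousLinearMap.adjoint_inner_left,
    ← ContinuousLinearMap.star_eq_adjoint, star_bishift_bv, inner_bv_fourierMap,
    fourierCoeff_fourier_mul, sub_neg_eq_add]

lemma fourierMap_fourier_one_mul (u : CircleFun) :
    fourierMap (fourier 1 * u) = star bishift (fourierMap u) := by
  have h1 : (fourier (-1) : CircleFun) * (fourier 1 * u) = u := by
    ext t
    simp only [ContinuousMap.mul_apply]
    rw [← mul_assoc, ← fourier_add]
    simp
  have h2 := fourierMap_fourier_neg_one_mul (fourier 1 * u)
  rw [h1] at h2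
  rw [h2, ← mul_apply_eq_comp, star_bishift_mul, one_apply_eq_self]

lemma fourierMap_one : fourierMap 1 = bv 0 := by
  refine ext_inner_bv fun n => ?_
  have h : (1 : CircleFun) = fourier 0 := by
    ext t
    simp
  rw [inner_bv_fourierMap, inner_bv_bv, h, fourierCoeff_fourier]
  simp [Pi.single_apply]

/-- Multiplication by `a` corresponds to the operator `X` under the Fourier transform. -/
def Represents (a : CircleFun) (X : Ell2 ℤ →L[ℂ] Ell2 ℤ) : Prop :=
  ∀ u, fourierMap (a * u) = X (fourierMap u)

namespace Represents

variable {a b : CircleFun} {X Y : Ell2 ℤ →L[ℂ] Ell2 ℤ}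

lemma one : Represents 1 1 := fun u => by rw [one_mul, one_apply_eq_self]

lemma mul (ha : Represents a X) (hb : Represents b Y) : Represents (a * b) (X * Y) := fun u => by
  rw [mul_assoc, ha, hb, mul_apply_eq_comp]

lemma smul (ha : Represents a X) (z : ℂ) : Represents (z • a) (z • X) := fun u => by
  rw [smul_mul_assoc, map_smul, ha, _root_.smul_apply]

lemma pow (ha : Represents a X) (n : ℕ) : Represents (a ^ n) (X ^ n) := by
  induction n with
  | zero => simpa using one
  | succ n ih => rw [pow_succ, pow_succ]; exact ih.mul ha

lemma hasSum {f : ℕ → CircleFun} {g : ℕ → Ell2 ℤ →L[ℂ] Ell2 ℤ}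
    (h : ∀ n, Represents (f n) (g n)) (hf : HasSum f a) (hg : HasSum g X) : Represents a X := by
  intro u
  have h1 := (hf.mul_right u).mapL fourierMap
  have h2 := hg.mapL (ContinuousLinearMap.apply ℂ (Ell2 ℤ) (fourierMap u))
  exact h1.unique (h2.congr_fun fun n => h n u)

lemma ser {γ : ℕ → ℂ} (hγ : Summable fun k => ‖γ k‖) (ha : Represents a X) (ha1 : ‖a‖ ≤ 1)
    (hX : ‖X‖ ≤ 1) : Represents (ser γ a) (ser γ X) :=
  hasSum (fun _ => (ha.pow _).smul _) (hasSum_ser hγ ha1) (hasSum_ser hγ hX)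

lemma exp (ha : Represents a X) : Represents (NormedSpace.exp a) (NormedSpace.exp X) :=
  hasSum (fun _ => (ha.pow _).smul _) (hasSum_exp a) (hasSum_exp X)

end Represents

lemma ser_apply {γ : ℕ → ℂ} (hγ : Summable fun k => ‖γ k‖) {a : CircleFun} (ha : ‖a‖ ≤ 1)
    (t : AddCircle (2 * Real.pi)) : ser γ a t = ∑' k, γ k * a t ^ (k + 1) :=
  (((hasSum_ser hγ ha).mapL (ContinuousMap.evalCLM ℂ t)).tsum_eq).symm

lemma exp_apply (a : CircleFun) (t : AddCircle (2 * Real.pi)) :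
    NormedSpace.exp a t = Complex.exp (a t) := by
  have h1 := (hasSum_exp a).mapL (ContinuousMap.evalCLM ℂ t)
  have h2 := hasSum_exp (a t)
  rw [← Complex.exp_eq_exp_ℂ] at h2
  exact h1.unique h2

/-- The function `θ ↦ exp (∑ β k exp (i (k + 1) θ) + ∑ γ k exp (-i (k + 1) θ))` on the circle. -/
def circleSymbol (β γ : ℕ → ℂ) : CircleFun :=
  NormedSpace.exp (ser β (fourier 1)) * NormedSpace.exp (ser γ (fourier (-1)))

/-- Under the Fourier transform, Laurent operators become multiplication operators. -/
lemma laurentCoeff_eq_fourierCoeff {β γ : ℕ → ℂ} (hβ : IsKrein β) (hγ : IsKrein γ) (l : ℤ) :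
    laurentCoeff β γ l = fourierCoeff (circleSymbol β γ) l := by
  have h1 : Represents (fourier 1) (star bishift) := fourierMap_fourier_one_mul
  have h2 : Represents (fourier (-1)) bishift := fourierMap_fourier_neg_one_mul
  have h := ((h1.ser hβ.summable (fourier_norm _).le norm_star_bishift_le).exp).mul
    ((h2.ser hγ.summable (fourier_norm _).le norm_bishift_le).exp) 1
  rw [mul_one, fourierMap_one] at h
  rw [laurentCoeff, ← inner_bv_fourierMap, circleSymbol, h]
  rfl

/-- The coefficients `ρ k * r ^ k`, reindexed by `ℕ` so that the first one has index `0`. They are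
used with radius `r` for the positive and with `r⁻¹` for the negative powers of `z`. -/
def scaled (r : ℝ) (ρ : ℕ+ → ℂ) (k : ℕ) : ℂ := ρ k.succPNat * (r : ℂ) ^ (k + 1)

lemma isKrein_scaled {r : ℝ} (hr : 0 < r) {ρ : ℕ+ → ℂ}
    (h1 : Summable fun k : ℕ+ => ‖ρ k‖ * r ^ (k : ℕ))
    (h2 : Summable fun k : ℕ+ => (k : ℝ) * (‖ρ k‖ * r ^ (k : ℕ)) ^ 2) : IsKrein (scaled r ρ) := by
  have hn : ∀ k : ℕ, ‖scaled r ρ k‖ = ‖ρ k.succPNat‖ * r ^ (k + 1) := fun k => by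
    rw [scaled, norm_mul, norm_pow, Complex.norm_real, Real.norm_of_nonneg hr.le]
  constructor
  · refine (Equiv.pnatEquivNat.symm.summable_iff.2 h1).congr fun k => ?_
    rw [hn]
    rfl
  · refine (Equiv.pnatEquivNat.symm.summable_iff.2 h2).congr fun k => ?_
    rw [hn]
    simp [Equiv.pnatEquivNat]

lemma tsum_scaled (r : ℝ) (ρ : ℕ+ → ℂ) (z : ℂ) :
    ∑' k, scaled r ρ k * z ^ (k + 1) = ∑' k : ℕ+, ρ k * ((r : ℂ) * z) ^ (k : ℕ) := by
  rw [← Equiv.pnatEquivNat.symm.tsum_eq]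
  refine tsum_congr fun k => ?_
  simp only [scaled, mul_pow, mul_assoc, Equiv.pnatEquivNat]
  rfl

section Symbol

variable {r : ℝ} {ρp ρm : ℕ+ → ℂ}

lemma circleSymbol_apply (hp : IsKrein (scaled r ρp)) (hm : IsKrein (scaled r⁻¹ ρm)) (θ : ℝ) :
    circleSymbol (scaled r ρp) (scaled r⁻¹ ρm) (θ : AddCircle (2 * Real.pi))
      = symbol ρp ρm (circleMap 0 r θ) := by
  have e1 : (fourier 1 (θ : AddCircle (2 * Real.pi)) : ℂ) = Complex.exp (θ * Complex.I) := by
    rw [fourier_coe_apply]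
    congr 1
    push_cast
    field_simp
  have e2 : (fourier (-1) (θ : AddCircle (2 * Real.pi)) : ℂ) = (Complex.exp (θ * Complex.I))⁻¹ := by
    rw [← Complex.exp_neg, fourier_coe_apply]
    congr 1
    push_cast
    field_simp
  rw [circleSymbol, ContinuousMap.mul_apply, exp_apply, exp_apply, ← Complex.exp_add,
    ser_apply hp.summable (fourier_norm _).le, ser_apply hm.summable (fourier_norm _).le, e1, e2,
    tsum_scaled, tsum_scaled, symbol, Rplus, Rminus, circleMap_zero, mul_inv, Complex.ofReal_inv]

lemma coeff_symbol (hr : 0 < r) (hp : IsKrein (scaled r ρp)) (hm : IsKrein (scaled r⁻¹ ρm))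
    (k : ℤ) : coeff r (symbol ρp ρm) k
      = (r : ℂ) ^ k * laurentCoeff (scaled r ρp) (scaled r⁻¹ ρm) (-k) := by
  have hr' : (r : ℂ) ≠ 0 := by exact_mod_cast hr.ne'
  have h : ∀ θ : ℝ, deriv (circleMap 0 r) θ • (symbol ρp ρm (circleMap 0 r θ)
        * circleMap 0 r θ ^ (k - 1))
      = (Complex.I * (r : ℂ) ^ k) * (fourier (- -k) (θ : AddCircle (2 * Real.pi))
        • circleSymbol (scaled r ρp) (scaled r⁻¹ ρm) (θ : AddCircle (2 * Real.pi))) := by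
    intro θ
    have h0 : circleMap 0 r θ ≠ 0 := circleMap_ne_center hr.ne'
    have h1 : circleMap 0 r θ ^ k
        = (r : ℂ) ^ k * fourier (- -k) (θ : AddCircle (2 * Real.pi)) := by
      rw [circleMap_zero, mul_zpow, ← Complex.exp_int_mul, fourier_coe_apply, neg_neg]
      congr 2
      push_cast
      field_simp
    rw [circleSymbol_apply hp hm, deriv_circleMap, zpow_sub_one₀ h0, h1, smul_eq_mul, smul_eq_mul]
    field_simp
  rw [laurentCoeff_eq_fourierCoeff hp hm, fourierCoeff_eq_intervalIntegral _ _ 0, coeff,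
    circleIntegral]
  simp only [h]
  rw [intervalIntegral.integral_const_mul, zero_add, Complex.real_smul]
  push_cast
  field_simp

end Symbol

/-! ### Toeplitz+Hankel determinants -/

lemma det_conj_diagonal {n : ℕ} (A : Matrix (Fin n) (Fin n) ℂ) {c : Fin n → ℂ}
    (hc : ∀ i, c i ≠ 0) : (Matrix.of fun i j => c i * (c j)⁻¹ * A i j).det = A.det := by
  have h1 := Matrix.det_mul_row (fun j => (c j)⁻¹) A
  have h2 := Matrix.det_mul_column c (Matrix.of fun i j => (c j)⁻¹ * A i j)
  rw [h1, ← mul_assoc, ← Finset.prod_mul_distrib,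
    Finset.prod_eq_one fun i _ => mul_inv_cancel₀ (hc i), one_mul] at h2
  rw [← h2]
  congr 1
  ext i j
  simp only [Matrix.of_apply, mul_assoc]

section Limits

variable {r : ℝ} {ρp ρm : ℕ+ → ℂ}

lemma coeff_sub (hr : 0 < r) (hp : IsKrein (scaled r ρp)) (hm : IsKrein (scaled r⁻¹ ρm))
    (i j : ℕ) : coeff r (symbol ρp ρm) ((i : ℤ) - j)
      = (r : ℂ) ^ i * ((r : ℂ) ^ j)⁻¹
        * laurentCoeff (scaled r ρp) (scaled r⁻¹ ρm) ((j : ℤ) - i) := by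
  have hr' : (r : ℂ) ≠ 0 := by exact_mod_cast hr.ne'
  rw [coeff_symbol hr hp hm, zpow_sub₀ hr', zpow_natCast, zpow_natCast, neg_sub, div_eq_mul_inv]

/-- The circle of radius `r` turns the reflection `t ↦ 1 / t` into `t ↦ r ^ 2 / t`: after
conjugation by powers of `r`, the Hankel part carries the weight `(r ^ 2) ^ (j + κ)`. -/
lemma coeff_add (hr : 0 < r) (hp : IsKrein (scaled r ρp)) (hm : IsKrein (scaled r⁻¹ ρm))
    (i j κ : ℕ) : coeff r (symbol ρp ρm) ((i : ℤ) + j + 2 * κ)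
      = (r : ℂ) ^ i * ((r : ℂ) ^ j)⁻¹ * (((r ^ 2 : ℝ) : ℂ) ^ (j + κ)
        * laurentCoeff (scaled r ρp) (scaled r⁻¹ ρm) (-(i : ℤ) - j - 2 * κ)) := by
  have hr' : (r : ℂ) ≠ 0 := by exact_mod_cast hr.ne'
  have h1 : (r : ℂ) ^ ((i : ℤ) + j + 2 * κ) = (r : ℂ) ^ (i + j + 2 * κ) := by
    rw [← zpow_natCast]
    push_cast
    rfl
  rw [coeff_symbol hr hp hm, h1, show -((i : ℤ) + j + 2 * κ) = -(i : ℤ) - j - 2 * κ by ring]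
  push_cast
  rw [← pow_mul]
  field_simp
  ring

lemma detPlus_coeff (hr : 0 < r) (hp : IsKrein (scaled r ρp)) (hm : IsKrein (scaled r⁻¹ ρm))
    (n : ℕ) : (Matrix.of fun i j : Fin n =>
        laurentCoeff (scaled r ρp) (scaled r⁻¹ ρm) ((j : ℤ) - i) + ((r ^ 2 : ℝ) : ℂ) ^ (j : ℕ)
          * laurentCoeff (scaled r ρp) (scaled r⁻¹ ρm) (-(i : ℤ) - j)).det
      = detPlus (coeff r (symbol ρp ρm)) n := by
  have hr' : (r : ℂ) ≠ 0 := by exact_mod_cast hr.ne'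
  rw [detPlus, ← det_conj_diagonal _ (c := fun i : Fin n => (r : ℂ) ^ (i : ℕ))
    fun i => pow_ne_zero _ hr']
  congr 1
  ext i j
  have h := coeff_add hr hp hm i j 0
  simp only [CharP.cast_eq_zero, mul_zero, add_zero, sub_zero] at h
  simp only [Matrix.of_apply]
  rw [coeff_sub hr hp hm, h, mul_add]

lemma detMinus_coeff (hr : 0 < r) (hp : IsKrein (scaled r ρp)) (hm : IsKrein (scaled r⁻¹ ρm))
    (n : ℕ) : (Matrix.of fun i j : Fin n =>
        laurentCoeff (scaled r ρp) (scaled r⁻¹ ρm) ((j : ℤ) - i) - ((r ^ 2 : ℝ) : ℂ) ^ ((j : ℕ) + 1)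
          * laurentCoeff (scaled r ρp) (scaled r⁻¹ ρm) (-(i : ℤ) - j - 2)).det
      = detMinus (coeff r (symbol ρp ρm)) n := by
  have hr' : (r : ℂ) ≠ 0 := by exact_mod_cast hr.ne'
  rw [detMinus, ← det_conj_diagonal _ (c := fun i : Fin n => (r : ℂ) ^ (i : ℕ))
    fun i => pow_ne_zero _ hr']
  congr 1
  ext i j
  have h := coeff_add hr hp hm i j 1
  simp only [Nat.cast_one, mul_one] at h
  simp only [Matrix.of_apply]
  rw [coeff_sub hr hp hm, h, mul_sub]

lemma scaled_mul_scaled_inv (hr0 : 0 < r) (ρ σ : ℕ+ → ℂ) (k : ℕ) :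
    scaled r ρ k * scaled r⁻¹ σ k = ρ k.succPNat * σ k.succPNat := by
  have hr' : (r : ℂ) ≠ 0 := by exact_mod_cast hr0.ne'
  simp only [scaled, Complex.ofReal_inv, inv_pow]
  field_simp

lemma twist_scaled_inv (hr0 : 0 < r) (ρ : ℕ+ → ℂ) (k : ℕ) :
    twist (r ^ 2) (scaled r⁻¹ ρ) k * scaled r⁻¹ ρ k = ρ k.succPNat ^ 2 := by
  have hr' : (r : ℂ) ≠ 0 := by exact_mod_cast hr0.ne'
  simp only [twist, scaled, Complex.ofReal_inv, Complex.ofReal_pow, inv_pow]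
  field_simp
  ring

lemma reflect_scaled_inv (hr0 : 0 < r) (ρ : ℕ+ → ℂ) (k : ℕ) :
    ((r ^ 2 : ℝ) : ℂ) ^ (k + 1) * scaled r⁻¹ ρ (2 * k + 1) = ρ (2 * k.succPNat) := by
  have hr' : (r : ℂ) ≠ 0 := by exact_mod_cast hr0.ne'
  have h : (2 * k + 1).succPNat = 2 * k.succPNat := by
    apply PNat.eq
    simp only [Nat.succPNat_coe, PNat.mul_coe, PNat.val_ofNat]
    omega
  rw [scaled, h, Complex.ofReal_pow, ← pow_mul, Complex.ofReal_inv, inv_pow,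
    show 2 * (k + 1) = 2 * k + 1 + 1 by ring]
  field_simp

/-- Both exponents in terms of the scaled coefficients; the radius cancels. -/
lemma summable_exponent_and_tsum_eq (hr0 : 0 < r) (hr1 : r ≤ 1) (hp : IsKrein (scaled r ρp))
    (hm : IsKrein (scaled r⁻¹ ρm)) :
    (Summable fun k => ‖exponentSp ρp ρm k‖) ∧
    (∑' k, exponentSp ρp ρm k = szegoExponent (scaled r ρp) (scaled r⁻¹ ρm)
      + reflectExponent (r ^ 2) (scaled r⁻¹ ρm)
      - szegoExponent (twist (r ^ 2) (scaled r⁻¹ ρm)) (scaled r⁻¹ ρm) / 2) ∧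
    (Summable fun k => ‖exponentO ρp ρm k‖) ∧
    (∑' k, exponentO ρp ρm k = szegoExponent (scaled r ρp) (scaled r⁻¹ ρm)
      - reflectExponent (r ^ 2) (scaled r⁻¹ ρm)
      - szegoExponent (twist (r ^ 2) (scaled r⁻¹ ρm)) (scaled r⁻¹ ρm) / 2) := by
  have hq0 : 0 ≤ r ^ 2 := by positivity
  have hq1 : r ^ 2 ≤ 1 := pow_le_one₀ hr0.le hr1
  have hK : ∀ {β γ : ℕ → ℂ}, IsKrein β → IsKrein γ →
      HasSum (fun k : ℕ => ((k : ℂ) + 1) * (β k * γ k)) (szegoExponent β γ) := by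
    intro β γ hβ hγ
    refine (Summable.of_norm_bounded (hβ.summable_mul hγ) fun k => le_of_eq ?_).hasSum
    rw [norm_mul, norm_mul]
    congr 1
    exact_mod_cast Complex.norm_natCast (k + 1)
  have h1 := hK hp hm
  have h2 := hasSum_reflectExponent hq0 hq1 hm
  have h3 := (hK ((isFold_odd hq0 hq1).isKrein_twist hm) hm).div_const 2
  simp only [scaled_mul_scaled_inv hr0, reflect_scaled_inv hr0, twist_scaled_inv hr0] at h1 h2 h3
  have hSp := (h1.add h2).sub h3
  have hO := (h1.sub h2).sub h3
  have e1 : HasSum (exponentSp ρp ρm) _ := Equiv.pnatEquivNat.symm.hasSum_iff.1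
    (hSp.congr_fun fun k => by
      simp only [Function.comp_apply, exponentSp, Equiv.pnatEquivNat, Equiv.coe_fn_symm_mk,
        Nat.succPNat_coe]
      push_cast
      ring)
  have e2 : HasSum (exponentO ρp ρm) _ := Equiv.pnatEquivNat.symm.hasSum_iff.1
    (hO.congr_fun fun k => by
      simp only [Function.comp_apply, exponentO, Equiv.pnatEquivNat, Equiv.coe_fn_symm_mk,
        Nat.succPNat_coe]
      push_cast
      ring)
  exact ⟨e1.summable.norm, e1.tsum_eq, e2.summable.norm, e2.tsum_eq⟩

theorem tendsto_D1 (hr0 : 0 < r) (hr1 : r ≤ 1) (hp : IsKrein (scaled r ρp))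
    (hm : IsKrein (scaled r⁻¹ ρm)) :
    Tendsto (fun n => (1 / 2 : ℂ) * D1 r ρp ρm n) atTop
      (𝓝 (Complex.exp (∑' k, exponentSp ρp ρm k))) := by
  have h := tendsto_det_even (sq_nonneg r) (pow_le_one₀ hr0.le hr1) hp hm
  rw [← (summable_exponent_and_tsum_eq hr0 hr1 hp hm).2.1] at h
  simp only [detPlus_coeff hr0 hp hm] at h
  have h' := h.const_mul (1 / 2 : ℂ)
  rw [← mul_assoc, one_div_mul_cancel two_ne_zero, one_mul] at h'
  exact h'

theorem tendsto_D3 (hr0 : 0 < r) (hr1 : r ≤ 1) (hp : IsKrein (scaled r ρp))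
    (hm : IsKrein (scaled r⁻¹ ρm)) :
    Tendsto (D3 r ρp ρm) atTop (𝓝 (Complex.exp (∑' k, exponentO ρp ρm k))) := by
  have h := tendsto_det_odd (sq_nonneg r) (pow_le_one₀ hr0.le hr1) hp hm
  rw [← (summable_exponent_and_tsum_eq hr0 hr1 hp hm).2.2.2] at h
  simp only [detMinus_coeff hr0 hp hm] at h
  exact h

end Limits

/-! ### The dual symbol -/

/-- The coefficients of the logarithm of the dual symbol. -/
def dualCoeff (ρ : ℕ+ → ℂ) (k : ℕ+) : ℂ := -((-1) ^ (k : ℕ) * ρ k)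

lemma norm_dualCoeff (ρ : ℕ+ → ℂ) (k : ℕ+) : ‖dualCoeff ρ k‖ = ‖ρ k‖ := by
  simp [dualCoeff]

lemma tsum_dualCoeff (ρ : ℕ+ → ℂ) (z : ℂ) :
    ∑' k : ℕ+, dualCoeff ρ k * z ^ (k : ℕ) = -∑' k : ℕ+, ρ k * (-z) ^ (k : ℕ) := by
  rw [← tsum_neg]
  refine tsum_congr fun k => ?_
  rw [dualCoeff, neg_pow z]
  ring

/-- The dual symbol is of the same form, so that the dual determinants need no separate
treatment. -/
lemma dualSymbol_eq (ρp ρm : ℕ+ → ℂ) :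
    dualSymbol ρp ρm = symbol (dualCoeff ρp) (dualCoeff ρm) := by
  funext z
  rw [dualSymbol, symbol, symbol, ← Complex.exp_neg]
  simp only [Rplus, Rminus]
  rw [tsum_dualCoeff, tsum_dualCoeff, inv_neg]
  congr 1
  ring

lemma dualCoeff_two_mul (ρ : ℕ+ → ℂ) (k : ℕ+) : dualCoeff ρ (2 * k) = -ρ (2 * k) := by
  simp [dualCoeff]

lemma dualCoeff_mul (ρ σ : ℕ+ → ℂ) (k : ℕ+) : dualCoeff ρ k * dualCoeff σ k = ρ k * σ k := by
  have h : ((-1 : ℂ) ^ (k : ℕ)) * (-1) ^ (k : ℕ) = 1 := by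
    rw [← mul_pow]
    norm_num
  rw [dualCoeff, dualCoeff]
  linear_combination ρ k * σ k * h

lemma exponentO_dualCoeff (ρp ρm : ℕ+ → ℂ) :
    exponentO (dualCoeff ρp) (dualCoeff ρm) = exponentSp ρp ρm := by
  funext k
  rw [exponentO, exponentSp, mul_assoc, dualCoeff_mul, sq, dualCoeff_mul, dualCoeff_two_mul]
  ring

lemma exponentSp_dualCoeff (ρp ρm : ℕ+ → ℂ) :
    exponentSp (dualCoeff ρp) (dualCoeff ρm) = exponentO ρp ρm := by
  funext k
  rw [exponentO, exponentSp, mul_assoc, dualCoeff_mul, sq, dualCoeff_mul, dualCoeff_two_mul]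
  ring

lemma D2_eq (r : ℝ) (ρp ρm : ℕ+ → ℂ) : D2 r ρp ρm = D3 r (dualCoeff ρp) (dualCoeff ρm) := by
  funext n
  rw [D2, D3, dualSymbol_eq]

lemma D4_eq (r : ℝ) (ρp ρm : ℕ+ → ℂ) : D4 r ρp ρm = D1 r (dualCoeff ρp) (dualCoeff ρm) := by
  funext n
  rw [D4, D1, dualSymbol_eq]

end ToeplitzHankel

end

theorem mainTheorem6 (ρp ρm : ℕ+ → ℂ) (r : ℝ) (hr0 : 0 < r) (hr1 : r ≤ 1)
    (hp1 : Summable fun k : ℕ+ => ‖ρp k‖ * r ^ (k : ℕ))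
    (hm1 : Summable fun k : ℕ+ => ‖ρm k‖ * r⁻¹ ^ (k : ℕ))
    (hp2 : Summable fun k : ℕ+ => (k : ℝ) * (‖ρp k‖ * r ^ (k : ℕ)) ^ 2)
    (hm2 : Summable fun k : ℕ+ => (k : ℝ) * (‖ρm k‖ * r⁻¹ ^ (k : ℕ)) ^ 2) :
    (Summable (fun k : ℕ+ => ‖ToeplitzHankel.exponentSp ρp ρm k‖) ∧
      Tendsto (fun n : ℕ => (1 / 2 : ℂ) * ToeplitzHankel.D1 r ρp ρm n) atTop
        (𝓝 (Complex.exp (∑' k : ℕ+, ToeplitzHankel.exponentSp ρp ρm k))) ∧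
      Tendsto (fun m : ℕ => ToeplitzHankel.D2 r ρp ρm m) atTop
        (𝓝 (Complex.exp (∑' k : ℕ+, ToeplitzHankel.exponentSp ρp ρm k)))) ∧
    (Summable (fun k : ℕ+ => ‖ToeplitzHankel.exponentO ρp ρm k‖) ∧
      Tendsto (fun n : ℕ => ToeplitzHankel.D3 r ρp ρm n) atTop
        (𝓝 (Complex.exp (∑' k : ℕ+, ToeplitzHankel.exponentO ρp ρm k))) ∧
      Tendsto (fun m : ℕ => (1 / 2 : ℂ) * ToeplitzHankel.D4 r ρp ρm m) atTop
        (𝓝 (Complex.exp (∑' k : ℕ+, ToeplitzHankel.exponentO ρp ρm k)))) := by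
  open ToeplitzHankel in
  have hr0' : 0 < r⁻¹ := inv_pos.2 hr0
  have hp := isKrein_scaled hr0 hp1 hp2
  have hm := isKrein_scaled hr0' hm1 hm2
  have hp' : IsKrein (scaled r (dualCoeff ρp)) :=
    isKrein_scaled hr0 (by simpa only [norm_dualCoeff] using hp1)
      (by simpa only [norm_dualCoeff] using hp2)
  have hm' : IsKrein (scaled r⁻¹ (dualCoeff ρm)) :=
    isKrein_scaled hr0' (by simpa only [norm_dualCoeff] using hm1)
      (by simpa only [norm_dualCoeff] using hm2)
  have h := summable_exponent_and_tsum_eq hr0 hr1 hp hm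
  have h2 := tendsto_D3 hr0 hr1 hp' hm'
  have h4 := tendsto_D1 hr0 hr1 hp' hm'
  rw [exponentO_dualCoeff, ← D2_eq] at h2
  rw [exponentSp_dualCoeff, ← D4_eq] at h4
  exact ⟨⟨h.1, tendsto_D1 hr0 hr1 hp hm, h2⟩, h.2.2.1, tendsto_D3 hr0 hr1 hp hm, h4⟩
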